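/- Let $n\in\mathbb N$, $n\ge 2$, $1<p<n$, $R>0$, $\frac1{p^*}=\frac1p-\frac1n$, and let $B_R\subset\mathbb R^n$ be the open ball of radius $R$ centered at the origin. For $q>0$, $q\ne1$, $r>0$ put $\log_q r=\frac{r^{1-q}-1}{1-q}$, and let $$S_{n,p}=\sqrt{\pi}\,n^{\frac1p}\left(\frac{n-p}{p-1}\right)^{\frac{p-1}{p}}\left[\frac{\Gamma(\frac np)\,\Gamma(n+1-\frac np)}{\Gamma(n)\,\Gamma(1+\frac n2)}\right]^{\frac1n}.$$ Then every real-valued radially symmetric $u\in W^{1,p}_0(B_R)$ satisfies $$S_{n,p}\left(\frac{n-p}{p-1}\right)^{\frac1n-1}\left(\int_{B_R}\frac{|u(x)|^{p^*}}{\left[\log_{\frac{n-1}{p-1}}\frac{R}{|x|}\right]^{\frac{p(n-1)}{n-p}}}\,dx\right)^{\frac1{p^*}}\le\|\nabla u\|_{L^p(B_R)}.\qquad(*)$$ The constant $S_{n,p}\left(\frac{n-p}{p-1}\right)^{\frac1n-1}$ is optimal: no larger constant can replace it in $(*)$. It is attained: for all $a,b>0$ the function $$U_R(x)=\left[a+b\left\{|x|^{-\frac{n-p}{p-1}}-R^{-\frac{n-p}{p-1}}\right\}^{-\frac{p}{n-p}}\right]^{1-\frac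 np}\quad(x\neq0),\qquad U_R(0)=a^{1-\frac np},$$ is a radially symmetric element of $W^{1,p}_0(B_R)$ with $\nabla U_R\not\equiv0$, and equality holds in $(*)$ for $u=U_R$. Furthermore, $(*)$ is invariant under the nonlinear scaling $$u_\lambda(x)=\lambda^{-\frac{p-1}{p}}u(x_\lambda),\qquad x_\lambda=\left[\lambda|x|^{-\frac{n-p}{p-1}}+(1-\lambda)R^{-\frac{n-p}{p-1}}\right]^{-\frac{p-1}{n-p}}\frac{x}{|x|},\qquad\lambda>0:$$ for every radially symmetric $u\in W^{1,p}_0(B_R)$ and every $\lambda>0$, the function $u_\lambda$ is again a radially symmetric element of $W^{1,p}_0(B_R)$, the integral on the left of $(*)$ is the same for $u_\lambda$ as for $u$, and $\|\nabla u_\lambda\|_{L^p(B_R)}=\|\nabla u\|_{L^p(B_R)}$. -/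

import Mathlib

open MeasureTheory Filter Topology
open scoped ENNReal

/-! ### Sobolev spaces with zero boundary values -/

/-- `φ ∈ C_c^∞(Ω)`: smooth with compact support contained in `Ω`. -/
def IsTestFunction {n : ℕ} (Ω : Set (EuclideanSpace ℝ (Fin n)))
    (φ : EuclideanSpace ℝ (Fin n) → ℝ) : Prop :=
  ContDiff ℝ ((⊤ : ℕ∞) : WithTop ℕ∞) φ ∧ HasCompactSupport φ ∧ tsupport φ ⊆ Ω

/-- `G` is the weak (distributional) gradient of `u` on the open set `Ω`. -/
def HasWeakGradient {n : ℕ} (Ω : Set (EuclideanSpace ℝ (Fin n)))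
    (u : EuclideanSpace ℝ (Fin n) → ℝ)
    (G : EuclideanSpace ℝ (Fin n) → EuclideanSpace ℝ (Fin n)) : Prop :=
  LocallyIntegrableOn u Ω ∧ LocallyIntegrableOn G Ω ∧
    ∀ φ, IsTestFunction Ω φ →
      ∫ x in Ω, u x • gradient φ x = -∫ x in Ω, φ x • G x

/-- `u ∈ W^{1,p}(Ω)` with weak gradient `∇u = G` (the gradient is unique up to null sets). -/
def MemW1p {n : ℕ} (p : ℝ) (Ω : Set (EuclideanSpace ℝ (Fin n)))
    (u : EuclideanSpace ℝ (Fin n) → ℝ)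
    (G : EuclideanSpace ℝ (Fin n) → EuclideanSpace ℝ (Fin n)) : Prop :=
  MemLp u (ENNReal.ofReal p) (volume.restrict Ω) ∧
    MemLp G (ENNReal.ofReal p) (volume.restrict Ω) ∧
    HasWeakGradient Ω u G

/-- `u ∈ W^{1,p}_0(Ω)` with weak gradient `∇u = G`: `u` lies in the closure of `C_c^∞(Ω)` in
`W^{1,p}(Ω)`. -/
def MemW1pZero {n : ℕ} (p : ℝ) (Ω : Set (EuclideanSpace ℝ (Fin n)))
    (u : EuclideanSpace ℝ (Fin n) → ℝ)
    (G : EuclideanSpace ℝ (Fin n) → EuclideanSpace ℝ (Fin n)) : Prop :=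
  MemW1p p Ω u G ∧
    ∃ φ : ℕ → EuclideanSpace ℝ (Fin n) → ℝ,
      (∀ k, IsTestFunction Ω (φ k)) ∧
      Tendsto (fun k => eLpNorm (fun x => φ k x - u x) (ENNReal.ofReal p) (volume.restrict Ω))
        atTop (𝓝 0) ∧
      Tendsto (fun k => eLpNorm (fun x => gradient (φ k) x - G x) (ENNReal.ofReal p)
        (volume.restrict Ω)) atTop (𝓝 0)

/-- `u` is radially symmetric on the ball of radius `R` about the origin: up to a null set,
`u x` depends on `‖x‖` only. -/
def IsRadialOnBall {n : ℕ} (R : ℝ) (u : EuclideanSpace ℝ (Fin n) → ℝ) : Prop :=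
  ∃ g : ℝ → ℝ, ∀ᵐ x ∂(volume.restrict (Metric.ball (0 : EuclideanSpace ℝ (Fin n)) R)),
    u x = g ‖x‖

/-! ### The constants, the weight, the extremals and the scaling -/

/-- The `q`-logarithm `(r^{1-q} - 1) / (1 - q)`, for `q ≠ 1` and `r > 0`. -/
noncomputable def qLog (q r : ℝ) : ℝ := (r ^ (1 - q) - 1) / (1 - q)

/-- The Sobolev conjugate exponent `p* = np / (n - p)`, i.e. `1/p* = 1/p - 1/n`. -/
noncomputable def sobolevConj (n : ℕ) (p : ℝ) : ℝ := n * p / (n - p)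

/-- The Aubin-Talenti constant `S_{n,p}` for `1 < p < n`. -/
noncomputable def sobolevConst (n : ℕ) (p : ℝ) : ℝ :=
  √Real.pi * (n : ℝ) ^ (1 / p) * ((n - p) / (p - 1)) ^ ((p - 1) / p) *
    (Real.Gamma (n / p) * Real.Gamma (n + 1 - n / p) /
      (Real.Gamma n * Real.Gamma (1 + n / 2))) ^ (1 / (n : ℝ))

/-- The weighted norm
`(∫_{B_R} |u|^{p*} / [log_{(n-1)/(p-1)} (R/|x|)]^{p(n-1)/(n-p)} dx)^{1/p*}`, with values in
`[0, ∞]`. The weight is positive on `B_R`; at the single point `x = 0` the conventions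
`R / 0 = 0` and `0 ^ y = 0` give `log_q` its limiting value `1 / (q - 1)`. -/
noncomputable def logWeightedNorm {n : ℕ} (p R : ℝ) (u : EuclideanSpace ℝ (Fin n) → ℝ) : ℝ≥0∞ :=
  (∫⁻ x in Metric.ball (0 : EuclideanSpace ℝ (Fin n)) R,
    ENNReal.ofReal (|u x| ^ sobolevConj n p /
      (qLog ((n - 1) / (p - 1)) (R / ‖x‖)) ^ (p * (n - 1) / (n - p)))) ^ (1 / sobolevConj n p)

/-- `‖F‖_{L^p(B_R)}` for a vector field `F`. -/
noncomputable def ballLpNorm {n : ℕ} (p R : ℝ)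
    (F : EuclideanSpace ℝ (Fin n) → EuclideanSpace ℝ (Fin n)) : ℝ≥0∞ :=
  eLpNorm F (ENNReal.ofReal p)
    (volume.restrict (Metric.ball (0 : EuclideanSpace ℝ (Fin n)) R))

/-- The Aubin-Talenti type function `U_R` with parameters `a, b`, extended continuously to the
origin by `a^{1-n/p}`. -/
noncomputable def talentiBall {n : ℕ} (p R a b : ℝ) (x : EuclideanSpace ℝ (Fin n)) : ℝ :=
  open Classical in
  if x = 0 then a ^ (1 - n / p)
  else (a + b * (1 / ‖x‖ ^ ((n - p) / (p - 1)) - 1 / R ^ ((n - p) / (p - 1))) ^ (-(p / (n - p))))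
    ^ (1 - n / p)

/-- The point `x_μ = [μ |x|^{-(n-p)/(p-1)} + (1-μ) R^{-(n-p)/(p-1)}]^{-(p-1)/(n-p)} x/|x|`
(and `0` for `x = 0`). -/
noncomputable def scaledPoint {n : ℕ} (p R μ : ℝ) (x : EuclideanSpace ℝ (Fin n)) :
    EuclideanSpace ℝ (Fin n) :=
  (μ * ‖x‖ ^ (-((n - p) / (p - 1))) + (1 - μ) * R ^ (-((n - p) / (p - 1))))
    ^ (-((p - 1) / (n - p))) • (‖x‖⁻¹ • x)

/-- The nonlinear scaling `u_μ(x) = μ^{-(p-1)/p} u(x_μ)`. -/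
noncomputable def scaledFun {n : ℕ} (p R μ : ℝ) (u : EuclideanSpace ℝ (Fin n) → ℝ)
    (x : EuclideanSpace ℝ (Fin n)) : ℝ :=
  μ ^ (-((p - 1) / p)) * u (scaledPoint p R μ x)

/-! Put α = (n-p)/(p-1). The coordinate t = |x|^(-α) - R^(-α), a p-harmonic function vanishing on
the sphere of radius R, maps the punctured ball radially onto (0, ∞). A radial element of
`W^{1,p}_0` becomes the primitive w(t) = ∫₀ᵗ f of a profile f in L^p(0, ∞). With δ = p/(n-p), the
p-th power of the gradient norm is a constant times ∫ |f|^p, and the weighted integral is a constant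
times ∫ |w|^(nδ) t^(-(n-1)δ): the logarithmic weight is exactly what produces the power of t and the
Jacobian. Neither one-dimensional integral sees R, and the claim becomes Bliss's inequality on the
half line (`bliss_inequality`).

Bliss's inequality is proved by mass transport. With β = (p-1)/(n-p), let Y push the density w^(nδ)
t^(-(n-1)δ) forward to y^δ (1+y^δ)^(-n). The arithmetic-geometric mean inequality applied to Y'/Y
and n-1 copies of 1/t bounds ∫ (1+y^δ)^(1-n) dy by an integral of w^((n-1)δ) against minus the
derivative of Y^(-β) t^(-(n-1)β). Integration by parts moves the derivative onto w, and Hölder's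
inequality separates ‖f‖_p from a factor which, by the transport equation, depends on the target
density alone. This is `bliss_of_transport`. A multiplication by a constant equalises the masses,
and approximation by smooth profiles with Fatou's lemma removes the regularity assumptions.

The passage between radial Sobolev functions and profiles has two directions. `IsProfile.memW1pZero`
shows that every profile gives an element of the closure of the test functions.
`MemW1pZero.exists_profile` recovers the profile from the behaviour of approximating test functions
along one well-chosen ray.

The functions `talentiBall` correspond to the profiles b (a t^δ + b)^(-n/p), whose integrals are
beta integrals; equality is then a computation with the Gamma function, and optimality follows
because these functions have finite nonzero norms. The nonlinear scaling is the dilation t ↦ μ t in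
the new coordinate, with the factor that preserves the L^p norm of the profile, so both sides are
visibly invariant. -/

/-! ### The mass transport argument for Bliss's inequality. -/

/-- Writing positive quantities as exponentials reduces identities between products of real powers
to polynomial identities in the exponents. -/
theorem exists_exp_eq {x : ℝ} (hx : 0 < x) : ∃ a, x = Real.exp a := ⟨Real.log x, (Real.exp_log hx).symm⟩

/-- The arithmetic-geometric mean inequality for the one-dimensional transport map. -/
theorem transport_amgm {N δ β w t Y : ℝ} (hN : 1 < N) (hβ : 0 < β) (hNβ : N * β = (N - 1) * δ - 1)
    (hw : 0 < w) (ht : 0 < t) (hY : 0 < Y) {D : ℝ}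
    (hD : D = w ^ (N * δ) * t ^ (-((N - 1) * δ)) / (Y ^ δ * (1 + Y ^ δ) ^ (-N))) :
    N * β * (D * (1 + Y ^ δ) ^ (1 - N)) ≤
      w ^ ((N - 1) * δ) * (β * (Y ^ (-β) * t ^ (-((N - 1) * β))) * (D / Y + (N - 1) / t)) := by
  have h1 : 0 < 1 + Y ^ δ := by positivity
  have hN0 : (0 : ℝ) < N := by linarith
  have hDpos : 0 < D := by rw [hD]; positivity
  have am := Real.geom_mean_le_arith_mean2_weighted (w₁ := 1 / N) (w₂ := (N - 1) / N)
    (p₁ := D / Y) (p₂ := 1 / t) (by positivity) (div_nonneg (by linarith) hN0.le)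
    (by positivity) (by positivity) (by field_simp; ring)
  -- Substituting the formula for D makes the powers of w cancel, and those of t and Y combine to
  -- the stated ones precisely because Nβ + 1 = (N-1)δ.
  have key : w ^ ((N - 1) * δ) * (Y ^ (-β) * t ^ (-((N - 1) * β))) *
      ((D / Y) ^ (1 / N) * (1 / t) ^ ((N - 1) / N)) = D * (1 + Y ^ δ) ^ (1 - N) := by
    obtain ⟨d, hd⟩ := exists_exp_eq h1
    rw [hd] at hD ⊢
    obtain ⟨a, rfl⟩ := exists_exp_eq hw
    obtain ⟨b, rfl⟩ := exists_exp_eq ht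
    obtain ⟨c, rfl⟩ := exists_exp_eq hY
    have h1t : 1 / Real.exp b = Real.exp (-b) := by rw [Real.exp_neg, one_div]
    rw [hD, h1t]
    simp only [← Real.exp_mul, ← Real.exp_add, ← Real.exp_sub]
    congr 1
    have hb : β = ((N - 1) * δ - 1) / N := by field_simp; linarith
    rw [hb]
    field_simp
    ring
  have hc : 0 ≤ N * β * (w ^ ((N - 1) * δ) * (Y ^ (-β) * t ^ (-((N - 1) * β)))) := by positivity
  calc N * β * (D * (1 + Y ^ δ) ^ (1 - N))
      = N * β * (w ^ ((N - 1) * δ) * (Y ^ (-β) * t ^ (-((N - 1) * β)))) *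
      ((D / Y) ^ (1 / N) * (1 / t) ^ ((N - 1) / N)) := by rw [← key]; ring
    _ ≤ N * β * (w ^ ((N - 1) * δ) * (Y ^ (-β) * t ^ (-((N - 1) * β)))) *
      (1 / N * (D / Y) + (N - 1) / N * (1 / t)) := mul_le_mul_of_nonneg_left am hc
    _ = _ := by field_simp

/-- Tonelli's theorem on the triangle `t₀ < s < t`, in the form of an integration by parts
inequality. -/
theorem lintegral_primitive_mul_le {t₀ : ℝ} {k a b P : ℝ → ℝ}
    (ha : ContinuousOn a (Set.Ioi t₀)) (hb : ContinuousOn b (Set.Ioi t₀))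
    (ha0 : ∀ t ∈ Set.Ioi t₀, 0 ≤ a t) (hb0 : ∀ t ∈ Set.Ioi t₀, 0 ≤ b t)
    (hP0 : ∀ t ∈ Set.Ioi t₀, 0 ≤ P t)
    (hk : ∀ t ∈ Set.Ioi t₀, HasDerivAt k (a t) t) (hkc : ContinuousOn k (Set.Ici t₀))
    (hk0 : k t₀ = 0)
    (hP : ∀ t ∈ Set.Ioi t₀, HasDerivAt P (-b t) t) :
    ∫⁻ t in Set.Ioi t₀, ENNReal.ofReal (k t * b t) ≤
      ∫⁻ s in Set.Ioi t₀, ENNReal.ofReal (a s * P s) := by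
  have hka : ∀ t ∈ Set.Ioi t₀, ENNReal.ofReal (k t) =
      ∫⁻ s in Set.Ioi t₀, (Set.Iio t).indicator (fun s => ENNReal.ofReal (a s)) s := by
    intro t ht
    have ht' : t₀ < t := ht
    -- Continuity of a is not known at t₀; integrability up to the endpoint comes from a being the
    -- nonnegative derivative of a function continuous there.
    have hint : IntegrableOn a (Set.Ioc t₀ t) :=
      intervalIntegral.integrableOn_deriv_of_nonneg
        (hkc.mono Set.Icc_subset_Ici_self) (fun x hx => hk x hx.1) (fun x hx => ha0 x hx.1)
    have := intervalIntegral.integral_eq_sub_of_hasDerivAt_of_le ht'.le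
      (hkc.mono Set.Icc_subset_Ici_self) (fun x hx => hk x hx.1)
      ((intervalIntegrable_iff_integrableOn_Ioc_of_le ht'.le).2 hint)
    rw [hk0, sub_zero, intervalIntegral.integral_of_le ht'.le] at this
    rw [← this, ofReal_integral_eq_lintegral_ofReal hint
      ((ae_restrict_mem measurableSet_Ioc).mono fun x hx => ha0 x hx.1),
      setLIntegral_indicator measurableSet_Iio, Set.inter_comm, Set.Ioi_inter_Iio,
      restrict_Ioo_eq_restrict_Ioc]
  -- The integral of b beyond s is P(s) minus the limit of P at infinity. Dropping that nonnegative
  -- limit means that no decay of P has to be proved.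
  have hPb : ∀ s ∈ Set.Ioi t₀, 
      ∫⁻ t in Set.Ioi t₀, (Set.Ioi s).indicator (fun t => ENNReal.ofReal (b t)) t
        ≤ ENNReal.ofReal (P s) := by
    intro s hs
    have hs' : t₀ < s := hs
    rw [setLIntegral_indicator measurableSet_Ioi, Set.Ioi_inter_Ioi, sup_eq_left.2 hs'.le]
    have hU : Set.Ioi s = ⋃ j : ℕ, Set.Ioc s (s + j) := by
      ext x
      simp only [Set.mem_Ioi, Set.mem_iUnion, Set.mem_Ioc]
      refine ⟨fun h => ?_, fun ⟨j, h⟩ => h.1⟩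
      obtain ⟨j, hj⟩ := exists_nat_ge (x - s)
      exact ⟨j, h, by linarith⟩
    rw [hU, setLIntegral_iUnion_of_directed _ (Monotone.directed_le fun i j hij =>
      Set.Ioc_subset_Ioc_right (by gcongr))]
    refine iSup_le fun j => ?_
    have hle : s ≤ s + (j : ℝ) := by simp
    have hsub : Set.Icc s (s + (j : ℝ)) ⊆ Set.Ioi t₀ := fun x hx => hs'.trans_le hx.1
    have hint : IntervalIntegrable b volume s (s + j) :=
      (hb.mono (by rwa [Set.uIcc_of_le hle])).intervalIntegrable
    have := intervalIntegral.integral_eq_sub_of_hasDerivAt (f := fun t => - P t) (f' := b)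
      (a := s) (b := s + j)
      (fun x hx => by
        rw [Set.uIcc_of_le hle] at hx
        have h := (hP x (hsub hx)).neg
        rw [neg_neg] at h
        exact h) hint
    rw [intervalIntegral.integral_of_le hle] at this
    rw [← ofReal_integral_eq_lintegral_ofReal hint.1
      ((ae_restrict_mem measurableSet_Ioc).mono fun x hx => hb0 x (hs'.trans hx.1)), this]
    refine ENNReal.ofReal_le_ofReal ?_
    linarith [hP0 (s + j) (hs'.trans_le hle)]
  have ham : AEMeasurable (fun s => ENNReal.ofReal (a s)) (volume.restrict (Set.Ioi t₀)) :=
    (ha.aemeasurable measurableSet_Ioi).ennreal_ofReal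
  have hbm : AEMeasurable (fun s => ENNReal.ofReal (b s)) (volume.restrict (Set.Ioi t₀)) :=
    (hb.aemeasurable measurableSet_Ioi).ennreal_ofReal
  have hT : MeasurableSet {z : ℝ × ℝ | z.2 < z.1} := measurableSet_lt measurable_snd measurable_fst
  calc ∫⁻ t in Set.Ioi t₀, ENNReal.ofReal (k t * b t)
      = ∫⁻ t in Set.Ioi t₀, ∫⁻ s in Set.Ioi t₀, {z : ℝ × ℝ | z.2 < z.1}.indicator
        (fun z => ENNReal.ofReal (b z.1) * ENNReal.ofReal (a z.2)) (t, s) := by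
        refine setLIntegral_congr_fun measurableSet_Ioi fun t ht => ?_
        rw [ENNReal.ofReal_mul' (hb0 t ht), hka t ht, mul_comm,
          ← lintegral_const_mul' _ _ ENNReal.ofReal_ne_top]
        refine lintegral_congr fun s => ?_
        by_cases h : s < t <;> simp [Set.indicator, h]
    _ = ∫⁻ s in Set.Ioi t₀, ∫⁻ t in Set.Ioi t₀, {z : ℝ × ℝ | z.2 < z.1}.indicator
        (fun z => ENNReal.ofReal (b z.1) * ENNReal.ofReal (a z.2)) (t, s) := by
        refine lintegral_lintegral_swap ?_
        refine AEMeasurable.indicator ?_ hT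
        exact (hbm.comp_fst).mul (ham.comp_snd)
    _ ≤ ∫⁻ s in Set.Ioi t₀, ENNReal.ofReal (a s * P s) := by
        refine setLIntegral_mono' measurableSet_Ioi fun s hs => ?_
        rw [ENNReal.ofReal_mul (ha0 s hs)]
        refine le_trans (le_of_eq ?_) (mul_le_mul_right (hPb s hs) _)
        rw [← lintegral_const_mul' _ _ ENNReal.ofReal_ne_top]
        refine lintegral_congr fun t => ?_
        by_cases h : s < t <;> simp [Set.indicator, h, mul_comm]

/-- The mass transport argument for Bliss's inequality: `Y` transports `w ^ (N δ) t ^ (-(N-1) δ)`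
to `y ^ δ (1 + y ^ δ) ^ (-N)`. -/
theorem bliss_of_transport {N δ β p p' t₀ : ℝ} {w f Y D : ℝ → ℝ} (hN : 1 < N) (hβ : 0 < β)
    (hδ : 0 < δ)
    (hNβ : N * β = (N - 1) * δ - 1) (hpp : p.HolderConjugate p') (hβp : β * p' = δ)
    (ht₀ : 0 ≤ t₀) (hf : ContinuousOn f (Set.Ioi t₀)) (hf0 : ∀ t ∈ Set.Ioi t₀, 0 ≤ f t)
    (hw : ∀ t ∈ Set.Ioi t₀, 0 < w t) (hwc : ContinuousOn w (Set.Ici t₀)) (hw0 : w t₀ = 0)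
    (hwd : ∀ t ∈ Set.Ioi t₀, HasDerivAt w (f t) t) (hY : ∀ t ∈ Set.Ioi t₀, 0 < Y t)
    (hYd : ∀ t ∈ Set.Ioi t₀, HasDerivAt Y (D t) t)
    (hD : ∀ t ∈ Set.Ioi t₀, D t = w t ^ (N * δ) * t ^ (-((N - 1) * δ)) /
      (Y t ^ δ * (1 + Y t ^ δ) ^ (-N)))
    (hYi : Set.InjOn Y (Set.Ioi t₀)) (hYs : Y '' Set.Ioi t₀ = Set.Ioi 0) :
    ENNReal.ofReal (N * β) * ∫⁻ y in Set.Ioi (0 : ℝ), ENNReal.ofReal ((1 + y ^ δ) ^ (1 - N)) ≤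
      ENNReal.ofReal ((N - 1) * δ) * ((∫⁻ t in Set.Ioi t₀, ENNReal.ofReal (f t) ^ p) ^ (1 / p) *
        (∫⁻ y in Set.Ioi (0 : ℝ), ENNReal.ofReal ((1 + y ^ δ) ^ (-N))) ^ (1 / p')) := by
  have hpos : ∀ t ∈ Set.Ioi t₀, 0 < t := fun t ht => ht₀.trans_lt ht
  set κ := (N - 1) * δ with hκ
  have hN0 : 0 < N := by linarith
  have hκ1 : 1 < κ := by nlinarith [mul_pos hN0 hβ]
  have hDpos : ∀ t ∈ Set.Ioi t₀, 0 < D t := fun t ht => by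
    have h1 := hw t ht; have h2 := hY t ht; have h3 := hpos t ht
    rw [hD t ht]; positivity
  have hYc : ContinuousOn Y (Set.Ioi t₀) := fun t ht => (hYd t ht).continuousAt.continuousWithinAt
  have hwc' : ContinuousOn w (Set.Ioi t₀) := hwc.mono Set.Ioi_subset_Ici_self
  have hDc : ContinuousOn D (Set.Ioi t₀) := by
    refine ContinuousOn.congr ?_ hD
    refine ContinuousOn.div ?_ ?_ fun t ht => ?_
    · exact (hwc'.rpow_const fun t ht => Or.inl (hw t ht).ne').mul
        (continuousOn_id.rpow_const fun t ht => Or.inl (hpos t ht).ne')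
    · refine (hYc.rpow_const fun t ht => Or.inl (hY t ht).ne').mul
        ((continuousOn_const.add (hYc.rpow_const fun t ht => Or.inl (hY t ht).ne')).rpow_const
          fun t ht => Or.inl ?_)
      have := hY t ht
      exact (by positivity : (0 : ℝ) < 1 + Y t ^ δ).ne'
    · have := hY t ht
      positivity
  set P : ℝ → ℝ := fun t => Y t ^ (-β) * t ^ (-((N - 1) * β)) with hPdef
  have hP0 : ∀ t ∈ Set.Ioi t₀, 0 < P t := fun t ht => by
    have h2 := hY t ht; have h3 := hpos t ht
    simp only [hPdef]; positivity
  set b : ℝ → ℝ := fun t => β * P t * (D t / Y t + (N - 1) / t) with hbdef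
  have hPd : ∀ t ∈ Set.Ioi t₀, HasDerivAt P (-b t) t := fun t ht => by
    have h2 := hY t ht; have h3 := hpos t ht
    have h := ((hYd t ht).rpow_const (p := -β) (Or.inl h2.ne')).mul
      (Real.hasDerivAt_rpow_const (x := t) (p := -((N - 1) * β)) (Or.inl h3.ne'))
    refine h.congr_deriv ?_
    simp only [hbdef, hPdef]
    rw [Real.rpow_sub_one h2.ne', Real.rpow_sub_one h3.ne']
    field_simp
    ring
  have hPc : ContinuousOn P (Set.Ioi t₀) := fun t ht => (hPd t ht).continuousAt.continuousWithinAt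
  have hbc : ContinuousOn b (Set.Ioi t₀) := by
    refine (continuousOn_const.mul hPc).mul ((hDc.div hYc fun t ht => (hY t ht).ne').add
      (continuousOn_const.div continuousOn_id fun t ht => (hpos t ht).ne'))
  have hb0 : ∀ t ∈ Set.Ioi t₀, 0 ≤ b t := fun t ht => by
    have h1 := hP0 t ht; have h2 := hY t ht; have h3 := hpos t ht; have h4 := hDpos t ht
    have h5 : 0 < N - 1 := by linarith
    simp only [hbdef]; positivity
  set k : ℝ → ℝ := fun t => w t ^ κ with hkdef
  set a : ℝ → ℝ := fun t => f t * κ * w t ^ (κ - 1) with hadef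
  have hkd : ∀ t ∈ Set.Ioi t₀, HasDerivAt k (a t) t := fun t ht =>
    (hwd t ht).rpow_const (Or.inl (hw t ht).ne')
  have hac : ContinuousOn a (Set.Ioi t₀) :=
    (hf.mul continuousOn_const).mul (hwc'.rpow_const fun t ht => Or.inl (hw t ht).ne')
  have ha0 : ∀ t ∈ Set.Ioi t₀, 0 ≤ a t := fun t ht => by
    have h1 := hf0 t ht; have h2 := hw t ht
    simp only [hadef]; positivity
  -- The boundary term at t₀ vanishes because w(t₀) = 0 and κ > 0.
  have tri := lintegral_primitive_mul_le hac hbc ha0 hb0 (fun t ht => (hP0 t ht).le) hkd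
    (hwc.rpow_const fun t ht => Or.inr (by linarith)) (by simp only [hkdef, hw0]; exact Real.zero_rpow (by linarith)) hPd
  have cv : ∀ g : ℝ → ℝ, ∫⁻ y in Set.Ioi (0 : ℝ), ENNReal.ofReal (g y) =
      ∫⁻ t in Set.Ioi t₀, ENNReal.ofReal (D t * g (Y t)) := fun g => by
    rw [← hYs, lintegral_image_eq_lintegral_abs_deriv_mul measurableSet_Ioi
      (fun t ht => (hYd t ht).hasDerivWithinAt) hYi]
    refine setLIntegral_congr_fun measurableSet_Ioi fun t ht => ?_
    rw [abs_of_pos (hDpos t ht), ENNReal.ofReal_mul (hDpos t ht).le]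
  have left : ENNReal.ofReal (N * β) *
      ∫⁻ y in Set.Ioi (0 : ℝ), ENNReal.ofReal ((1 + y ^ δ) ^ (1 - N)) ≤
      ∫⁻ t in Set.Ioi t₀, ENNReal.ofReal (k t * b t) := by
    rw [cv, ← lintegral_const_mul' _ _ ENNReal.ofReal_ne_top]
    refine setLIntegral_mono' measurableSet_Ioi fun t ht => ?_
    rw [← ENNReal.ofReal_mul (by positivity)]
    refine ENNReal.ofReal_le_ofReal ?_
    exact transport_amgm hN hβ hNβ (hw t ht) (hpos t ht) (hY t ht) (hD t ht)
  -- After integration by parts the integrand is κ f g. Since κ - 1 = Nβ and β p' = δ, the transport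
  -- equation gives g^p' = D (1 + Y^δ)^(-N), so the Hölder factor is an integral of the target
  -- density, independent of w.
  set g : ℝ → ℝ := fun t => w t ^ (κ - 1) * P t with hgdef
  have hg0 : ∀ t ∈ Set.Ioi t₀, 0 < g t := fun t ht => by
    have h1 := hP0 t ht; have h2 := hw t ht
    simp only [hgdef]; positivity
  have right : ∫⁻ t in Set.Ioi t₀, ENNReal.ofReal (a t * P t) =
      ENNReal.ofReal κ * ∫⁻ t in Set.Ioi t₀, ENNReal.ofReal (f t) * ENNReal.ofReal (g t) := by
    rw [← lintegral_const_mul' _ _ ENNReal.ofReal_ne_top]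
    refine setLIntegral_congr_fun measurableSet_Ioi fun t ht => ?_
    rw [← ENNReal.ofReal_mul (hf0 t ht), ← ENNReal.ofReal_mul (by linarith)]
    congr 1
    simp only [hadef, hgdef]
    ring
  have holder := ENNReal.lintegral_mul_le_Lp_mul_Lq (volume.restrict (Set.Ioi t₀)) hpp
    (f := fun t => ENNReal.ofReal (f t)) (g := fun t => ENNReal.ofReal (g t))
    (hf.aemeasurable measurableSet_Ioi).ennreal_ofReal
    (((hwc'.rpow_const fun t ht => Or.inl (hw t ht).ne').mul hPc).aemeasurable
      measurableSet_Ioi).ennreal_ofReal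
  have hgp : ∫⁻ t in Set.Ioi t₀, ENNReal.ofReal (g t) ^ p' =
      ∫⁻ y in Set.Ioi (0 : ℝ), ENNReal.ofReal ((1 + y ^ δ) ^ (-N)) := by
    rw [cv]
    refine setLIntegral_congr_fun measurableSet_Ioi fun t ht => ?_
    have h1 := hw t ht; have h2 := hY t ht; have h3 := hpos t ht
    have h4 : 0 < 1 + Y t ^ δ := by positivity
    rw [ENNReal.ofReal_rpow_of_pos (hg0 t ht)]
    congr 1
    simp only [hgdef, hPdef, hD t ht]
    obtain ⟨d, hd⟩ := exists_exp_eq h4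
    obtain ⟨x, hx⟩ := exists_exp_eq h1
    obtain ⟨y, hy⟩ := exists_exp_eq h3
    obtain ⟨z, hz⟩ := exists_exp_eq h2
    rw [hd, hx, hz, hy]
    simp only [← Real.exp_mul, ← Real.exp_add, ← Real.exp_sub]
    congr 1
    have e1 : κ - 1 = N * β := by linarith
    rw [e1]
    linear_combination (N * x - z - y * (N - 1)) * hβp
  calc _ ≤ _ := left
    _ ≤ _ := tri
    _ = _ := right
    _ ≤ _ := by
        gcongr
        rw [← hgp]
        exact holder
-- Monotone transport on half lines.
/-- The distribution function of a positive continuous density on a half line. -/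
theorem distribution_properties {a M : ℝ} {φ : ℝ → ℝ} (hφ : ContinuousOn φ (Set.Ici a))
    (hφ0 : ∀ x ∈ Set.Ioi a, 0 < φ x)
    (hM : ∫⁻ x in Set.Ioi a, ENNReal.ofReal (φ x) = ENNReal.ofReal M) :
    (∀ x ∈ Set.Ioi a, HasDerivAt (fun x => ∫ s in a..x, φ s) (φ x) x) ∧
      StrictMonoOn (fun x => ∫ s in a..x, φ s) (Set.Ioi a) ∧
      (fun x => ∫ s in a..x, φ s) '' Set.Ioi a = Set.Ioo 0 M := by
  set F : ℝ → ℝ := fun x => ∫ s in a..x, φ s with hF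
  have hii : ∀ x ∈ Set.Ici a, ∀ y ∈ Set.Ici a, IntervalIntegrable φ volume x y := fun x hx y hy =>
    (hφ.mono (by
      intro z hz
      exact (le_min hx hy).trans hz.1)).intervalIntegrable
  have hd : ∀ x ∈ Set.Ioi a, HasDerivAt F (φ x) x := fun x hx =>
    intervalIntegral.integral_hasDerivAt_right (hii a Set.self_mem_Ici x (Set.mem_Ici_of_Ioi hx))
      ((hφ.mono Set.Ioi_subset_Ici_self).stronglyMeasurableAtFilter isOpen_Ioi x hx)
      (hφ.continuousAt (Ici_mem_nhds hx))
  have hmono : StrictMonoOn F (Set.Ici a) := by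
    intro x hx y hy hxy
    have h1 : F y - F x = ∫ s in x..y, φ s := by
      simp only [hF]
      rw [intervalIntegral.integral_interval_sub_left (hii a Set.self_mem_Ici y hy)
        (hii a Set.self_mem_Ici x hx)]
    have h2 : 0 < ∫ s in x..y, φ s :=
      intervalIntegral.intervalIntegral_pos_of_pos_on (hii x hx y hy)
        (fun s hs => hφ0 s (lt_of_le_of_lt hx hs.1)) hxy
    linarith
  have hFa : F a = 0 := by simp [hF]
  have hFpos : ∀ x ∈ Set.Ioi a, 0 < F x := fun x hx => by
    rw [← hFa]; exact hmono Set.self_mem_Ici (Set.mem_Ici_of_Ioi hx) hx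
  have hFc : ContinuousOn F (Set.Ioi a) := fun x hx => (hd x hx).continuousAt.continuousWithinAt
  have hint : IntegrableOn φ (Set.Ioi a) := by
    refine ⟨(hφ.mono Set.Ioi_subset_Ici_self).aestronglyMeasurable measurableSet_Ioi, ?_⟩
    rw [hasFiniteIntegral_iff_ofReal ((ae_restrict_mem measurableSet_Ioi).mono
      fun x hx => (hφ0 x hx).le), hM]
    exact ENNReal.ofReal_lt_top
  have hM' : ∫ x in Set.Ioi a, φ x = M := by
    have h0 : 0 ≤ᵐ[volume.restrict (Set.Ioi a)] φ :=
      (ae_restrict_mem measurableSet_Ioi).mono fun x hx => (hφ0 x hx).le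
    rw [← ofReal_integral_eq_lintegral_ofReal hint h0] at hM
    -- `ENNReal.ofReal` determines M only once M is known to be positive.
    have hp : 0 < ∫ x in Set.Ioi a, φ x := by
      have hle : F (a + 1) ≤ ∫ x in Set.Ioi a, φ x := by
        simp only [hF]
        rw [intervalIntegral.integral_of_le (by linarith)]
        exact setIntegral_mono_set hint h0 Set.Ioc_subset_Ioi_self.eventuallyLE
      exact (hFpos (a + 1) (by simp)).trans_le hle
    have hMp : 0 < M := by
      rw [← ENNReal.ofReal_pos, ← hM]
      exact ENNReal.ofReal_pos.2 hp
    exact (ENNReal.ofReal_eq_ofReal_iff hp.le hMp.le).1 hM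
  have hlim : Tendsto F atTop (𝓝 M) := by
    rw [← hM']
    exact intervalIntegral_tendsto_integral_Ioi a hint tendsto_id
  refine ⟨hd, hmono.mono Set.Ioi_subset_Ici_self, Set.Subset.antisymm ?_ ?_⟩
  · rintro _ ⟨x, hx, rfl⟩
    refine ⟨hFpos x hx, ?_⟩
    have hx' : a < x := hx
    have h1 : F x < F (x + 1) := hmono hx'.le (by simp; linarith) (by linarith)
    refine h1.trans_le (ge_of_tendsto hlim ?_)
    filter_upwards [eventually_ge_atTop (x + 1)] with y hy
    exact hmono.monotoneOn (by simp; linarith) (by simp; linarith) hy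
  · rintro u ⟨hu0, huM⟩
    obtain ⟨y, hy1, hy2⟩ := ((hlim.eventually (lt_mem_nhds huM)).and
      (eventually_gt_atTop a)).exists
    have hFc' : ContinuousOn F (Set.Icc a y) := by
      have := intervalIntegral.continuousOn_primitive_interval (f := φ) (μ := volume) (a := a)
        (b := y) ((intervalIntegrable_iff_integrableOn_Icc_of_le hy2.le).1
          (hii a Set.self_mem_Ici y hy2.le) |> fun h => by rwa [Set.uIcc_of_le hy2.le])
      rwa [Set.uIcc_of_le hy2.le] at this
    obtain ⟨x, hx, hxu⟩ := intermediate_value_Icc hy2.le hFc'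
      (show u ∈ Set.Icc (F a) (F y) from ⟨by rw [hFa]; exact hu0.le, hy1.le⟩)
    refine ⟨x, ?_, hxu⟩
    rcases hx.1.eq_or_lt with h | h
    · rw [← h, hFa] at hxu
      exact absurd hxu hu0.ne
    · exact h

/-- Monotone transport between two positive continuous densities with the same total mass. -/
theorem exists_transport {a t₀ M : ℝ} {φ ψ : ℝ → ℝ} (hφ : ContinuousOn φ (Set.Ici a))
    (hφ0 : ∀ x ∈ Set.Ioi a, 0 < φ x)
    (hφM : ∫⁻ x in Set.Ioi a, ENNReal.ofReal (φ x) = ENNReal.ofReal M)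
    (hψ : ContinuousOn ψ (Set.Ici t₀)) (hψ0 : ∀ x ∈ Set.Ioi t₀, 0 < ψ x)
    (hψM : ∫⁻ x in Set.Ioi t₀, ENNReal.ofReal (ψ x) = ENNReal.ofReal M) :
    ∃ Y : ℝ → ℝ, (∀ t ∈ Set.Ioi t₀, HasDerivAt Y (ψ t / φ (Y t)) t) ∧
      Set.InjOn Y (Set.Ioi t₀) ∧ Y '' Set.Ioi t₀ = Set.Ioi a := by
  obtain ⟨hF1, hF2, hF3⟩ := distribution_properties hφ hφ0 hφM
  obtain ⟨hm1, hm2, hm3⟩ := distribution_properties hψ hψ0 hψM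
  set F : ℝ → ℝ := fun x => ∫ s in a..x, φ s
  set m : ℝ → ℝ := fun x => ∫ s in t₀..x, ψ s
  -- The transport map is `G ∘ m`: the distribution function of ψ followed by the inverse of that of
  -- φ. The chain rule yields the derivative ψ / φ(Y).
  set G : ℝ → ℝ := Function.invFunOn F (Set.Ioi a)
  have hmm : ∀ t ∈ Set.Ioi t₀, m t ∈ Set.Ioo 0 M := fun t ht => hm3 ▸ Set.mem_image_of_mem m ht
  have hG1 : ∀ u ∈ Set.Ioo 0 M, G u ∈ Set.Ioi a := fun u hu =>
    Function.invFunOn_mem (by rw [← hF3] at hu; exact hu)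
  have hG2 : ∀ u ∈ Set.Ioo 0 M, F (G u) = u := fun u hu =>
    Function.invFunOn_eq (by rw [← hF3] at hu; exact hu)
  have hG3 : ∀ x ∈ Set.Ioi a, G (F x) = x := fun x hx =>
    hF2.injOn (hG1 _ (hF3 ▸ Set.mem_image_of_mem F hx)) hx
      (hG2 _ (hF3 ▸ Set.mem_image_of_mem F hx))
  have hGi : G '' Set.Ioo 0 M = Set.Ioi a := by
    refine Set.Subset.antisymm (Set.image_subset_iff.2 hG1) fun x hx => ?_
    exact ⟨F x, hF3 ▸ Set.mem_image_of_mem F hx, hG3 x hx⟩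
  have hGm : StrictMonoOn G (Set.Ioo 0 M) := fun u hu v hv huv => by
    rw [← hF2.lt_iff_lt (hG1 u hu) (hG1 v hv), hG2 u hu, hG2 v hv]
    exact huv
  have hGd : ∀ u ∈ Set.Ioo 0 M, HasDerivAt G (φ (G u))⁻¹ u := fun u hu => by
    -- A strictly monotone function whose image is a neighbourhood of its value cannot jump, so the
    -- inverse is continuous and the derivative of F can be inverted.
    have hc : ContinuousAt G u := hGm.continuousAt_of_image_mem_nhds
      (Ioo_mem_nhds hu.1 hu.2) (by rw [hGi]; exact Ioi_mem_nhds (hG1 u hu))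
    exact HasDerivAt.of_local_left_inverse hc (hF1 _ (hG1 u hu)) (hφ0 _ (hG1 u hu)).ne'
      (eventually_of_mem (Ioo_mem_nhds hu.1 hu.2) hG2)
  refine ⟨G ∘ m, fun t ht => ?_, ?_, ?_⟩
  · have := (hGd _ (hmm t ht)).comp t (hm1 t ht)
    rwa [mul_comm, ← div_eq_mul_inv] at this
  · exact (hGm.comp hm2 fun t ht => hmm t ht).injOn
  · rw [Set.image_comp, hm3, hGi]
-- Bliss's inequality with matched masses.
-- Splits the integral produced by the transport argument into the mass M and the energy NβM, whose
-- sum is (N-1)δM.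
theorem one_add_rpow_split {N δ y : ℝ} (hy : 0 < y) :
    (1 + y ^ δ) ^ (1 - N) = y ^ δ * (1 + y ^ δ) ^ (-N) + (1 + y ^ δ) ^ (-N) := by
  have h : 0 < 1 + y ^ δ := by positivity
  rw [sub_eq_add_neg, Real.rpow_add h, Real.rpow_one]
  ring

/-- Bliss's inequality for continuous functions, under a normalisation of the left-hand side. -/
theorem bliss_normalized {N δ β p p' M e : ℝ} {f : ℝ → ℝ} (hN : 1 < N) (hβ : 0 < β) (hδ : 0 < δ)
    (hNβ : N * β = (N - 1) * δ - 1) (hpp : p.HolderConjugate p') (hβp : β * p' = δ)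
    (hM0 : 0 < M)
    (hM : ∫⁻ y in Set.Ioi (0 : ℝ), ENNReal.ofReal (y ^ δ * (1 + y ^ δ) ^ (-N)) = ENNReal.ofReal M)
    (hB : ∫⁻ y in Set.Ioi (0 : ℝ), ENNReal.ofReal ((1 + y ^ δ) ^ (-N)) =
      ENNReal.ofReal (N * β * M))
    (hf : Continuous f) (hf0 : ∀ t, 0 ≤ f t) (he : 0 < e) (hfe : ∀ t ≤ e, f t = 0)
    (hI : ∫⁻ t in Set.Ioi (0 : ℝ), ENNReal.ofReal ((∫ s in (0 : ℝ)..t, f s) ^ (N * δ) *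
      t ^ (-((N - 1) * δ))) = ENNReal.ofReal M) :
    ENNReal.ofReal (N * β * M) ^ (1 / p) ≤
      (∫⁻ t in Set.Ioi (0 : ℝ), ENNReal.ofReal (f t) ^ p) ^ (1 / p) := by
  set w : ℝ → ℝ := fun t => ∫ s in (0 : ℝ)..t, f s with hwdef
  have hN0 : 0 < N := by linarith
  have hwd : ∀ t, HasDerivAt w (f t) t := fun t =>
    intervalIntegral.integral_hasDerivAt_right (hf.intervalIntegrable _ _)
      (hf.stronglyMeasurableAtFilter _ _) hf.continuousAt
  have hwc : Continuous w := continuous_iff_continuousAt.2 fun t => (hwd t).continuousAt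
  have hwm : Monotone w := monotone_of_hasDerivAt_nonneg hwd hf0
  have hw0 : w 0 = 0 := by simp [hwdef]
  have hwe : w e = 0 := by
    simp only [hwdef]
    rw [intervalIntegral.integral_of_le he.le]
    exact setIntegral_eq_zero_of_forall_eq_zero fun t ht => hfe t ht.2
  set S : Set ℝ := {t | 0 ≤ t ∧ w t = 0} with hS
  obtain ⟨x, hx0, hx⟩ : ∃ x, 0 < x ∧ w x ≠ 0 := by
    by_contra! h
    have : ∫⁻ t in Set.Ioi (0 : ℝ), ENNReal.ofReal (w t ^ (N * δ) * t ^ (-((N - 1) * δ))) = 0 := by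
      rw [← lintegral_zero (μ := volume.restrict (Set.Ioi (0 : ℝ)))]
      refine setLIntegral_congr_fun measurableSet_Ioi fun t ht => ?_
      simp [h t ht, Real.zero_rpow (mul_pos hN0 hδ).ne']
    rw [hI] at this
    exact (ENNReal.ofReal_pos.2 hM0).ne' this
  have hxpos : 0 < w x := lt_of_le_of_ne (by rw [← hw0]; exact hwm hx0.le) hx.symm
  have hSb : BddAbove S := ⟨x, fun t ht => le_of_lt (by
    by_contra! h
    have := hwm h
    linarith [ht.2])⟩
  have hSe : e ∈ S := ⟨he.le, hwe⟩
  have hSc : IsClosed S := (isClosed_le continuous_const continuous_id).inter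
    (isClosed_eq hwc continuous_const)
  set t₀ := sSup S with ht₀
  have ht₀S : t₀ ∈ S := hSc.csSup_mem ⟨e, hSe⟩ hSb
  have ht₀e : e ≤ t₀ := le_csSup hSb hSe
  have ht₀pos : 0 < t₀ := he.trans_le ht₀e
  have hwp : ∀ t ∈ Set.Ioi t₀, 0 < w t := fun t ht => by
    have ht' : t₀ < t := ht
    refine lt_of_le_of_ne (by rw [← hw0]; exact hwm (ht₀pos.trans ht').le) fun h => ?_
    exact absurd (le_csSup hSb (show t ∈ S from ⟨(ht₀pos.trans ht').le, h.symm⟩)) ht'.not_ge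
  have hwz : ∀ t, 0 < t → t ≤ t₀ → w t = 0 := fun t h1 h2 =>
    le_antisymm (by rw [← ht₀S.2]; exact hwm h2) (by rw [← hw0]; exact hwm h1.le)
  set φ : ℝ → ℝ := fun y => y ^ δ * (1 + y ^ δ) ^ (-N) with hφ
  set ψ : ℝ → ℝ := fun t => w t ^ (N * δ) * t ^ (-((N - 1) * δ)) with hψ
  have hφc : ContinuousOn φ (Set.Ici 0) := by
    have h1 : ContinuousOn (fun y : ℝ => y ^ δ) (Set.Ici 0) :=
      continuousOn_id.rpow_const fun t ht => Or.inr hδ.le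
    refine h1.mul ((continuousOn_const.add h1).rpow_const fun t ht => Or.inl ?_)
    have ht' : 0 ≤ t := ht
    exact (by positivity : (0 : ℝ) < 1 + t ^ δ).ne'
  have hφ0 : ∀ x ∈ Set.Ioi (0 : ℝ), 0 < φ x := fun y hy => by
    have hy' : 0 < y := hy
    simp only [hφ]; positivity
  have hψc : ContinuousOn ψ (Set.Ici t₀) := by
    refine (hwc.continuousOn.rpow_const fun t ht => Or.inr (by positivity)).mul
      (continuousOn_id.rpow_const fun t ht => Or.inl ?_)
    exact (ht₀pos.trans_le ht).ne'
  have hψ0 : ∀ t ∈ Set.Ioi t₀, 0 < ψ t := fun t ht => by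
    have h1 := hwp t ht
    have h2 : 0 < t := ht₀pos.trans ht
    simp only [hψ]; positivity
  have hψM : ∫⁻ t in Set.Ioi t₀, ENNReal.ofReal (ψ t) = ENNReal.ofReal M := by
    rw [← hI, ← Set.Ioc_union_Ioi_eq_Ioi ht₀pos.le, lintegral_union measurableSet_Ioi
      (Set.Ioc_disjoint_Ioi le_rfl)]
    rw [show ∫⁻ t in Set.Ioc 0 t₀, ENNReal.ofReal (ψ t) = 0 from ?_, zero_add]
    rw [← lintegral_zero (μ := volume.restrict (Set.Ioc 0 t₀))]
    refine setLIntegral_congr_fun measurableSet_Ioc fun t ht => ?_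
    simp [hψ, hwz t ht.1 ht.2, Real.zero_rpow (mul_pos hN0 hδ).ne']
  obtain ⟨Y, hY1, hY2, hY3⟩ := exists_transport hφc hφ0 hM hψc hψ0 hψM
  have main := bliss_of_transport hN hβ hδ hNβ hpp hβp ht₀pos.le hf.continuousOn
    (fun t _ => hf0 t) hwp hwc.continuousOn ht₀S.2 (fun t _ => hwd t)
    (fun t ht => (hY3 ▸ Set.mem_image_of_mem Y ht : Y t ∈ Set.Ioi (0 : ℝ))) hY1
    (fun t _ => rfl) hY2 hY3
  have hA : ∫⁻ y in Set.Ioi (0 : ℝ), ENNReal.ofReal ((1 + y ^ δ) ^ (1 - N)) =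
      ENNReal.ofReal ((1 + N * β) * M) := by
    rw [add_mul, one_mul, ENNReal.ofReal_add hM0.le (by positivity), ← hM, ← hB,
      ← lintegral_add_left (by fun_prop)]
    refine setLIntegral_congr_fun measurableSet_Ioi fun y hy => ?_
    have hy' : 0 < y := hy
    rw [← ENNReal.ofReal_add (by positivity) (by positivity), one_add_rpow_split hy']
  set X := (∫⁻ t in Set.Ioi t₀, ENNReal.ofReal (f t) ^ p) ^ (1 / p)
  have hX : X ≤ (∫⁻ t in Set.Ioi (0 : ℝ), ENNReal.ofReal (f t) ^ p) ^ (1 / p) :=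
    ENNReal.rpow_le_rpow (lintegral_mono_set (Set.Ioi_subset_Ioi ht₀pos.le))
      (one_div_nonneg.2 hpp.nonneg)
  refine le_trans ?_ hX
  have hBpos : 0 < N * β * M := by positivity
  -- Since 1 + Nβ = (N-1)δ, this factor cancels from both sides. What remains is B ≤ ‖f‖_p B^(1/p')
  -- with B = NβM, and division by B^(1/p') leaves the claim.
  rw [hA, hB, ← ENNReal.ofReal_mul (by positivity),
    show N * β * ((1 + N * β) * M) = (N - 1) * δ * (N * β * M) by rw [hNβ]; ring,
    ENNReal.ofReal_mul (by nlinarith)] at main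
  have hκ : 0 < (N - 1) * δ := mul_pos (by linarith) hδ
  have main2 := (ENNReal.mul_le_mul_iff_right (ENNReal.ofReal_pos.2 hκ).ne'
    ENNReal.ofReal_ne_top).1 main
  have hb : ENNReal.ofReal (N * β * M) =
      ENNReal.ofReal (N * β * M) ^ (1 / p) * ENNReal.ofReal (N * β * M) ^ (1 / p') := by
    rw [← ENNReal.rpow_add _ _ (ENNReal.ofReal_pos.2 hBpos).ne' ENNReal.ofReal_ne_top]
    rw [one_div, one_div, hpp.inv_add_inv_eq_one, ENNReal.rpow_one]
  nth_rewrite 1 [hb] at main2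
  refine (ENNReal.mul_le_mul_iff_left ?_ ?_).1 main2
  · exact (ENNReal.rpow_pos (ENNReal.ofReal_pos.2 hBpos) ENNReal.ofReal_ne_top).ne'
  · exact ENNReal.rpow_ne_top_of_nonneg (one_div_nonneg.2 hpp.symm.nonneg) ENNReal.ofReal_ne_top
-- Smooth approximation of profiles and convergence of primitives.
theorem eLpNorm_ofReal_eq_lintegral {α E : Type*} [MeasurableSpace α] [NormedAddCommGroup E]
    {μ : Measure α} {p : ℝ} (hp : 0 < p) (f : α → E) :
    eLpNorm f (ENNReal.ofReal p) μ = (∫⁻ x, ENNReal.ofReal (‖f x‖ ^ p) ∂μ) ^ (1 / p) := by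
  rw [eLpNorm_eq_lintegral_rpow_enorm_toReal (ENNReal.ofReal_pos.2 hp).ne' ENNReal.ofReal_ne_top,
    ENNReal.toReal_ofReal hp.le]
  congr 1
  refine lintegral_congr fun x => ?_
  rw [← ENNReal.ofReal_rpow_of_nonneg (norm_nonneg _) hp.le, ofReal_norm]

/-- Smooth functions with compact support in `(0, ∞)` are dense in `L^p(0, ∞)`. -/
theorem exists_seq_contDiff_tendsto_Lp_Ioi {p : ℝ} (hp : 1 ≤ p) {f : ℝ → ℝ}
    (hf : MemLp f (ENNReal.ofReal p) (volume.restrict (Set.Ioi 0))) :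
    ∃ g : ℕ → ℝ → ℝ, (∀ k, ContDiff ℝ ((⊤ : ℕ∞) : WithTop ℕ∞) (g k)) ∧
      (∀ k, ∃ e > 0, ∀ t ≤ e, g k t = 0) ∧ (∀ k, ∃ E > 0, ∀ t ≥ E, g k t = 0) ∧
      Tendsto (fun k => eLpNorm (fun t => g k t - f t) (ENNReal.ofReal p)
        (volume.restrict (Set.Ioi 0))) atTop (𝓝 0) := by
  have hp1 : 1 ≤ ENNReal.ofReal p := by simpa using ENNReal.ofReal_le_ofReal hp
  have hp0 : 0 < p := by linarith
  have step : ∀ ε : ℝ, 0 < ε → ∃ g : ℝ → ℝ, ContDiff ℝ ((⊤ : ℕ∞) : WithTop ℕ∞) g ∧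
      (∃ e > 0, ∀ t ≤ e, g t = 0) ∧ (∃ E > 0, ∀ t ≥ E, g t = 0) ∧
      eLpNorm (fun t => g t - f t) (ENNReal.ofReal p) (volume.restrict (Set.Ioi 0)) ≤
        ENNReal.ofReal ε := by
    intro ε hε
    obtain ⟨h, hc, hs, hle⟩ := hf.exist_eLpNorm_sub_le ENNReal.ofReal_ne_top hp1 (half_pos hε)
    obtain ⟨C, hC⟩ := hc.exists_bound_of_continuous hs.continuous
    obtain ⟨E, hE⟩ := (hc.isCompact.isBounded).subset_closedBall 0
    -- The cutoff at scale 1/(k+1) changes h only on (0, 2/(k+1)], by at most C, so its L^p error is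
    -- at most C (2/(k+1))^(1/p).
    have hlim : Tendsto (fun k : ℕ => ENNReal.ofReal (C * (2 / ((k : ℝ) + 1)) ^ (1 / p))) atTop
        (𝓝 0) := by
      rw [← ENNReal.ofReal_zero]
      refine ENNReal.tendsto_ofReal ?_
      have h1 : Tendsto (fun k : ℕ => (2 : ℝ) / ((k : ℝ) + 1)) atTop (𝓝 0) :=
        tendsto_const_nhds.div_atTop (tendsto_natCast_atTop_atTop.atTop_add tendsto_const_nhds)
      have h2 := (h1.rpow_const (p := 1 / p) (Or.inr (by positivity))).const_mul C
      rwa [Real.zero_rpow (by positivity), mul_zero] at h2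
    obtain ⟨k, hk⟩ := (hlim.eventually (gt_mem_nhds (ENNReal.ofReal_pos.2 (half_pos hε)))).exists
    have hk1 : (0 : ℝ) < (k : ℝ) + 1 := by positivity
    refine ⟨fun t => Real.smoothTransition (((k : ℝ) + 1) * t - 1) * h t, ?_, ?_, ?_, ?_⟩
    · exact (Real.smoothTransition.contDiff.comp
        ((contDiff_const.mul contDiff_id).sub contDiff_const)).mul hs
    · refine ⟨1 / ((k : ℝ) + 1), by positivity, fun t ht => ?_⟩
      beta_reduce
      rw [Real.smoothTransition.zero_of_nonpos, zero_mul]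
      rw [le_div_iff₀ hk1] at ht
      linarith
    · refine ⟨max E 0 + 1, by positivity, fun t ht => ?_⟩
      have hmax : E ≤ max E 0 := le_max_left _ _
      have hmax' : 0 ≤ max E 0 := le_max_right _ _
      beta_reduce
      rw [image_eq_zero_of_notMem_tsupport (f := h) (x := t), mul_zero]
      intro hmem
      have := hE hmem
      rw [Metric.mem_closedBall, dist_zero_right, Real.norm_of_nonneg (by linarith)] at this
      linarith
    · have hmeas : AEStronglyMeasurable (fun t => Real.smoothTransition (((k : ℝ) + 1) * t - 1) *
          h t - h t) (volume.restrict (Set.Ioi 0)) :=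
        (((Real.smoothTransition.continuous.comp (by fun_prop)).mul hs.continuous).sub
          hs.continuous).aestronglyMeasurable
      have hsplit : (fun t => Real.smoothTransition (((k : ℝ) + 1) * t - 1) * h t - f t) =
          (fun t => Real.smoothTransition (((k : ℝ) + 1) * t - 1) * h t - h t) + (h - f) := by
        ext t; simp
      rw [hsplit]
      refine (eLpNorm_add_le hmeas (hs.continuous.aestronglyMeasurable.sub hf.1) hp1).trans ?_
      rw [← add_halves ε, ENNReal.ofReal_add (half_pos hε).le (half_pos hε).le]
      refine add_le_add ?_ (by rwa [eLpNorm_sub_comm])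
      refine le_trans ?_ hk.le
      have hC0 : 0 ≤ C := (norm_nonneg _).trans (hC 0)
      have hb : eLpNorm (fun t => Real.smoothTransition (((k : ℝ) + 1) * t - 1) * h t - h t)
          (ENNReal.ofReal p) (volume.restrict (Set.Ioi 0)) ≤
          eLpNorm ((Set.Ioc 0 (2 / ((k : ℝ) + 1))).indicator fun _ => C)
          (ENNReal.ofReal p) (volume.restrict (Set.Ioi 0)) := by
        refine eLpNorm_mono_ae ((ae_restrict_mem measurableSet_Ioi).mono fun t ht => ?_)
        by_cases htk : t ≤ 2 / ((k : ℝ) + 1)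
        · rw [Set.indicator_of_mem (show t ∈ Set.Ioc 0 (2 / ((k : ℝ) + 1)) from ⟨ht, htk⟩), Real.norm_of_nonneg hC0]
          have h1 := Real.smoothTransition.nonneg (((k : ℝ) + 1) * t - 1)
          have h2 := Real.smoothTransition.le_one (((k : ℝ) + 1) * t - 1)
          calc _ = ‖(Real.smoothTransition (((k : ℝ) + 1) * t - 1) - 1) * h t‖ := by
                congr 1; ring
            _ ≤ 1 * C := by
                rw [norm_mul]
                refine mul_le_mul ?_ (hC t) (norm_nonneg _) zero_le_one
                rw [Real.norm_eq_abs, abs_le]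
                constructor <;> linarith
            _ = C := one_mul C
        · rw [Real.smoothTransition.one_of_one_le, one_mul, sub_self, norm_zero]
          · exact norm_nonneg _
          · rw [not_le, div_lt_iff₀ hk1] at htk
            linarith
      refine hb.trans ((eLpNorm_indicator_const_le _ _).trans ?_)
      rw [ENNReal.toReal_ofReal hp0.le, Real.enorm_of_nonneg hC0, ENNReal.ofReal_mul hC0,
        ← ENNReal.ofReal_rpow_of_pos (by positivity)]
      gcongr
      refine (Measure.restrict_apply_le _ _).trans ?_
      simp
  choose g h1 h2 h3 h4 using fun k : ℕ => step (1 / ((k : ℝ) + 1)) (by positivity)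
  refine ⟨g, h1, h2, h3, tendsto_of_tendsto_of_tendsto_of_le_of_le tendsto_const_nhds ?_
    (fun _ => zero_le) h4⟩
  rw [← ENNReal.ofReal_zero]
  exact ENNReal.tendsto_ofReal tendsto_one_div_add_atTop_nhds_zero_nat

theorem integrableOn_Ioc_of_memLp_Ioi {p : ℝ} (hp : 1 ≤ p) {f : ℝ → ℝ}
    (hf : MemLp f (ENNReal.ofReal p) (volume.restrict (Set.Ioi 0))) (t : ℝ) :
    IntegrableOn f (Set.Ioc 0 t) := by
  have hp1 : 1 ≤ ENNReal.ofReal p := by simpa using ENNReal.ofReal_le_ofReal hp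
  have : MemLp f (ENNReal.ofReal p) (volume.restrict (Set.Ioc 0 t)) :=
    hf.mono_measure (Measure.restrict_mono Set.Ioc_subset_Ioi_self le_rfl)
  exact memLp_one_iff_integrable.1 (this.mono_exponent hp1)

/-- Hölder's inequality for a primitive of an `L^p` function on the half line. -/
theorem enorm_primitive_le {p : ℝ} (hp : 1 ≤ p) {f : ℝ → ℝ}
    (hf : AEStronglyMeasurable f (volume.restrict (Set.Ioi 0))) {t : ℝ} (ht : 0 ≤ t) :
    ‖∫ s in (0 : ℝ)..t, f s‖ₑ ≤ eLpNorm f (ENNReal.ofReal p) (volume.restrict (Set.Ioi 0)) *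
      ENNReal.ofReal t ^ (1 - 1 / p) := by
  have hp1 : 1 ≤ ENNReal.ofReal p := by simpa using ENNReal.ofReal_le_ofReal hp
  rw [intervalIntegral.integral_of_le ht]
  have hle : volume.restrict (Set.Ioc 0 t) ≤ volume.restrict (Set.Ioi (0 : ℝ)) :=
    Measure.restrict_mono Set.Ioc_subset_Ioi_self le_rfl
  refine (enorm_integral_le_lintegral_enorm _).trans ?_
  rw [← eLpNorm_one_eq_lintegral_enorm]
  refine (eLpNorm_le_eLpNorm_mul_rpow_measure_univ hp1 (hf.mono_measure hle)).trans ?_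
  simp only [Measure.restrict_apply_univ, Real.volume_Ioc, sub_zero, ENNReal.toReal_one, div_one]
  rw [ENNReal.toReal_ofReal (by linarith)]
  gcongr

/-- By Hölder on (0, t), the L^p error controls the error of the primitive at each fixed t. This
supplies the pointwise limits for Fatou's lemma. -/
theorem tendsto_primitive {p : ℝ} (hp : 1 ≤ p) {f : ℝ → ℝ} {g : ℕ → ℝ → ℝ} {l : Filter ℕ}
    (hf : MemLp f (ENNReal.ofReal p) (volume.restrict (Set.Ioi 0)))
    (hg : ∀ k, MemLp (g k) (ENNReal.ofReal p) (volume.restrict (Set.Ioi 0)))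
    (h : Tendsto (fun k => eLpNorm (fun t => g k t - f t) (ENNReal.ofReal p)
        (volume.restrict (Set.Ioi 0))) l (𝓝 0)) {t : ℝ} (ht : 0 ≤ t) :
    Tendsto (fun k => ∫ s in (0 : ℝ)..t, g k s) l (𝓝 (∫ s in (0 : ℝ)..t, f s)) := by
  rw [tendsto_iff_edist_tendsto_0]
  have hlim : Tendsto (fun k => eLpNorm (fun t => g k t - f t) (ENNReal.ofReal p)
        (volume.restrict (Set.Ioi 0)) * ENNReal.ofReal t ^ (1 - 1 / p)) l (𝓝 0) := by
    have := ENNReal.Tendsto.mul_const h (b := ENNReal.ofReal t ^ (1 - 1 / p))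
      (Or.inr (ENNReal.rpow_ne_top_of_nonneg
        (by rw [sub_nonneg, div_le_one (by linarith)]; exact hp) ENNReal.ofReal_ne_top))
    rwa [zero_mul] at this
  refine tendsto_of_tendsto_of_tendsto_of_le_of_le tendsto_const_nhds hlim
    (fun _ => zero_le) fun k => ?_
  have hi : ∀ {u : ℝ → ℝ}, MemLp u (ENNReal.ofReal p) (volume.restrict (Set.Ioi 0)) →
      IntervalIntegrable u volume 0 t := fun hu =>
    (intervalIntegrable_iff_integrableOn_Ioc_of_le ht).2 (integrableOn_Ioc_of_memLp_Ioi hp hu t)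
  simp only [edist_eq_enorm_sub]
  rw [← intervalIntegral.integral_sub (hi (hg k)) (hi hf)]
  exact enorm_primitive_le hp ((hg k).1.sub hf.1) ht
-- Bliss's inequality for all profiles in L^p.
/-- Bliss's inequality for nonnegative continuous functions vanishing near `0` and `∞`. -/
theorem bliss_continuous {N δ β p p' M e E : ℝ} {f : ℝ → ℝ} (hN : 1 < N) (hβ : 0 < β) (hδ : 0 < δ)
    (hNβ : N * β = (N - 1) * δ - 1) (hpp : p.HolderConjugate p') (hβp : β * p' = δ)
    (hM0 : 0 < M)
    (hM : ∫⁻ y in Set.Ioi (0 : ℝ), ENNReal.ofReal (y ^ δ * (1 + y ^ δ) ^ (-N)) = ENNReal.ofReal M)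
    (hB : ∫⁻ y in Set.Ioi (0 : ℝ), ENNReal.ofReal ((1 + y ^ δ) ^ (-N)) =
      ENNReal.ofReal (N * β * M))
    (hf : Continuous f) (hf0 : ∀ t, 0 ≤ f t) (he : 0 < e) (hfe : ∀ t ≤ e, f t = 0)
    (hE : 0 < E) (hfE : ∀ t ≥ E, f t = 0) :
    (∫⁻ t in Set.Ioi (0 : ℝ), ENNReal.ofReal ((∫ s in (0 : ℝ)..t, f s) ^ (N * δ) *
      t ^ (-((N - 1) * δ)))) ^ (1 / (N * δ)) * ENNReal.ofReal (N * β * M) ^ (1 / p) ≤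
      ENNReal.ofReal M ^ (1 / (N * δ)) *
        (∫⁻ t in Set.Ioi (0 : ℝ), ENNReal.ofReal (f t) ^ p) ^ (1 / p) := by
  set w : ℝ → ℝ := fun t => ∫ s in (0 : ℝ)..t, f s with hwdef
  set I := ∫⁻ t in Set.Ioi (0 : ℝ), ENNReal.ofReal (w t ^ (N * δ) * t ^ (-((N - 1) * δ))) with hI
  have hN0 : 0 < N := by linarith
  have hq : 0 < N * δ := mul_pos hN0 hδ
  have hwd : ∀ t, HasDerivAt w (f t) t := fun t =>
    intervalIntegral.integral_hasDerivAt_right (hf.intervalIntegrable _ _)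
      (hf.stronglyMeasurableAtFilter _ _) hf.continuousAt
  have hwm : Monotone w := monotone_of_hasDerivAt_nonneg hwd hf0
  have hw0 : w 0 = 0 := by simp [hwdef]
  have hwnn : ∀ t, 0 < t → 0 ≤ w t := fun t ht => by rw [← hw0]; exact hwm ht.le
  have hwe : ∀ t ≤ e, 0 < t → w t = 0 := fun t ht ht0 => by
    simp only [hwdef]
    rw [intervalIntegral.integral_of_le ht0.le]
    exact setIntegral_eq_zero_of_forall_eq_zero fun s hs => hfe s (hs.2.trans ht)
  have hwE : ∀ t, w t ≤ w E := fun t => by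
    rcases le_total t E with h | h
    · exact hwm h
    · have : w t - w E = ∫ s in E..t, f s := by
        simp only [hwdef]
        rw [intervalIntegral.integral_interval_sub_left (hf.intervalIntegrable _ _)
          (hf.intervalIntegrable _ _)]
      rw [intervalIntegral.integral_of_le h,
        setIntegral_eq_zero_of_forall_eq_zero fun s hs => hfE s hs.1.le] at this
      linarith
  -- Near 0 the primitive vanishes; beyond e it is bounded by w(E), and t^(-(N-1)δ) is integrable at
  -- infinity because (N-1)δ = 1 + Nβ > 1.
  have hIfin : I ≠ ∞ := by
    have h1 : I ≤ ∫⁻ t in Set.Ioi e, ENNReal.ofReal (w E ^ (N * δ) * t ^ (-((N - 1) * δ))) := by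
      rw [hI, ← Set.Ioc_union_Ioi_eq_Ioi he.le, lintegral_union measurableSet_Ioi
        (Set.Ioc_disjoint_Ioi le_rfl)]
      rw [show ∫⁻ t in Set.Ioc 0 e, ENNReal.ofReal (w t ^ (N * δ) * t ^ (-((N - 1) * δ))) = 0
        from ?_, zero_add]
      · refine setLIntegral_mono' measurableSet_Ioi fun t ht => ENNReal.ofReal_le_ofReal ?_
        have ht0 : 0 < t := he.trans ht
        exact mul_le_mul_of_nonneg_right (Real.rpow_le_rpow (hwnn t ht0) (hwE t) hq.le)
          (by positivity)
      · rw [← lintegral_zero (μ := volume.restrict (Set.Ioc 0 e))]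
        refine setLIntegral_congr_fun measurableSet_Ioc fun t ht => ?_
        simp [hwe t ht.2 ht.1, Real.zero_rpow hq.ne']
    have h2 : IntegrableOn (fun t : ℝ => w E ^ (N * δ) * t ^ (-((N - 1) * δ))) (Set.Ioi e) :=
      (integrableOn_Ioi_rpow_of_lt (by nlinarith [mul_pos hN0 hβ]) he).const_mul _
    refine (h1.trans_lt ?_).ne
    rw [← hasFiniteIntegral_iff_ofReal]
    · exact h2.2
    · refine (ae_restrict_mem measurableSet_Ioi).mono fun t ht => ?_
      have ht0 : 0 < t := he.trans ht
      have := hwnn E hE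
      simp only [Pi.zero_apply]
      positivity
  rcases eq_or_ne I 0 with hI0 | hI0
  · rw [hI0, ENNReal.zero_rpow_of_pos (by positivity), zero_mul]
    exact zero_le
  set J := I.toReal with hJ
  have hJpos : 0 < J := ENNReal.toReal_pos hI0 hIfin
  have hIJ : I = ENNReal.ofReal J := (ENNReal.ofReal_toReal hIfin).symm
  -- The left side of the integral is homogeneous of degree Nδ in f, so this multiple of f carries
  -- exactly the mass M.
  set c : ℝ := (M / J) ^ (1 / (N * δ)) with hc
  have hcpos : 0 < c := by positivity
  have hcq : c ^ (N * δ) = M / J := by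
    rw [hc, ← Real.rpow_mul (by positivity), one_div_mul_cancel hq.ne', Real.rpow_one]
  have hIc : ∫⁻ t in Set.Ioi (0 : ℝ), ENNReal.ofReal ((∫ s in (0 : ℝ)..t, c * f s) ^ (N * δ) *
      t ^ (-((N - 1) * δ))) = ENNReal.ofReal M := by
    have : M = M / J * J := by field_simp
    rw [this, ENNReal.ofReal_mul (by positivity), ← hIJ, hI,
      ← lintegral_const_mul' _ _ ENNReal.ofReal_ne_top]
    refine setLIntegral_congr_fun measurableSet_Ioi fun t ht => ?_
    rw [intervalIntegral.integral_const_mul, Real.mul_rpow hcpos.le (hwnn t ht), hcq,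
      ← ENNReal.ofReal_mul (by positivity), mul_assoc]
  have main := bliss_normalized (f := fun t => c * f t) hN hβ hδ hNβ hpp hβp hM0 hM hB
    (continuous_const.mul hf) (fun t => mul_nonneg hcpos.le (hf0 t)) he
    (fun t ht => by simp [hfe t ht]) hIc
  have hcX : (∫⁻ t in Set.Ioi (0 : ℝ), ENNReal.ofReal (c * f t) ^ p) ^ (1 / p) =
      ENNReal.ofReal c * (∫⁻ t in Set.Ioi (0 : ℝ), ENNReal.ofReal (f t) ^ p) ^ (1 / p) := by
    have h1 : ∀ t, ENNReal.ofReal (c * f t) ^ p = ENNReal.ofReal c ^ p * ENNReal.ofReal (f t) ^ p :=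
      fun t => by rw [ENNReal.ofReal_mul hcpos.le, ENNReal.mul_rpow_of_nonneg _ _ hpp.nonneg]
    simp_rw [h1]
    rw [lintegral_const_mul' _ _ (ENNReal.rpow_ne_top_of_nonneg hpp.nonneg ENNReal.ofReal_ne_top),
      ENNReal.mul_rpow_of_nonneg _ _ (one_div_nonneg.2 hpp.nonneg), ← ENNReal.rpow_mul,
      mul_one_div_cancel hpp.ne_zero, ENNReal.rpow_one]
  rw [hcX] at main
  have hMc : ENNReal.ofReal M ^ (1 / (N * δ)) = I ^ (1 / (N * δ)) * ENNReal.ofReal c := by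
    rw [hIJ, ENNReal.ofReal_rpow_of_pos hM0, ENNReal.ofReal_rpow_of_pos hJpos,
      ← ENNReal.ofReal_mul (by positivity), hc, ← Real.mul_rpow hJpos.le (by positivity)]
    congr 2
    field_simp
  rw [hMc, mul_assoc (I ^ (1 / (N * δ)))]
  exact mul_le_mul_right main _

/-- **Bliss's inequality** with the sharp constant. -/
theorem bliss_inequality {N δ β p p' M : ℝ} {f : ℝ → ℝ} (hN : 1 < N) (hβ : 0 < β) (hδ : 0 < δ)
    (hNβ : N * β = (N - 1) * δ - 1) (hpp : p.HolderConjugate p') (hβp : β * p' = δ)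
    (hM0 : 0 < M)
    (hM : ∫⁻ y in Set.Ioi (0 : ℝ), ENNReal.ofReal (y ^ δ * (1 + y ^ δ) ^ (-N)) = ENNReal.ofReal M)
    (hB : ∫⁻ y in Set.Ioi (0 : ℝ), ENNReal.ofReal ((1 + y ^ δ) ^ (-N)) =
      ENNReal.ofReal (N * β * M))
    (hf : MemLp f (ENNReal.ofReal p) (volume.restrict (Set.Ioi 0))) :
    (∫⁻ t in Set.Ioi (0 : ℝ), ENNReal.ofReal (|∫ s in (0 : ℝ)..t, f s| ^ (N * δ) *
      t ^ (-((N - 1) * δ)))) ^ (1 / (N * δ)) * ENNReal.ofReal (N * β * M) ^ (1 / p) ≤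
      ENNReal.ofReal M ^ (1 / (N * δ)) *
        eLpNorm f (ENNReal.ofReal p) (volume.restrict (Set.Ioi 0)) := by
  have hN0 : 0 < N := by linarith
  have hq : 0 < N * δ := mul_pos hN0 hδ
  have hp1 : 1 ≤ ENNReal.ofReal p := by simpa using ENNReal.ofReal_le_ofReal hpp.lt.le
  set b := ENNReal.ofReal (N * β * M) ^ (1 / p) with hb
  set m := ENNReal.ofReal M ^ (1 / (N * δ)) with hm
  have hb0 : b ≠ 0 := (ENNReal.rpow_pos (ENNReal.ofReal_pos.2 (by positivity))
    ENNReal.ofReal_ne_top).ne'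
  have hbt : b ≠ ∞ := ENNReal.rpow_ne_top_of_nonneg (one_div_nonneg.2 hpp.nonneg)
    ENNReal.ofReal_ne_top
  have hmt : m ≠ ∞ := ENNReal.rpow_ne_top_of_nonneg (by positivity) ENNReal.ofReal_ne_top
  obtain ⟨g, hg1, hg2, hg3, hg4⟩ := exists_seq_contDiff_tendsto_Lp_Ioi hpp.lt.le hf
  have hgc : ∀ k, Continuous (g k) := fun k => (hg1 k).continuous
  have hgm : ∀ k, MemLp (g k) (ENNReal.ofReal p) (volume.restrict (Set.Ioi 0)) := fun k => by
    have hcs : HasCompactSupport (g k) := by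
      obtain ⟨e, he, hge⟩ := hg2 k
      obtain ⟨E, hE, hgE⟩ := hg3 k
      refine HasCompactSupport.intro (isCompact_Icc (a := e) (b := E)) fun t ht => ?_
      by_contra h
      exact ht ⟨by by_contra! h'; exact h (hge t h'.le), by by_contra! h'; exact h (hgE t h'.le)⟩
    exact (hgc k).memLp_of_hasCompactSupport hcs
  set ν := eLpNorm f (ENNReal.ofReal p) (volume.restrict (Set.Ioi 0))
  set ε : ℕ → ℝ≥0∞ := fun k => eLpNorm (fun t => g k t - f t) (ENNReal.ofReal p)
        (volume.restrict (Set.Ioi 0))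
  have hnorm : ∀ k, (∫⁻ t in Set.Ioi (0 : ℝ), ENNReal.ofReal |g k t| ^ p) ^ (1 / p) ≤ ε k + ν :=
    fun k => by
    have h1 : (∫⁻ t in Set.Ioi (0 : ℝ), ENNReal.ofReal |g k t| ^ p) ^ (1 / p) =
        eLpNorm (g k) (ENNReal.ofReal p) (volume.restrict (Set.Ioi 0)) := by
      rw [eLpNorm_ofReal_eq_lintegral hpp.pos]
      simp_rw [ENNReal.ofReal_rpow_of_nonneg (abs_nonneg _) hpp.nonneg, Real.norm_eq_abs]
    rw [h1]
    have h2 : g k = (fun t => g k t - f t) + f := by ext; simp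
    nth_rewrite 1 [h2]
    exact eLpNorm_add_le ((hgm k).1.sub hf.1) hf.1 hp1
  have hk : ∀ k, ∫⁻ t in Set.Ioi (0 : ℝ), ENNReal.ofReal (|∫ s in (0 : ℝ)..t, g k s| ^ (N * δ) *
      t ^ (-((N - 1) * δ))) ≤ (m * (ε k + ν) / b) ^ (N * δ) := fun k => by
    obtain ⟨e, he, hge⟩ := hg2 k
    obtain ⟨E, hE, hgE⟩ := hg3 k
    -- Replacing g by its absolute value keeps the L^p norm and can only increase the modulus of the
    -- primitive.
    have := bliss_continuous (f := fun t => |g k t|) hN hβ hδ hNβ hpp hβp hM0 hM hB (hgc k).abs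
      (fun t => abs_nonneg _) he (fun t ht => by simp [hge t ht]) hE
      (fun t ht => by simp [hgE t ht])
    have h3 := this.trans (mul_le_mul_right (hnorm k) _)
    rw [← ENNReal.le_div_iff_mul_le (Or.inl hb0) (Or.inl hbt)] at h3
    have h4 := ENNReal.rpow_le_rpow h3 hq.le
    rw [← ENNReal.rpow_mul, one_div_mul_cancel hq.ne', ENNReal.rpow_one] at h4
    refine le_trans ?_ h4
    refine setLIntegral_mono' measurableSet_Ioi fun t ht => ENNReal.ofReal_le_ofReal ?_
    have ht' : (0 : ℝ) < t := ht
    refine mul_le_mul_of_nonneg_right (Real.rpow_le_rpow (abs_nonneg _) ?_ hq.le) (by positivity)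
    exact intervalIntegral.abs_integral_le_integral_abs ht'.le
  have hlim : Tendsto (fun k => (m * (ε k + ν) / b) ^ (N * δ)) atTop
      (𝓝 ((m * ν / b) ^ (N * δ))) := by
    have h1 : Tendsto (fun k => ε k + ν) atTop (𝓝 ν) := by
      simpa using hg4.add_const ν
    exact (ENNReal.Tendsto.div_const (ENNReal.Tendsto.const_mul h1 (Or.inr hmt))
      (Or.inr hb0)).ennrpow_const _
  -- The bound for smooth profiles is stated without the outer root so that Fatou's lemma applies
  -- directly to the integrands.
  have hfatou : ∫⁻ t in Set.Ioi (0 : ℝ), ENNReal.ofReal (|∫ s in (0 : ℝ)..t, f s| ^ (N * δ) *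
      t ^ (-((N - 1) * δ))) ≤ (m * ν / b) ^ (N * δ) := by
    calc _ = ∫⁻ t in Set.Ioi (0 : ℝ), liminf (fun k =>
          ENNReal.ofReal (|∫ s in (0 : ℝ)..t, g k s| ^ (N * δ) * t ^ (-((N - 1) * δ)))) atTop := by
          refine setLIntegral_congr_fun measurableSet_Ioi fun t ht => ?_
          have ht' : (0 : ℝ) < t := ht
          refine (Tendsto.liminf_eq (ENNReal.tendsto_ofReal ?_)).symm
          exact ((tendsto_primitive hpp.lt.le hf hgm hg4 ht'.le).abs.rpow_const
            (Or.inr hq.le)).mul_const _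
      _ ≤ liminf (fun k => ∫⁻ t in Set.Ioi (0 : ℝ), ENNReal.ofReal
          (|∫ s in (0 : ℝ)..t, g k s| ^ (N * δ) * t ^ (-((N - 1) * δ)))) atTop := by
          refine lintegral_liminf_le fun k => ?_
          have : Continuous fun t => ∫ s in (0 : ℝ)..t, g k s :=
            intervalIntegral.continuous_primitive (fun a b => (hgc k).intervalIntegrable a b) 0
          have := this.measurable
          fun_prop
      _ ≤ liminf (fun k => (m * (ε k + ν) / b) ^ (N * δ)) atTop :=
          liminf_le_liminf (Eventually.of_forall hk)
      _ = _ := hlim.liminf_eq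
  have h4 := ENNReal.rpow_le_rpow hfatou (one_div_nonneg.2 hq.le)
  rw [← ENNReal.rpow_mul (m * ν / b), mul_one_div_cancel hq.ne', ENNReal.rpow_one] at h4
  rwa [ENNReal.le_div_iff_mul_le (Or.inl hb0) (Or.inl hbt)] at h4

/-! ### Beta integrals behind the sharp constant. -/

theorem lintegral_Ioi_comp_mul {c : ℝ} (hc : 0 < c) (g : ℝ → ℝ≥0∞) :
    ∫⁻ t in Set.Ioi (0 : ℝ), g t = ENNReal.ofReal c * ∫⁻ y in Set.Ioi (0 : ℝ), g (c * y) := by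
  have himg : (fun y => c * y) '' Set.Ioi (0 : ℝ) = Set.Ioi 0 := by
    rw [Set.image_mul_left_Ioi hc, mul_zero]
  nth_rewrite 1 [← himg]
  rw [lintegral_image_eq_lintegral_abs_deriv_mul (f' := fun _ => c) measurableSet_Ioi
    (fun x _ => by simpa using ((hasDerivAt_id x).const_mul c).hasDerivWithinAt)
    ((mul_right_injective₀ hc.ne').injOn), abs_of_pos hc,
    ← lintegral_const_mul' _ _ ENNReal.ofReal_ne_top]

/-- Euler's beta integral over the half line. -/
theorem lintegral_rpow_mul_one_add_rpow {N δ s : ℝ} (hδ : 0 < δ) (hs : -1 < s)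
    (hN : (s + 1) / δ < N) :
    ∫⁻ y in Set.Ioi (0 : ℝ), ENNReal.ofReal (y ^ s * (1 + y ^ δ) ^ (-N)) =
      ENNReal.ofReal (1 / δ * ProbabilityTheory.beta ((s + 1) / δ) (N - (s + 1) / δ)) := by
  set a := (s + 1) / δ with ha
  have ha0 : 0 < a := div_pos (by linarith) hδ
  have hb0 : 0 < N - a := by linarith
  -- This substitution maps (0, ∞) onto (0, 1) and the integrand to a multiple of a beta density,
  -- whose total mass is one.
  set x : ℝ → ℝ := fun y => y ^ δ / (1 + y ^ δ) with hx
  have hpos : ∀ y ∈ Set.Ioi (0 : ℝ), 0 < y ^ δ := fun y hy => Real.rpow_pos_of_pos hy _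
  have hd : ∀ y ∈ Set.Ioi (0 : ℝ), HasDerivWithinAt x (δ * y ^ (δ - 1) / (1 + y ^ δ) ^ 2)
      (Set.Ioi 0) y := fun y hy => by
    have h1 := Real.hasDerivAt_rpow_const (x := y) (p := δ) (Or.inl (ne_of_gt hy))
    have h2 := h1.div (h1.const_add 1) (by have := hpos y hy; positivity)
    refine (h2.congr_deriv ?_).hasDerivWithinAt
    congr 1
    ring
  have hinj : Set.InjOn x (Set.Ioi 0) := fun y hy z hz hyz => by
    have h1 := hpos y hy
    have h2 := hpos z hz
    simp only [hx] at hyz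
    rw [div_eq_div_iff (by positivity) (by positivity)] at hyz
    exact (Real.rpow_left_inj (le_of_lt hy) (le_of_lt hz) hδ.ne').1 (by linarith)
  have himg : x '' Set.Ioi 0 = Set.Ioo 0 1 := by
    refine Set.Subset.antisymm ?_ ?_
    · rintro _ ⟨y, hy, rfl⟩
      have h1 := hpos y hy
      exact ⟨by simp only [hx]; positivity, by simp only [hx]; rw [div_lt_one (by positivity)]; linarith⟩
    · rintro u ⟨hu0, hu1⟩
      have h1 : 0 < u / (1 - u) := div_pos hu0 (by linarith)
      refine ⟨(u / (1 - u)) ^ (1 / δ), Real.rpow_pos_of_pos h1 _, ?_⟩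
      simp only [hx]
      rw [← Real.rpow_mul h1.le, one_div_mul_cancel hδ.ne', Real.rpow_one]
      have : 1 - u ≠ 0 := by linarith
      field_simp
      ring
  have hbeta := ProbabilityTheory.lintegral_betaPDF_eq_one ha0 hb0
  have hβ0 := ProbabilityTheory.beta_pos ha0 hb0
  rw [ProbabilityTheory.lintegral_betaPDF, ← himg,
    lintegral_image_eq_lintegral_abs_deriv_mul measurableSet_Ioi hd hinj] at hbeta
  set bt := ProbabilityTheory.beta a (N - a)
  have hkey : ∫⁻ y in Set.Ioi (0 : ℝ), ENNReal.ofReal (δ / bt) *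
      ENNReal.ofReal (y ^ s * (1 + y ^ δ) ^ (-N)) = 1 := by
    rw [← hbeta]
    refine setLIntegral_congr_fun measurableSet_Ioi fun y hy => ?_
    have hy' : 0 < y := hy
    have h1 := hpos y hy
    have h2 : 0 < 1 + y ^ δ := by positivity
    rw [← ENNReal.ofReal_mul (by positivity), ← ENNReal.ofReal_mul (abs_nonneg _)]
    congr 1
    rw [abs_of_pos (by positivity)]
    have h3 : 1 - x y = 1 / (1 + y ^ δ) := by simp only [hx]; field_simp; ring
    have h4 : y ^ s * (1 + y ^ δ) ^ (-N) =
        y ^ (δ - 1) / (1 + y ^ δ) ^ (2 : ℕ) * (x y ^ (a - 1) * (1 - x y) ^ (N - a - 1)) := by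
      rw [h3]
      simp only [hx]
      obtain ⟨d, hd⟩ := exists_exp_eq h2
      rw [hd]
      obtain ⟨c, rfl⟩ := exists_exp_eq hy'
      rw [show 1 / Real.exp d = Real.exp (-d) by rw [Real.exp_neg, one_div],
        show Real.exp d ^ (2 : ℕ) = Real.exp (2 * d) by rw [two_mul, Real.exp_add, sq]]
      simp only [← Real.exp_mul, ← Real.exp_add, ← Real.exp_sub]
      congr 1
      rw [show s = a * δ - 1 by rw [ha]; field_simp; ring]
      ring
    rw [h4]
    field_simp
  rw [lintegral_const_mul' _ _ ENNReal.ofReal_ne_top] at hkey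
  have h5 := ENNReal.eq_inv_of_mul_eq_one_left (by rw [mul_comm]; exact hkey)
  rw [h5, ← ENNReal.ofReal_inv_of_pos (by positivity)]
  congr 1
  field_simp

/-- The total mass of the extremal density in Bliss's inequality. -/
noncomputable def blissMass (N δ : ℝ) : ℝ :=
  1 / δ * ProbabilityTheory.beta ((δ + 1) / δ) (N - (δ + 1) / δ)

section
variable {N δ β : ℝ}

/-- Integrability of the extremal density at infinity: it amounts to (N-1)δ > 1. -/
theorem bliss_exponent_lt (hβ : 0 < β) (hδ : 0 < δ) (hN : 1 < N)
    (hNβ : N * β = (N - 1) * δ - 1) : (δ + 1) / δ < N := by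
  rw [div_lt_iff₀ hδ]
  nlinarith [mul_pos (by linarith : 0 < N) hβ]

theorem blissMass_pos (hβ : 0 < β) (hδ : 0 < δ) (hN : 1 < N)
    (hNβ : N * β = (N - 1) * δ - 1) : 0 < blissMass N δ := by
  have h := bliss_exponent_lt hβ hδ hN hNβ
  exact mul_pos (by positivity) (ProbabilityTheory.beta_pos (by positivity) (by linarith))

theorem lintegral_blissMass (hβ : 0 < β) (hδ : 0 < δ) (hN : 1 < N)
    (hNβ : N * β = (N - 1) * δ - 1) :
    ∫⁻ y in Set.Ioi (0 : ℝ), ENNReal.ofReal (y ^ δ * (1 + y ^ δ) ^ (-N)) =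
      ENNReal.ofReal (blissMass N δ) :=
  lintegral_rpow_mul_one_add_rpow hδ (by linarith) (bliss_exponent_lt hβ hδ hN hNβ)

/-- The mass and the energy are the beta integrals B(1/δ + 1, c) and B(1/δ, c + 1), up to the same
factor 1/δ, with c = N - 1/δ - 1. The recursion of the Gamma function makes their ratio δc = (N-1)δ
- 1 = Nβ. -/
theorem lintegral_bliss_energy (hβ : 0 < β) (hδ : 0 < δ) (hN : 1 < N)
    (hNβ : N * β = (N - 1) * δ - 1) :
    ∫⁻ y in Set.Ioi (0 : ℝ), ENNReal.ofReal ((1 + y ^ δ) ^ (-N)) =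
      ENNReal.ofReal (N * β * blissMass N δ) := by
  have h := bliss_exponent_lt hβ hδ hN hNβ
  have hδ1 : (δ + 1) / δ = 1 / δ + 1 := by field_simp; ring
  rw [hδ1] at h
  have h0 := lintegral_rpow_mul_one_add_rpow (N := N) (s := 0) hδ (by norm_num)
    (by rw [zero_add]; linarith)
  simp only [Real.rpow_zero, one_mul, zero_add] at h0
  rw [h0, blissMass, hδ1]
  congr 1
  simp only [ProbabilityTheory.beta]
  rw [show N - 1 / δ = N - (1 / δ + 1) + 1 by ring,
    show 1 / δ + (N - (1 / δ + 1) + 1) = N by ring,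
    show 1 / δ + 1 + (N - (1 / δ + 1)) = N by ring,
    Real.Gamma_add_one (s := N - (1 / δ + 1)) (by linarith),
    Real.Gamma_add_one (s := 1 / δ) (by positivity), hNβ]
  field_simp
  ring

/-- The dilation t = (b/a)^(1/δ) y normalises the parameters. -/
theorem lintegral_extremal {a b s : ℝ} (ha : 0 < a) (hb : 0 < b) (hδ : 0 < δ) :
    ∫⁻ t in Set.Ioi (0 : ℝ), ENNReal.ofReal (t ^ s * (a * t ^ δ + b) ^ (-N)) =
      ENNReal.ofReal (b ^ (-N) * (b / a) ^ ((s + 1) / δ)) *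
        ∫⁻ y in Set.Ioi (0 : ℝ), ENNReal.ofReal (y ^ s * (1 + y ^ δ) ^ (-N)) := by
  have hba : 0 < b / a := div_pos hb ha
  rw [lintegral_Ioi_comp_mul (c := (b / a) ^ (1 / δ)) (by positivity),
    ← lintegral_const_mul' _ _ ENNReal.ofReal_ne_top,
    ← lintegral_const_mul' _ _ ENNReal.ofReal_ne_top]
  refine setLIntegral_congr_fun measurableSet_Ioi fun y hy => ?_
  have hy' : 0 < y := hy
  rw [← ENNReal.ofReal_mul (by positivity), ← ENNReal.ofReal_mul (by positivity)]
  congr 1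
  rw [Real.mul_rpow (by positivity) hy'.le, Real.mul_rpow (by positivity) hy'.le,
    ← Real.rpow_mul hba.le, ← Real.rpow_mul hba.le, one_div_mul_cancel hδ.ne', Real.rpow_one,
    show a * (b / a * y ^ δ) + b = b * (1 + y ^ δ) by field_simp; ring,
    Real.mul_rpow hb.le (by positivity),
    show (s + 1) / δ = 1 / δ + 1 / δ * s by field_simp; ring, Real.rpow_add hba]
  ring

end

/-! ### Polar coordinates and the radial change of variable. -/

/-- Integration in polar coordinates. -/
theorem lintegral_eq_lintegral_sphere {n : ℕ} (hn : 0 < n) {F : EuclideanSpace ℝ (Fin n) → ℝ≥0∞}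
    (hF : Measurable F) :
    ∫⁻ x, F x = ∫⁻ θ, (∫⁻ r in Set.Ioi (0 : ℝ), ENNReal.ofReal (r ^ (n - 1)) *
      F (r • (θ : EuclideanSpace ℝ (Fin n))))
      ∂(volume : Measure (EuclideanSpace ℝ (Fin n))).toSphere := by
  have : Nonempty (Fin n) := ⟨⟨0, hn⟩⟩
  have hmp := (volume : Measure (EuclideanSpace ℝ (Fin n))).measurePreserving_homeomorphUnitSphereProd
  have hsm : MeasurableSet ({0}ᶜ : Set (EuclideanSpace ℝ (Fin n))) :=
    (measurableSet_singleton _).compl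
  have h1 : ∫⁻ x, F x = ∫⁻ x : ({0}ᶜ : Set (EuclideanSpace ℝ (Fin n))), F x
      ∂(Measure.comap Subtype.val volume) := by
    rw [lintegral_subtype_comap hsm, restrict_compl_singleton]
  have hFm : Measurable fun z : Metric.sphere (0 : EuclideanSpace ℝ (Fin n)) 1 × Set.Ioi (0 : ℝ) =>
      F ((z.2 : ℝ) • (z.1 : EuclideanSpace ℝ (Fin n))) := by
    refine hF.comp ?_
    fun_prop
  have h2 : ∀ x : ({0}ᶜ : Set (EuclideanSpace ℝ (Fin n))), F x =
      (fun z : Metric.sphere (0 : EuclideanSpace ℝ (Fin n)) 1 × Set.Ioi (0 : ℝ) =>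
      F ((z.2 : ℝ) • (z.1 : EuclideanSpace ℝ (Fin n))))
        (homeomorphUnitSphereProd (EuclideanSpace ℝ (Fin n)) x) := fun x => by
    simp only [homeomorphUnitSphereProd_apply_fst_coe, homeomorphUnitSphereProd_apply_snd_coe]
    rw [smul_inv_smul₀ (norm_ne_zero_iff.2 x.2)]
  rw [h1]
  simp_rw [h2]
  rw [hmp.lintegral_comp hFm, lintegral_prod _ hFm.aemeasurable]
  refine lintegral_congr fun θ => ?_
  rw [Measure.volumeIoiPow, lintegral_withDensity_eq_lintegral_mul _ (by fun_prop) (by fun_prop)]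
  simp only [Pi.mul_apply, finrank_euclideanSpace, Fintype.card_fin]
  exact lintegral_subtype_comap measurableSet_Ioi fun r : ℝ =>
    ENNReal.ofReal (r ^ (n - 1)) * F (r • (θ : EuclideanSpace ℝ (Fin n)))

theorem lintegral_ball_eq_lintegral_sphere {n : ℕ} (hn : 0 < n) (R : ℝ)
    {F : EuclideanSpace ℝ (Fin n) → ℝ≥0∞} (hF : Measurable F) :
    ∫⁻ x in Metric.ball 0 R, F x =
      ∫⁻ θ, (∫⁻ r in Set.Ioo (0 : ℝ) R, ENNReal.ofReal (r ^ (n - 1)) *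
      F (r • (θ : EuclideanSpace ℝ (Fin n))))
      ∂(volume : Measure (EuclideanSpace ℝ (Fin n))).toSphere := by
  rw [← lintegral_indicator measurableSet_ball,
    lintegral_eq_lintegral_sphere hn (hF.indicator measurableSet_ball)]
  refine lintegral_congr fun θ => ?_
  rw [← Set.Ioi_inter_Iio, Set.inter_comm, ← setLIntegral_indicator measurableSet_Iio]
  refine setLIntegral_congr_fun measurableSet_Ioi fun r hr => ?_
  have hr' : (0 : ℝ) < r := hr
  have hnorm : ‖r • (θ : EuclideanSpace ℝ (Fin n))‖ = r := by
    rw [norm_smul, Real.norm_of_nonneg hr'.le, norm_eq_of_mem_sphere, mul_one]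
  by_cases h : r < R <;> simp [Set.indicator, hnorm, h]

/-- The change of variables `t = r ^ (-α) - R ^ (-α)`. -/
noncomputable def radialCoord (α R r : ℝ) : ℝ := r ^ (-α) - R ^ (-α)

/-- The inverse of `radialCoord`. -/
noncomputable def radialCoordInv (α R t : ℝ) : ℝ := (t + R ^ (-α)) ^ (-(1 / α))

section radialCoord
variable {α R : ℝ}

theorem radialCoord_pos (hα : 0 < α) {r : ℝ} (hr : r ∈ Set.Ioo 0 R) : 0 < radialCoord α R r :=
  sub_pos.2 (Real.rpow_lt_rpow_of_neg hr.1 hr.2 (neg_lt_zero.2 hα))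

theorem radialCoordInv_mem (hα : 0 < α) (hR : 0 < R) {t : ℝ} (ht : 0 < t) :
    radialCoordInv α R t ∈ Set.Ioo 0 R := by
  have h : 0 < R ^ (-α) := Real.rpow_pos_of_pos hR _
  refine ⟨Real.rpow_pos_of_pos (by linarith) _, ?_⟩
  have h1 : R = (R ^ (-α)) ^ (-(1 / α)) := by
    rw [← Real.rpow_mul hR.le, neg_mul_neg, mul_one_div_cancel hα.ne', Real.rpow_one]
  nth_rewrite 2 [h1]
  exact Real.rpow_lt_rpow_of_neg h (by linarith) (neg_lt_zero.2 (by positivity))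

theorem radialCoord_radialCoordInv (hα : 0 < α) (hR : 0 < R) {t : ℝ} (ht : 0 < t) :
    radialCoord α R (radialCoordInv α R t) = t := by
  have h : 0 < R ^ (-α) := Real.rpow_pos_of_pos hR _
  rw [radialCoord, radialCoordInv, ← Real.rpow_mul (by linarith), neg_mul_neg,
    one_div_mul_cancel hα.ne', Real.rpow_one, add_sub_cancel_right]

theorem radialCoordInv_radialCoord (hα : 0 < α) {r : ℝ} (hr : 0 < r) :
    radialCoordInv α R (radialCoord α R r) = r := by
  rw [radialCoord, radialCoordInv, sub_add_cancel, ← Real.rpow_mul hr.le, neg_mul_neg,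
    mul_one_div_cancel hα.ne', Real.rpow_one]

theorem hasDerivAt_radialCoord {r : ℝ} (hr : 0 < r) :
    HasDerivAt (radialCoord α R) (-α * r ^ (-α - 1)) r :=
  (Real.hasDerivAt_rpow_const (Or.inl hr.ne')).sub_const _

theorem hasDerivAt_radialCoordInv (hα : 0 < α) (hR : 0 < R) {t : ℝ} (ht : 0 < t) :
    HasDerivAt (radialCoordInv α R) (-α * radialCoordInv α R t ^ (-α - 1))⁻¹ t := by
  have h : 0 < R ^ (-α) := Real.rpow_pos_of_pos hR _
  have h1 : HasDerivAt (radialCoordInv α R) _ t :=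
    ((hasDerivAt_id t).add_const (R ^ (-α))).rpow_const (p := -(1 / α))
    (Or.inl (by simp only [id]; linarith))
  refine HasDerivAt.of_local_left_inverse h1.continuousAt
    (hasDerivAt_radialCoord (R := R) (radialCoordInv_mem hα hR ht).1) ?_ ?_
  · have := (radialCoordInv_mem hα hR ht).1
    exact mul_ne_zero (by linarith) (by positivity)
  · filter_upwards [lt_mem_nhds ht] with s hs using radialCoord_radialCoordInv hα hR hs

theorem radialCoord_image (hα : 0 < α) (hR : 0 < R) :
    radialCoord α R '' Set.Ioo 0 R = Set.Ioi 0 :=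
  Set.Subset.antisymm (Set.image_subset_iff.2 fun _ hr => radialCoord_pos hα hr) fun _ ht =>
    ⟨_, radialCoordInv_mem hα hR ht, radialCoord_radialCoordInv hα hR ht⟩

theorem radialCoord_injOn (hα : 0 < α) : Set.InjOn (radialCoord α R) (Set.Ioo 0 R) :=
  fun r hr s hs h => by
    rw [← radialCoordInv_radialCoord (R := R) hα hr.1, h, radialCoordInv_radialCoord hα hs.1]

/-- Change of variables in one dimension. -/
theorem lintegral_radialCoord (hα : 0 < α) (hR : 0 < R) (F : ℝ → ℝ≥0∞) :
    ∫⁻ r in Set.Ioo 0 R, ENNReal.ofReal (r ^ (-α - 1)) * F (radialCoord α R r) =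
      ENNReal.ofReal (1 / α) * ∫⁻ t in Set.Ioi (0 : ℝ), F t := by
  rw [← radialCoord_image hα hR, lintegral_image_eq_lintegral_abs_deriv_mul measurableSet_Ioo
    (fun r hr => (hasDerivAt_radialCoord hr.1).hasDerivWithinAt) (radialCoord_injOn hα),
    ← lintegral_const_mul' _ _ ENNReal.ofReal_ne_top]
  refine setLIntegral_congr_fun measurableSet_Ioo fun r hr => ?_
  have hr' := hr.1
  rw [← mul_assoc, ← ENNReal.ofReal_mul (by positivity), neg_mul, abs_neg, abs_of_pos (by positivity)]
  congr 2
  field_simp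

theorem measurable_radialCoord : Measurable (radialCoord α R) := by
  unfold radialCoord; fun_prop

end radialCoord

/-- Change of variables for radial functions on a ball. -/
theorem lintegral_ball_radialCoord {n : ℕ} (hn : 0 < n) {α R : ℝ} (hα : 0 < α) (hR : 0 < R)
    {F : ℝ → ℝ≥0∞} (hF : Measurable F) :
    ∫⁻ x in Metric.ball (0 : EuclideanSpace ℝ (Fin n)) R,
      ENNReal.ofReal (‖x‖ ^ (-((n : ℝ) + α))) * F (radialCoord α R ‖x‖) =
      (volume : Measure (EuclideanSpace ℝ (Fin n))).toSphere Set.univ * ENNReal.ofReal (1 / α) *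
        ∫⁻ t in Set.Ioi (0 : ℝ), F t := by
  rw [lintegral_ball_eq_lintegral_sphere hn R (by
    have := measurable_radialCoord (α := α) (R := R)
    fun_prop), mul_assoc, ← lintegral_radialCoord hα hR, mul_comm, ← lintegral_const]
  refine lintegral_congr fun θ => setLIntegral_congr_fun measurableSet_Ioo fun r hr => ?_
  have hr' := hr.1
  have hnorm : ‖r • (θ : EuclideanSpace ℝ (Fin n))‖ = r := by
    rw [norm_smul, Real.norm_of_nonneg hr'.le, norm_eq_of_mem_sphere, mul_one]
  rw [hnorm, ← mul_assoc, ← ENNReal.ofReal_mul (by positivity)]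
  congr 2
  -- The polar factor r^(n-1) times r^(-(n+α)) is r^(-α-1), the Jacobian of the coordinate up to the
  -- constant α.
  rw [← Real.rpow_natCast, ← Real.rpow_add hr', Nat.cast_sub hn]
  congr 1
  push_cast
  ring

/-! ### Test functions and weak gradients. -/

/-- On a finite measure space L^p convergence implies L^1 convergence. Products with a bounded
factor are covered by the constant C, so the weak gradient identity passes to limits. -/
theorem tendsto_integral_of_norm_sub_le {α E E' : Type*} [MeasurableSpace α] {μ : Measure α}
    [IsFiniteMeasure μ] [NormedAddCommGroup E] [NormedSpace ℝ E] [NormedAddCommGroup E']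
    {p : ℝ≥0∞} (hp : 1 ≤ p) {F : α → E} {Fk : ℕ → α → E} {f : α → E'} {fk : ℕ → α → E'} {C : ℝ}
    (hF : Integrable F μ) (hFk : ∀ k, Integrable (Fk k) μ)
    (hf : AEStronglyMeasurable f μ) (hfk : ∀ k, AEStronglyMeasurable (fk k) μ)
    (hle : ∀ k x, ‖Fk k x - F x‖ ≤ C * ‖fk k x - f x‖)
    (h : Tendsto (fun k => eLpNorm (fun x => fk k x - f x) p μ) atTop (𝓝 0)) :
    Tendsto (fun k => ∫ x, Fk k x ∂μ) atTop (𝓝 (∫ x, F x ∂μ)) := by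
  refine tendsto_integral_of_L1' F hF.1 (Eventually.of_forall hFk) ?_
  set K : ℝ≥0∞ := ENNReal.ofReal C * μ Set.univ ^ (1 / (1 : ℝ≥0∞).toReal - 1 / p.toReal) with hK
  have hKt : K ≠ ∞ := by
    refine ENNReal.mul_ne_top ENNReal.ofReal_ne_top (ENNReal.rpow_ne_top_of_nonneg ?_
      (measure_ne_top _ _))
    rcases eq_or_ne p ∞ with rfl | hpt
    · simp
    · have : 1 ≤ p.toReal := by simpa using ENNReal.toReal_mono hpt hp
      rw [ENNReal.toReal_one, div_one, sub_nonneg, div_le_one (by linarith)]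
      exact this
  have hlim := ENNReal.Tendsto.mul_const h (b := K) (Or.inr hKt)
  rw [zero_mul] at hlim
  refine tendsto_of_tendsto_of_tendsto_of_le_of_le tendsto_const_nhds hlim (fun _ => zero_le)
    fun k => ?_
  calc eLpNorm (Fk k - F) 1 μ ≤ ENNReal.ofReal C * eLpNorm (fun x => fk k x - f x) 1 μ :=
        eLpNorm_le_mul_eLpNorm_of_ae_le_mul (Eventually.of_forall (hle k)) 1
    _ ≤ ENNReal.ofReal C * (eLpNorm (fun x => fk k x - f x) p μ *
        μ Set.univ ^ (1 / (1 : ℝ≥0∞).toReal - 1 / p.toReal)) := by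
        gcongr
        exact eLpNorm_le_eLpNorm_mul_rpow_measure_univ hp ((hfk k).sub hf)
    _ = _ := by rw [hK]; ring

section
variable {n : ℕ} {Ω : Set (EuclideanSpace ℝ (Fin n))}

theorem IsTestFunction.continuous_gradient {φ : EuclideanSpace ℝ (Fin n) → ℝ}
    (h : IsTestFunction Ω φ) : Continuous (gradient φ) :=
  (InnerProductSpace.toDual ℝ _).symm.continuous.comp (h.1.continuous_fderiv (by simp))

theorem IsTestFunction.hasCompactSupport_gradient {φ : EuclideanSpace ℝ (Fin n) → ℝ}
    (h : IsTestFunction Ω φ) : HasCompactSupport (gradient φ) :=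
  (h.2.1.fderiv (𝕜 := ℝ)).comp_left (g := (InnerProductSpace.toDual ℝ _).symm) (map_zero _)

theorem inner_gradient_eq_fderiv (φ : EuclideanSpace ℝ (Fin n) → ℝ)
    (x v : EuclideanSpace ℝ (Fin n)) : inner ℝ (gradient φ x) v = fderiv ℝ φ x v := by
  rw [gradient, InnerProductSpace.toDual_symm_apply]

/-- Integration by parts for test functions. -/
theorem IsTestFunction.integral_smul_gradient {φ ψ : EuclideanSpace ℝ (Fin n) → ℝ}
    (hφ : IsTestFunction Ω φ) (hψ : IsTestFunction Ω ψ) :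
    ∫ x in Ω, φ x • gradient ψ x = -∫ x in Ω, ψ x • gradient φ x := by
  have hint : ∀ {φ ψ : EuclideanSpace ℝ (Fin n) → ℝ}, IsTestFunction Ω φ → IsTestFunction Ω ψ →
      Integrable fun x => φ x • gradient ψ x := fun hφ hψ =>
    (hφ.1.continuous.smul hψ.continuous_gradient).integrable_of_hasCompactSupport hφ.2.1.smul_right
  have hset : ∀ {φ ψ : EuclideanSpace ℝ (Fin n) → ℝ}, IsTestFunction Ω φ →
      ∫ x in Ω, φ x • gradient ψ x = ∫ x, φ x • gradient ψ x := fun hφ =>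
    setIntegral_eq_integral_of_forall_compl_eq_zero fun x hx => by
      rw [image_eq_zero_of_notMem_tsupport fun h => hx (hφ.2.2 h), zero_smul]
  rw [hset hφ, hset hψ]
  -- Pairing with a fixed vector reduces the identity to scalar integration by parts for a
  -- directional derivative.
  refine ext_inner_left ℝ fun v => ?_
  rw [inner_neg_right, ← integral_inner (hint hφ hψ), ← integral_inner (hint hψ hφ)]
  have h1 : ∀ (φ ψ : EuclideanSpace ℝ (Fin n) → ℝ) x, inner ℝ v (φ x • gradient ψ x) =
      φ x * fderiv ℝ ψ x v := fun φ ψ x => by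
    rw [inner_smul_right, real_inner_comm, inner_gradient_eq_fderiv]
  have hint' : ∀ {φ ψ : EuclideanSpace ℝ (Fin n) → ℝ}, IsTestFunction Ω φ → IsTestFunction Ω ψ →
      Integrable fun x => φ x * fderiv ℝ ψ x v := fun {φ ψ} hφ hψ => by
    simp_rw [← h1]
    exact (hint hφ hψ).const_inner v
  simp_rw [h1]
  rw [integral_mul_fderiv_eq_neg_fderiv_mul_of_integrable]
  · simp_rw [mul_comm]
  · simp_rw [mul_comm (fderiv ℝ φ _ v)]
    exact hint' hψ hφ
  · exact hint' hφ hψ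
  · exact (hφ.1.continuous.mul hψ.1.continuous).integrable_of_hasCompactSupport hφ.2.1.mul_right
  · exact fun x _ => (hφ.1.differentiable (by simp)) x
  · exact fun x _ => (hψ.1.differentiable (by simp)) x

/-- An `L^p` limit of test functions whose gradients converge in `L^p` belongs to `W^{1,p}_0`. -/
theorem memW1pZero_of_tendsto {p : ℝ} (hp : 1 ≤ p) [IsFiniteMeasure (volume.restrict Ω)]
    {u : EuclideanSpace ℝ (Fin n) → ℝ}
    {G : EuclideanSpace ℝ (Fin n) → EuclideanSpace ℝ (Fin n)}
    (hu : MemLp u (ENNReal.ofReal p) (volume.restrict Ω))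
    (hG : MemLp G (ENNReal.ofReal p) (volume.restrict Ω))
    {φ : ℕ → EuclideanSpace ℝ (Fin n) → ℝ} (hφ : ∀ k, IsTestFunction Ω (φ k))
    (h1 : Tendsto (fun k => eLpNorm (fun x => φ k x - u x) (ENNReal.ofReal p)
      (volume.restrict Ω)) atTop (𝓝 0))
    (h2 : Tendsto (fun k => eLpNorm (fun x => gradient (φ k) x - G x) (ENNReal.ofReal p)
        (volume.restrict Ω)) atTop (𝓝 0)) : MemW1pZero p Ω u G := by
  have hp1 : 1 ≤ ENNReal.ofReal p := by simpa using ENNReal.ofReal_le_ofReal hp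
  have hui : IntegrableOn u Ω := hu.integrable hp1
  have hGi : IntegrableOn G Ω := hG.integrable hp1
  refine ⟨⟨hu, hG, hui.locallyIntegrableOn, hGi.locallyIntegrableOn, fun ψ hψ => ?_⟩, φ, hφ, h1, h2⟩
  obtain ⟨C₁, hC₁⟩ := hψ.hasCompactSupport_gradient.exists_bound_of_continuous
    hψ.continuous_gradient
  obtain ⟨C₂, hC₂⟩ := hψ.2.1.exists_bound_of_continuous hψ.1.continuous
  have hint : ∀ {φ ψ : EuclideanSpace ℝ (Fin n) → ℝ}, IsTestFunction Ω φ → IsTestFunction Ω ψ →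
      IntegrableOn (fun x => φ x • gradient ψ x) Ω := fun hφ hψ =>
    ((hφ.1.continuous.smul hψ.continuous_gradient).integrable_of_hasCompactSupport
      hφ.2.1.smul_right).integrableOn
  have l1 : Tendsto (fun k => ∫ x in Ω, φ k x • gradient ψ x) atTop
      (𝓝 (∫ x in Ω, u x • gradient ψ x)) := by
    refine tendsto_integral_of_norm_sub_le hp1 (C := C₁)
      (hui.smul_bdd C₁ hψ.continuous_gradient.aestronglyMeasurable (Eventually.of_forall hC₁))
      (fun k => hint (hφ k) hψ) hui.1 (fun k => (hφ k).1.continuous.aestronglyMeasurable)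
      (fun k x => ?_) h1
    rw [← sub_smul, norm_smul, mul_comm]
    exact mul_le_mul_of_nonneg_right (hC₁ x) (norm_nonneg _)
  have l2 : Tendsto (fun k => ∫ x in Ω, ψ x • gradient (φ k) x) atTop
      (𝓝 (∫ x in Ω, ψ x • G x)) := by
    refine tendsto_integral_of_norm_sub_le hp1 (C := C₂)
      (hGi.bdd_smul C₂ hψ.1.continuous.aestronglyMeasurable (Eventually.of_forall hC₂))
      (fun k => hint hψ (hφ k)) hGi.1 (fun k => (hφ k).continuous_gradient.aestronglyMeasurable)
      (fun k x => ?_) h2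
    rw [← smul_sub, norm_smul]
    exact mul_le_mul_of_nonneg_right (hC₂ x) (norm_nonneg _)
  refine tendsto_nhds_unique l1 ?_
  simp_rw [fun k => (hφ k).integral_smul_gradient hψ]
  exact l2.neg

/-- The weak gradient is unique up to null sets. -/
theorem HasWeakGradient.unique (hΩ : IsOpen Ω) {u : EuclideanSpace ℝ (Fin n) → ℝ}
    {G G' : EuclideanSpace ℝ (Fin n) → EuclideanSpace ℝ (Fin n)}
    (h : HasWeakGradient Ω u G) (h' : HasWeakGradient Ω u G') (hG : IntegrableOn G Ω)
    (hG' : IntegrableOn G' Ω) : G =ᵐ[volume.restrict Ω] G' := by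
  have key := hΩ.ae_eq_zero_of_integral_contDiff_smul_eq_zero (μ := volume)
    (f := fun x => G x - G' x) (h.2.1.sub h'.2.1) fun ψ h1 h2 h3 => by
    have ht : IsTestFunction Ω ψ := ⟨h1, h2, h3⟩
    obtain ⟨C, hC⟩ := h2.exists_bound_of_continuous h1.continuous
    have hi : ∀ {H : EuclideanSpace ℝ (Fin n) → EuclideanSpace ℝ (Fin n)},
        IntegrableOn H Ω → IntegrableOn (fun x => ψ x • H x) Ω := fun hH =>
      hH.bdd_smul C h1.continuous.aestronglyMeasurable (Eventually.of_forall hC)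
    have e := (h.2.2 ψ ht).symm.trans (h'.2.2 ψ ht)
    rw [neg_inj] at e
    rw [← setIntegral_eq_integral_of_forall_compl_eq_zero (s := Ω) fun x hx => by
      rw [image_eq_zero_of_notMem_tsupport fun h => hx (h3 h), zero_smul]]
    simp_rw [smul_sub]
    rw [integral_sub (hi hG) (hi hG'), e, sub_self]
  rw [EventuallyEq, ae_restrict_iff' hΩ.measurableSet]
  filter_upwards [key] with x hx hxΩ using sub_eq_zero.1 (hx hxΩ)

theorem MemW1pZero.congr {p : ℝ} {u v : EuclideanSpace ℝ (Fin n) → ℝ}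
    {G H : EuclideanSpace ℝ (Fin n) → EuclideanSpace ℝ (Fin n)} (h : MemW1pZero p Ω u G)
    (hu : u =ᵐ[volume.restrict Ω] v) (hG : G =ᵐ[volume.restrict Ω] H) : MemW1pZero p Ω v H := by
  obtain ⟨⟨h1, h2, h3, h4, h5⟩, φ, h6, h7, h8⟩ := h
  refine ⟨⟨h1.ae_eq hu, h2.ae_eq hG, h3.congr hu, h4.congr hG, fun ψ hψ => ?_⟩, φ, h6, ?_, ?_⟩
  · have e1 : ∫ x in Ω, v x • gradient ψ x = ∫ x in Ω, u x • gradient ψ x :=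
      integral_congr_ae (hu.mono fun x hx => by simp only [hx])
    have e2 : ∫ x in Ω, ψ x • H x = ∫ x in Ω, ψ x • G x :=
      integral_congr_ae (hG.mono fun x hx => by simp only [hx])
    rw [e1, e2, h5 ψ hψ]
  · refine h7.congr fun k => eLpNorm_congr_ae (hu.mono fun x hx => by simp only [hx])
  · refine h8.congr fun k => eLpNorm_congr_ae (hG.mono fun x hx => by simp only [hx])
end

/-! ### From profiles to radial elements of the Sobolev space. -/

/-- Profiles of radial `W^{1,p}_0` functions: measurable functions in `L^p(0, ∞)`, extended by
zero. -/
structure IsProfile (p : ℝ) (f : ℝ → ℝ) : Prop where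
  measurable : Measurable f
  eq_zero : ∀ t ≤ 0, f t = 0
  memLp : MemLp f (ENNReal.ofReal p) (volume.restrict (Set.Ioi 0))

/-- The radial function with profile `f`. -/
noncomputable def radialFun {n : ℕ} (α R : ℝ) (f : ℝ → ℝ) (x : EuclideanSpace ℝ (Fin n)) : ℝ :=
  ∫ s in (0 : ℝ)..radialCoord α R ‖x‖, f s

/-- The gradient of `radialFun α R f`. -/
noncomputable def radialField {n : ℕ} (α R : ℝ) (f : ℝ → ℝ) (x : EuclideanSpace ℝ (Fin n)) :
    EuclideanSpace ℝ (Fin n) :=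
  (f (radialCoord α R ‖x‖) * (-α * ‖x‖ ^ (-α - 1)) * ‖x‖⁻¹) • x

theorem hasFDerivAt_norm_of_ne_zero {n : ℕ} {x : EuclideanSpace ℝ (Fin n)} (hx : x ≠ 0) :
    HasFDerivAt (fun y : EuclideanSpace ℝ (Fin n) => ‖y‖) (‖x‖⁻¹ • innerSL ℝ x) x := by
  have h := ((hasStrictFDerivAt_norm_sq x).hasFDerivAt).sqrt (by simpa using hx)
  simp only [Real.sqrt_sq (norm_nonneg _)] at h
  refine h.congr_fderiv ?_
  ext v
  simp
  ring

theorem IsProfile.sub {p : ℝ} {f g : ℝ → ℝ} (hf : IsProfile p f) (hg : IsProfile p g) :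
    IsProfile p (fun t => f t - g t) :=
  ⟨hf.measurable.sub hg.measurable, fun t ht => by simp [hf.eq_zero t ht, hg.eq_zero t ht],
    hf.memLp.sub hg.memLp⟩

theorem IsProfile.intervalIntegrable {p : ℝ} (hp : 1 ≤ p) {f : ℝ → ℝ} (hf : IsProfile p f)
    (a b : ℝ) : IntervalIntegrable f volume a b := by
  have hp1 : 1 ≤ ENNReal.ofReal p := by simpa using ENNReal.ofReal_le_ofReal hp
  have h1 : (Set.Ioi (0 : ℝ)).indicator f = f := by
    ext t
    by_cases ht : t ∈ Set.Ioi (0 : ℝ)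
    · simp [ht]
    · rw [Set.indicator_of_notMem ht, hf.eq_zero t (not_lt.1 ht)]
  have h2 : MemLp f (ENNReal.ofReal p) volume := by
    rw [← h1, memLp_indicator_iff_restrict measurableSet_Ioi]
    exact hf.memLp
  rw [intervalIntegrable_iff]
  exact ((h2.locallyIntegrable hp1).integrableOn_isCompact isCompact_uIcc).mono_set
    Set.uIoc_subset_uIcc

theorem IsProfile.continuous_primitive {p : ℝ} (hp : 1 ≤ p) {f : ℝ → ℝ} (hf : IsProfile p f) :
    Continuous fun t => ∫ s in (0 : ℝ)..t, f s :=
  intervalIntegral.continuous_primitive (fun a b => hf.intervalIntegrable hp a b) 0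

theorem norm_radialField {n : ℕ} {α R : ℝ} (hα : 0 < α) (f : ℝ → ℝ)
    (x : EuclideanSpace ℝ (Fin n)) :
    ‖radialField α R f x‖ = |f (radialCoord α R ‖x‖)| * (α * ‖x‖ ^ (-α - 1)) := by
  rcases eq_or_ne x 0 with rfl | hx
  -- The convention that 0 to a nonzero power is 0 makes the formula hold at the origin too.
  · simp [radialField, Real.zero_rpow (show -α - 1 ≠ 0 by linarith)]
  · have hx' : 0 < ‖x‖ := norm_pos_iff.2 hx
    rw [radialField, norm_smul, norm_mul, norm_mul, norm_mul, norm_neg, norm_inv, norm_norm,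
      Real.norm_of_nonneg hα.le,
      Real.norm_of_nonneg (Real.rpow_nonneg (norm_nonneg x) (-α - 1)), Real.norm_eq_abs]
    field_simp

section
variable {n : ℕ} {α p R : ℝ}

theorem measurable_radialField {f : ℝ → ℝ} (hf : Measurable f) :
    Measurable (radialField (n := n) α R f) := by
  have := measurable_radialCoord (α := α) (R := R)
  unfold radialField
  fun_prop

/-- From α(p-1) = n-p one gets (α+1)p = n+α: the p-th power of the gradient carries exactly the
weight of the radial change of variable. -/
theorem lintegral_radialField (hn : 0 < n) (hα : 0 < α) (hR : 0 < R)
    (hαp : α * (p - 1) = n - p) {f : ℝ → ℝ} (hf : Measurable f) :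
    ∫⁻ x in Metric.ball (0 : EuclideanSpace ℝ (Fin n)) R, ENNReal.ofReal (‖radialField α R f x‖ ^ p)
      = (volume : Measure (EuclideanSpace ℝ (Fin n))).toSphere Set.univ *
        ENNReal.ofReal (α ^ (p - 1)) * ∫⁻ t in Set.Ioi (0 : ℝ), ENNReal.ofReal (|f t| ^ p) := by
  have h := lintegral_ball_radialCoord hn hα hR
    (F := fun t => ENNReal.ofReal (α ^ p * |f t| ^ p)) (by fun_prop)
  calc _ = _ := ?_
    _ = _ := h
    _ = _ := ?_
  · refine lintegral_congr fun x => ?_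
    rw [norm_radialField hα, ← ENNReal.ofReal_mul (by positivity),
      Real.mul_rpow (abs_nonneg _) (by positivity), Real.mul_rpow hα.le (by positivity),
      ← Real.rpow_mul (norm_nonneg _), show (-α - 1) * p = -((n : ℝ) + α) by linarith]
    congr 1
    ring
  · simp_rw [fun t => ENNReal.ofReal_mul (q := |f t| ^ p) (show 0 ≤ α ^ p by positivity)]
    rw [lintegral_const_mul' _ _ ENNReal.ofReal_ne_top, ← mul_assoc,
      mul_assoc (Measure.toSphere _ _), ← ENNReal.ofReal_mul (by positivity), Real.rpow_sub_one hα.ne']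
    congr 3
    ring

theorem eLpNorm_radialField (hn : 0 < n) (hα : 0 < α) (hp : 1 < p) (hR : 0 < R)
    (hαp : α * (p - 1) = n - p) {f : ℝ → ℝ} (hf : Measurable f) :
    ballLpNorm (n := n) p R (radialField α R f) =
      ((volume : Measure (EuclideanSpace ℝ (Fin n))).toSphere Set.univ *
        ENNReal.ofReal (α ^ (p - 1))) ^ (1 / p) *
        eLpNorm f (ENNReal.ofReal p) (volume.restrict (Set.Ioi 0)) := by
  rw [ballLpNorm, eLpNorm_ofReal_eq_lintegral (by linarith), eLpNorm_ofReal_eq_lintegral (by linarith),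
    lintegral_radialField hn hα hR hαp hf, ENNReal.mul_rpow_of_nonneg _ _ (by positivity)]
  simp_rw [Real.norm_eq_abs]

theorem memLp_radialField (hn : 0 < n) (hα : 0 < α) (hp : 1 < p) (hR : 0 < R)
    (hαp : α * (p - 1) = n - p) {f : ℝ → ℝ} (hf : IsProfile p f) :
    MemLp (radialField (n := n) α R f) (ENNReal.ofReal p)
      (volume.restrict (Metric.ball 0 R)) := by
  refine ⟨(measurable_radialField hf.measurable).aestronglyMeasurable, ?_⟩
  have h := eLpNorm_radialField hn hα hp hR hαp hf.measurable
  rw [ballLpNorm] at h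
  rw [h]
  refine ENNReal.mul_lt_top (ENNReal.rpow_lt_top_of_nonneg (by positivity) ?_) hf.memLp.2
  exact ENNReal.mul_ne_top (measure_ne_top _ _) ENNReal.ofReal_ne_top

/-- Hölder's inequality bounds |w(t)|^p by ‖f‖_p^p t^(p-1), so this integral is the constant in the
Poincaré inequality. It is finite because t ≤ r^(-α) and r^(n-1) r^(-α(p-1)) = r^(p-1). -/
theorem lintegral_radialCoord_rpow_lt_top (hn : 0 < n) (hα : 0 < α) (hp : 1 < p)
    (hαp : α * (p - 1) = n - p) :
    ∫⁻ x in Metric.ball (0 : EuclideanSpace ℝ (Fin n)) R,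
      ENNReal.ofReal (radialCoord α R ‖x‖ ^ (p - 1)) < ∞ := by
  rw [lintegral_ball_eq_lintegral_sphere hn R (by
    have := measurable_radialCoord (α := α) (R := R)
    fun_prop)]
  have hb : ∀ θ : Metric.sphere (0 : EuclideanSpace ℝ (Fin n)) 1,
      ∫⁻ r in Set.Ioo 0 R, ENNReal.ofReal (r ^ (n - 1)) *
        ENNReal.ofReal (radialCoord α R ‖r • (θ : EuclideanSpace ℝ (Fin n))‖ ^ (p - 1)) ≤
      ENNReal.ofReal (R ^ (p - 1)) * ENNReal.ofReal R := fun θ => by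
    calc _ ≤ ∫⁻ r in Set.Ioo 0 R, ENNReal.ofReal (R ^ (p - 1)) := by
          refine setLIntegral_mono' measurableSet_Ioo fun r hr => ?_
          have hr0 := hr.1
          have hnorm : ‖r • (θ : EuclideanSpace ℝ (Fin n))‖ = r := by
            rw [norm_smul, Real.norm_of_nonneg hr0.le, norm_eq_of_mem_sphere, mul_one]
          rw [hnorm, ← ENNReal.ofReal_mul (by positivity)]
          refine ENNReal.ofReal_le_ofReal ?_
          have h0 : 0 < R ^ (-α) := Real.rpow_pos_of_pos (hr0.trans hr.2) _
          calc r ^ (n - 1) * radialCoord α R r ^ (p - 1) ≤ r ^ (n - 1) * (r ^ (-α)) ^ (p - 1) := by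
                refine mul_le_mul_of_nonneg_left (Real.rpow_le_rpow (radialCoord_pos hα hr).le ?_
                  (by linarith)) (by positivity)
                rw [radialCoord]; linarith
            _ = r ^ (p - 1) := by
                rw [← Real.rpow_natCast, ← Real.rpow_mul hr0.le, ← Real.rpow_add hr0,
                  Nat.cast_sub hn, neg_mul, hαp]
                congr 1
                push_cast
                ring
            _ ≤ R ^ (p - 1) := Real.rpow_le_rpow hr0.le hr.2.le (by linarith)
      _ = _ := by simp
  refine (lintegral_mono hb).trans_lt ?_
  rw [lintegral_const]
  exact ENNReal.mul_lt_top (ENNReal.mul_lt_top ENNReal.ofReal_lt_top ENNReal.ofReal_lt_top)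
    (measure_lt_top _ _)

/-- A Poincaré inequality for radial functions. -/
theorem exists_eLpNorm_radialFun_le (hn : 0 < n) (hα : 0 < α) (hp : 1 < p)
    (hαp : α * (p - 1) = n - p) :
    ∃ C : ℝ≥0∞, C ≠ ∞ ∧ ∀ f, IsProfile p f →
      eLpNorm (radialFun (n := n) α R f) (ENNReal.ofReal p) (volume.restrict (Metric.ball 0 R)) ≤
        eLpNorm f (ENNReal.ofReal p) (volume.restrict (Set.Ioi 0)) * C := by
  have hp0 : 0 < p := by linarith
  refine ⟨(∫⁻ x in Metric.ball (0 : EuclideanSpace ℝ (Fin n)) R,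
      ENNReal.ofReal (radialCoord α R ‖x‖ ^ (p - 1))) ^ (1 / p),
    ENNReal.rpow_ne_top_of_nonneg (by positivity)
      (lintegral_radialCoord_rpow_lt_top hn hα hp hαp).ne, fun f hf => ?_⟩
  set ν := eLpNorm f (ENNReal.ofReal p) (volume.restrict (Set.Ioi 0))
  have hν : ν ≠ ∞ := hf.memLp.2.ne
  rw [eLpNorm_eq_lintegral_rpow_enorm_toReal (ENNReal.ofReal_pos.2 hp0).ne' ENNReal.ofReal_ne_top,
    ENNReal.toReal_ofReal hp0.le]
  have : ∫⁻ x in Metric.ball (0 : EuclideanSpace ℝ (Fin n)) R, ‖radialFun α R f x‖ₑ ^ p ≤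
      ν ^ p * ∫⁻ x in Metric.ball (0 : EuclideanSpace ℝ (Fin n)) R,
      ENNReal.ofReal (radialCoord α R ‖x‖ ^ (p - 1)) := by
    rw [← lintegral_const_mul' _ _ (ENNReal.rpow_ne_top_of_nonneg hp0.le hν)]
    have : Nonempty (Fin n) := ⟨⟨0, hn⟩⟩
    refine lintegral_mono_ae ?_
    filter_upwards [ae_restrict_mem measurableSet_ball, ae_restrict_of_ae (compl_mem_ae_iff.2
      (measure_singleton (0 : EuclideanSpace ℝ (Fin n))))] with x hx hx0
    have hr : ‖x‖ ∈ Set.Ioo 0 R := ⟨norm_pos_iff.2 hx0, by simpa using hx⟩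
    have ht := radialCoord_pos hα hr
    have h1 := ENNReal.rpow_le_rpow (enorm_primitive_le hp.le hf.memLp.1 ht.le) hp0.le
    rw [ENNReal.mul_rpow_of_nonneg _ _ hp0.le, ← ENNReal.rpow_mul, sub_mul, one_mul,
      one_div_mul_cancel hp0.ne', ENNReal.ofReal_rpow_of_pos ht] at h1
    exact h1
  have h2 := ENNReal.rpow_le_rpow this (one_div_nonneg.2 hp0.le)
  rwa [ENNReal.mul_rpow_of_nonneg _ _ (by positivity), ← ENNReal.rpow_mul,
    mul_one_div_cancel hp0.ne', ENNReal.rpow_one] at h2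

end

section
variable {n : ℕ} {α p R : ℝ}

theorem contDiff_primitive {g : ℝ → ℝ} (hg : ContDiff ℝ ((⊤ : ℕ∞) : WithTop ℕ∞) g) :
    ContDiff ℝ ((⊤ : ℕ∞) : WithTop ℕ∞) fun t => ∫ s in (0 : ℝ)..t, g s := by
  have hd : ∀ t, HasDerivAt (fun t => ∫ s in (0 : ℝ)..t, g s) (g t) t := fun t =>
    intervalIntegral.integral_hasDerivAt_right (hg.continuous.intervalIntegrable _ _)
      (hg.continuous.stronglyMeasurableAtFilter _ _) hg.continuous.continuousAt
  rw [contDiff_infty_iff_deriv]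
  refine ⟨fun t => (hd t).differentiableAt, ?_⟩
  rwa [show deriv (fun t => ∫ s in (0 : ℝ)..t, g s) = g from funext fun t => (hd t).deriv]

theorem contDiffAt_radialCoord_norm {x : EuclideanSpace ℝ (Fin n)} (hx : x ≠ 0) :
    ContDiffAt ℝ ((⊤ : ℕ∞) : WithTop ℕ∞)
      (fun y : EuclideanSpace ℝ (Fin n) => radialCoord α R ‖y‖) x :=
  ((Real.contDiffAt_rpow_const_of_ne (norm_ne_zero_iff.2 hx)).comp x
    (contDiffAt_norm ℝ hx)).sub contDiffAt_const

theorem gradient_radialFun {g : ℝ → ℝ} (hg : Continuous g)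
    {x : EuclideanSpace ℝ (Fin n)} (hx : x ≠ 0) :
    gradient (radialFun α R g) x = radialField α R g x := by
  have hx' : 0 < ‖x‖ := norm_pos_iff.2 hx
  have hd : HasDerivAt (fun t => ∫ s in (0 : ℝ)..t, g s) (g (radialCoord α R ‖x‖))
      (radialCoord α R ‖x‖) :=
    intervalIntegral.integral_hasDerivAt_right (hg.intervalIntegrable _ _)
      (hg.stronglyMeasurableAtFilter _ _) hg.continuousAt
  have h1 := (hd.comp ‖x‖ (hasDerivAt_radialCoord (α := α) (R := R) hx')).comp_hasFDerivAt x
    (hasFDerivAt_norm_of_ne_zero hx)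
  refine HasGradientAt.gradient (hasGradientAt_iff_hasFDerivAt.2 (h1.congr_fderiv ?_))
  ext v
  simp [radialField]
  ring

/-- Smooth profiles with compact support in `(0, ∞)` give test functions. -/
theorem exists_isTestFunction (hα : 0 < α) (hR : 0 < R) {g : ℝ → ℝ}
    (hg : ContDiff ℝ ((⊤ : ℕ∞) : WithTop ℕ∞) g) {e E : ℝ} (he : 0 < e) (hge : ∀ t ≤ e, g t = 0)
    (hE : 0 < E) (hgE : ∀ t ≥ E, g t = 0) :
    ∃ φ : EuclideanSpace ℝ (Fin n) → ℝ, IsTestFunction (Metric.ball 0 R) φ ∧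
      ∀ x ≠ 0, φ x = radialFun α R g x ∧ gradient φ x = radialField α R g x := by
  classical
  -- Since g vanishes beyond E, the radial function is constant near the origin except at the origin
  -- itself, where `radialCoord` takes a conventional value; the update restores the constant.
  set φ : EuclideanSpace ℝ (Fin n) → ℝ :=
    Function.update (radialFun α R g) 0 (∫ s in (0 : ℝ)..E, g s) with hφ
  have hne : ∀ x ≠ 0, φ x = radialFun α R g x := fun x hx => Function.update_of_ne hx _ _
  have hev : ∀ x ≠ 0, φ =ᶠ[𝓝 x] radialFun α R g := fun x hx => by
    filter_upwards [isOpen_ne.mem_nhds hx] with y hy using hne y hy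
  have hsmooth : ContDiff ℝ ((⊤ : ℕ∞) : WithTop ℕ∞) φ := by
    refine contDiff_iff_contDiffAt.2 fun x => ?_
    rcases eq_or_ne x 0 with rfl | hx
    · have hc : φ =ᶠ[𝓝 0] fun _ => ∫ s in (0 : ℝ)..E, g s := by
        filter_upwards [Metric.ball_mem_nhds (0 : EuclideanSpace ℝ (Fin n))
          (radialCoordInv_mem hα hR hE).1] with y hy
        rcases eq_or_ne y 0 with rfl | hy0
        · simp [hφ]
        · rw [hne y hy0, radialFun]
          have hy1 : 0 < ‖y‖ := norm_pos_iff.2 hy0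
          have hy2 : ‖y‖ < radialCoordInv α R E := by simpa using hy
          have hle : E ≤ radialCoord α R ‖y‖ := by
            rw [← radialCoord_radialCoordInv hα hR hE]
            exact sub_le_sub_right (Real.rpow_le_rpow_of_nonpos hy1 hy2.le (by linarith)) _
          rw [← intervalIntegral.integral_add_adjacent_intervals
            (hg.continuous.intervalIntegrable 0 E) (hg.continuous.intervalIntegrable E _),
            intervalIntegral.integral_of_le hle,
            setIntegral_eq_zero_of_forall_eq_zero fun s hs => hgE s hs.1.le, add_zero]
      exact contDiffAt_const.congr_of_eventuallyEq hc
    · exact ((contDiff_primitive hg).contDiffAt.comp x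
        (contDiffAt_radialCoord_norm (α := α) (R := R) hx)).congr_of_eventuallyEq (hev x hx)
  have hsupp : ∀ x, x ∉ Metric.closedBall (0 : EuclideanSpace ℝ (Fin n)) (radialCoordInv α R e) →
      φ x = 0 := fun x hx => by
    have hx1 : radialCoordInv α R e < ‖x‖ := by simpa using hx
    have hpos := (radialCoordInv_mem hα hR he).1
    have hx0 : x ≠ 0 := norm_pos_iff.1 (hpos.trans hx1)
    have hle : radialCoord α R ‖x‖ ≤ e := by
      rw [← radialCoord_radialCoordInv hα hR he]
      exact sub_le_sub_right (Real.rpow_le_rpow_of_nonpos hpos hx1.le (by linarith)) _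
    rw [hne x hx0, radialFun]
    -- The coordinate is negative outside the ball of radius R; the upper bound by e on the
    -- unordered interval covers that case as well.
    refine intervalIntegral.integral_zero_ae (Eventually.of_forall fun s hs => hge s ?_)
    exact hs.2.trans (max_le he.le hle)
  have hts : tsupport φ ⊆ Metric.closedBall 0 (radialCoordInv α R e) :=
    closure_minimal (fun x hx => by by_contra h; exact hx (hsupp x h)) Metric.isClosed_closedBall
  refine ⟨φ, ⟨hsmooth, HasCompactSupport.intro (isCompact_closedBall _ _) hsupp,
    hts.trans (Metric.closedBall_subset_ball (radialCoordInv_mem hα hR he).2)⟩, fun x hx =>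
    ⟨hne x hx, ?_⟩⟩
  rw [(hev x hx).gradient_eq, gradient_radialFun hg.continuous hx]

/-- Profiles define radial elements of `W^{1,p}_0`. -/
theorem IsProfile.memW1pZero (hn : 0 < n) (hα : 0 < α) (hp : 1 < p) (hR : 0 < R)
    (hαp : α * (p - 1) = n - p) {f : ℝ → ℝ} (hf : IsProfile p f) :
    MemW1pZero (n := n) p (Metric.ball 0 R) (radialFun α R f) (radialField α R f) := by
  have : Nonempty (Fin n) := ⟨⟨0, hn⟩⟩
  have : IsFiniteMeasure (volume.restrict (Metric.ball (0 : EuclideanSpace ℝ (Fin n)) R)) :=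
    ⟨by simpa using measure_ball_lt_top⟩
  obtain ⟨C, hC, hCle⟩ := exists_eLpNorm_radialFun_le (n := n) (R := R) hn hα hp hαp
  have hu : MemLp (radialFun (n := n) α R f) (ENNReal.ofReal p)
      (volume.restrict (Metric.ball 0 R)) := by
    refine ⟨Measurable.aestronglyMeasurable ?_, (hCle f hf).trans_lt
      (ENNReal.mul_lt_top hf.memLp.2 hC.lt_top)⟩
    exact (hf.continuous_primitive hp.le).measurable.comp
      (measurable_radialCoord.comp measurable_norm)
  obtain ⟨g, hg1, hg2, hg3, hg4⟩ := exists_seq_contDiff_tendsto_Lp_Ioi hp.le hf.memLp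
  have hgp : ∀ k, IsProfile p (g k) := fun k => by
    obtain ⟨e, he, hge⟩ := hg2 k
    obtain ⟨E, hE, hgE⟩ := hg3 k
    refine ⟨(hg1 k).continuous.measurable, fun t ht => hge t (ht.trans he.le), ?_⟩
    have hcs : HasCompactSupport (g k) := by
      refine HasCompactSupport.intro (isCompact_Icc (a := e) (b := E)) fun t ht => ?_
      by_contra h
      exact ht ⟨by by_contra! h'; exact h (hge t h'.le), by by_contra! h'; exact h (hgE t h'.le)⟩
    exact (hg1 k).continuous.memLp_of_hasCompactSupport hcs
  have hφ : ∀ k, ∃ φ : EuclideanSpace ℝ (Fin n) → ℝ, IsTestFunction (Metric.ball 0 R) φ ∧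
      ∀ x ≠ 0, φ x = radialFun α R (g k) x ∧ gradient φ x = radialField α R (g k) x := fun k => by
    obtain ⟨e, he, hge⟩ := hg2 k
    obtain ⟨E, hE, hgE⟩ := hg3 k
    exact exists_isTestFunction hα hR (hg1 k) he hge hE hgE
  choose φ hφ1 hφ2 using hφ
  have hne : ∀ᵐ x ∂volume.restrict (Metric.ball (0 : EuclideanSpace ℝ (Fin n)) R), x ≠ 0 :=
    ae_restrict_of_ae (compl_mem_ae_iff.2 (measure_singleton _))
  refine memW1pZero_of_tendsto hp.le hu (memLp_radialField hn hα hp hR hαp hf) hφ1 ?_ ?_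
  · have hlim := ENNReal.Tendsto.mul_const hg4 (b := C) (Or.inr hC)
    rw [zero_mul] at hlim
    refine tendsto_of_tendsto_of_tendsto_of_le_of_le tendsto_const_nhds hlim (fun _ => zero_le)
      fun k => ?_
    refine le_trans (le_of_eq (eLpNorm_congr_ae ?_)) (hCle _ ((hgp k).sub hf))
    filter_upwards [hne] with x hx
    rw [(hφ2 k x hx).1, radialFun, radialFun, radialFun,
      intervalIntegral.integral_sub ((hgp k).intervalIntegrable hp.le _ _)
        (hf.intervalIntegrable hp.le _ _)]
  · have hK : ((volume : Measure (EuclideanSpace ℝ (Fin n))).toSphere Set.univ *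
        ENNReal.ofReal (α ^ (p - 1))) ^ (1 / p) ≠ ∞ :=
      ENNReal.rpow_ne_top_of_nonneg (by positivity)
        (ENNReal.mul_ne_top (measure_ne_top _ _) ENNReal.ofReal_ne_top)
    have hlim := ENNReal.Tendsto.const_mul hg4 (Or.inr hK)
    rw [mul_zero] at hlim
    refine hlim.congr fun k => ?_
    rw [← eLpNorm_radialField hn hα hp hR hαp ((hgp k).sub hf).measurable, ballLpNorm]
    refine eLpNorm_congr_ae ?_
    filter_upwards [hne] with x hx
    rw [(hφ2 k x hx).2, radialField, radialField, radialField, ← sub_smul]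
    congr 1
    ring

end

/-! ### From radial Sobolev functions to profiles, by restriction to rays. -/

section
variable {n : ℕ} {α p R : ℝ}

/-- A null set of radii has a null preimage in the ball, by polar coordinates. It spreads the
information found on one ray over the whole ball. -/
theorem ae_ball_of_ae_norm (hn : 0 < n) {P : ℝ → Prop}
    (hP : ∀ᵐ r ∂volume.restrict (Set.Ioo 0 R), P r) :
    ∀ᵐ x ∂volume.restrict (Metric.ball (0 : EuclideanSpace ℝ (Fin n)) R), P ‖x‖ := by
  obtain ⟨N, hN1, hN2, hN3⟩ := exists_measurable_superset_of_null hP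
  have hm : Measurable (N.indicator (1 : ℝ → ℝ≥0∞)) := measurable_one.indicator hN2
  have h := lintegral_ball_eq_lintegral_sphere hn R
    (F := fun x : EuclideanSpace ℝ (Fin n) => N.indicator (1 : ℝ → ℝ≥0∞) ‖x‖) (by fun_prop)
  have h0 : ∀ θ : Metric.sphere (0 : EuclideanSpace ℝ (Fin n)) 1,
      ∫⁻ r in Set.Ioo 0 R, ENNReal.ofReal (r ^ (n - 1)) *
        N.indicator (1 : ℝ → ℝ≥0∞) ‖r • (θ : EuclideanSpace ℝ (Fin n))‖ = 0 := fun θ => by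
    rw [← lintegral_zero (μ := volume.restrict (Set.Ioo 0 R))]
    have hN0 : ∀ᵐ r ∂volume.restrict (Set.Ioo 0 R), r ∉ N := compl_mem_ae_iff.2 hN3
    refine lintegral_congr_ae ?_
    filter_upwards [hN0, ae_restrict_mem measurableSet_Ioo] with r hr hr'
    rw [norm_smul, Real.norm_of_nonneg hr'.1.le, norm_eq_of_mem_sphere, mul_one,
      Set.indicator_of_notMem hr, mul_zero]
  simp_rw [h0] at h
  rw [lintegral_zero, lintegral_eq_zero_iff (by fun_prop)] at h
  filter_upwards [h] with x hx
  by_contra hPx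
  have hmem : ‖x‖ ∈ N := hN1 hPx
  simp [Set.indicator_of_mem hmem] at hx

/-- Tonelli's theorem in polar coordinates, applied to the indicator of a null set. -/
theorem ae_sphere_of_ae_ball (hn : 0 < n) {P : EuclideanSpace ℝ (Fin n) → Prop}
    (hP : ∀ᵐ x ∂volume.restrict (Metric.ball (0 : EuclideanSpace ℝ (Fin n)) R), P x) :
    ∀ᵐ θ : Metric.sphere (0 : EuclideanSpace ℝ (Fin n)) 1
        ∂(volume : Measure (EuclideanSpace ℝ (Fin n))).toSphere,
      (∀ᵐ r ∂volume.restrict (Set.Ioo 0 R), P (r • (θ : EuclideanSpace ℝ (Fin n)))) := by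
  obtain ⟨N, hN1, hN2, hN3⟩ := exists_measurable_superset_of_null hP
  have hm : Measurable (N.indicator (1 : EuclideanSpace ℝ (Fin n) → ℝ≥0∞)) :=
    measurable_one.indicator hN2
  have h := lintegral_ball_eq_lintegral_sphere hn R hm
  rw [lintegral_indicator_one hN2, hN3] at h
  have hm2 : Measurable fun z : Metric.sphere (0 : EuclideanSpace ℝ (Fin n)) 1 × ℝ =>
      ENNReal.ofReal (z.2 ^ (n - 1)) * N.indicator (1 : EuclideanSpace ℝ (Fin n) → ℝ≥0∞)
        (z.2 • (z.1 : EuclideanSpace ℝ (Fin n))) := by fun_prop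
  rw [eq_comm, lintegral_eq_zero_iff hm2.lintegral_prod_right'] at h
  filter_upwards [h] with θ hθ
  rw [Pi.zero_apply, lintegral_eq_zero_iff (by fun_prop)] at hθ
  filter_upwards [hθ, ae_restrict_mem measurableSet_Ioo] with r hr hr'
  by_contra hPr
  have hmem : r • (θ : EuclideanSpace ℝ (Fin n)) ∈ N := hN1 hPr
  simp only [Set.indicator_of_mem hmem, Pi.one_apply, mul_one, Pi.zero_apply,
    ENNReal.ofReal_eq_zero] at hr
  exact absurd (pow_pos hr'.1 _) (not_lt.2 hr)

/-- The profile of the radial function whose radial derivative is `H`. -/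
noncomputable def profileOf (α R : ℝ) (H : ℝ → ℝ) (t : ℝ) : ℝ :=
  if 0 < t then H (radialCoordInv α R t) * (-α * radialCoordInv α R t ^ (-α - 1))⁻¹ else 0

theorem measurable_profileOf {H : ℝ → ℝ} (hH : Measurable H) : Measurable (profileOf α R H) := by
  have h1 : Measurable (radialCoordInv α R) := by unfold radialCoordInv; fun_prop
  unfold profileOf
  exact Measurable.ite measurableSet_Ioi (by fun_prop) measurable_const

theorem profileOf_sub (H K : ℝ → ℝ) (t : ℝ) :
    profileOf α R (fun r => H r - K r) t = profileOf α R H t - profileOf α R K t := by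
  unfold profileOf
  split_ifs <;> ring

/-- The relation α(p-1) = n-p matches the Jacobian with the polar factor r^(n-1), so convergence of
radial derivatives along a ray is convergence of profiles in L^p. -/
theorem eLpNorm_profileOf (hn : 0 < n) (hα : 0 < α) (hp : 1 < p) (hR : 0 < R)
    (hαp : α * (p - 1) = n - p) (H : ℝ → ℝ) :
    eLpNorm (profileOf α R H) (ENNReal.ofReal p) (volume.restrict (Set.Ioi 0)) =
      (ENNReal.ofReal (α ^ (1 - p)) *
        ∫⁻ r in Set.Ioo 0 R, ENNReal.ofReal (r ^ (n - 1)) * ‖H r‖ₑ ^ p) ^ (1 / p) := by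
  have hp0 : 0 < p := by linarith
  rw [eLpNorm_ofReal_eq_lintegral hp0]
  congr 1
  have h := lintegral_radialCoord hα hR fun t => ENNReal.ofReal (‖profileOf α R H t‖ ^ p)
  have h1 : ENNReal.ofReal α * ENNReal.ofReal (1 / α) = 1 := by
    rw [← ENNReal.ofReal_mul hα.le, mul_one_div_cancel hα.ne', ENNReal.ofReal_one]
  rw [← one_mul (∫⁻ t in Set.Ioi (0 : ℝ), ENNReal.ofReal (‖profileOf α R H t‖ ^ p)), ← h1,
    mul_assoc, ← h, ← lintegral_const_mul' _ _ ENNReal.ofReal_ne_top,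
    ← lintegral_const_mul' _ _ ENNReal.ofReal_ne_top]
  refine setLIntegral_congr_fun measurableSet_Ioo fun r hr => ?_
  have hr0 := hr.1
  have hc : ‖(-α * r ^ (-α - 1))⁻¹‖ = (α * r ^ (-α - 1))⁻¹ := by
    rw [norm_inv, neg_mul, norm_neg, Real.norm_of_nonneg (by positivity)]
  rw [profileOf, if_pos (radialCoord_pos hα hr), radialCoordInv_radialCoord hα hr0,
    ← ofReal_norm (H r), ENNReal.ofReal_rpow_of_nonneg (norm_nonneg _) hp0.le, norm_mul, hc,
    ← ENNReal.ofReal_mul (by positivity), ← ENNReal.ofReal_mul hα.le,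
    ← ENNReal.ofReal_mul (by positivity), ← ENNReal.ofReal_mul (by positivity)]
  congr 1
  rw [Real.mul_rpow (norm_nonneg _) (by positivity)]
  have e : α * r ^ (-α - 1) * (α * r ^ (-α - 1))⁻¹ ^ p = α ^ (1 - p) * r ^ (n - 1) := by
    rw [← Real.rpow_natCast, Nat.cast_sub hn, Nat.cast_one]
    obtain ⟨a, rfl⟩ := exists_exp_eq hα
    obtain ⟨c, rfl⟩ := exists_exp_eq hr0
    simp only [← Real.exp_mul, ← Real.exp_add, ← Real.exp_neg]
    congr 1
    linear_combination c * hαp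
  linear_combination ‖H r‖ ^ p * e

/-- The fundamental theorem of calculus along the ray, starting at the boundary point Rθ, where the
test function vanishes. This is where the zero boundary values enter. -/
theorem IsTestFunction.primitive_profileOf (hn : 0 < n) (hα : 0 < α) (hp : 1 < p) (hR : 0 < R)
    (hαp : α * (p - 1) = n - p) {φ : EuclideanSpace ℝ (Fin n) → ℝ}
    (hφ : IsTestFunction (Metric.ball 0 R) φ) (θ : Metric.sphere (0 : EuclideanSpace ℝ (Fin n)) 1) :
    MemLp (profileOf α R fun r => inner ℝ (gradient φ (r • (θ : EuclideanSpace ℝ (Fin n)))) θ.1)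
      (ENNReal.ofReal p) (volume.restrict (Set.Ioi 0)) ∧
    ∀ t > 0, ∫ s in (0 : ℝ)..t,
      profileOf α R (fun r => inner ℝ (gradient φ (r • (θ : EuclideanSpace ℝ (Fin n)))) θ.1) s =
      φ (radialCoordInv α R t • (θ : EuclideanSpace ℝ (Fin n))) := by
  have hp0 : 0 < p := by linarith
  set H : ℝ → ℝ := fun r => inner ℝ (gradient φ (r • (θ : EuclideanSpace ℝ (Fin n)))) θ.1 with hH
  have hHc : Continuous H :=
    (hφ.continuous_gradient.comp (by fun_prop)).inner continuous_const
  have hmem : MemLp (profileOf α R H) (ENNReal.ofReal p) (volume.restrict (Set.Ioi 0)) := by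
    refine ⟨(measurable_profileOf hHc.measurable).aestronglyMeasurable, ?_⟩
    rw [eLpNorm_profileOf hn hα hp hR hαp]
    refine ENNReal.rpow_lt_top_of_nonneg (by positivity)
      (ENNReal.mul_ne_top ENNReal.ofReal_ne_top ?_)
    obtain ⟨C, hC⟩ := hφ.hasCompactSupport_gradient.exists_bound_of_continuous
      hφ.continuous_gradient
    have hle : ∫⁻ r in Set.Ioo 0 R, ENNReal.ofReal (r ^ (n - 1)) * ‖H r‖ₑ ^ p ≤
        ∫⁻ r in Set.Ioo 0 R, ENNReal.ofReal (R ^ (n - 1)) * ENNReal.ofReal C ^ p := by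
      refine setLIntegral_mono' measurableSet_Ioo fun r hr => ?_
      gcongr
      · exact hr.1.le
      · exact hr.2.le
      · rw [← ofReal_norm]
        refine ENNReal.ofReal_le_ofReal ((norm_inner_le_norm _ _).trans ?_)
        rw [norm_eq_of_mem_sphere, mul_one]
        exact hC _
    refine (hle.trans_lt ?_).ne
    rw [setLIntegral_const]
    exact ENNReal.mul_lt_top (ENNReal.mul_lt_top ENNReal.ofReal_lt_top
      (ENNReal.rpow_lt_top_of_nonneg hp0.le ENNReal.ofReal_ne_top)) measure_Ioo_lt_top
  refine ⟨hmem, fun t ht => ?_⟩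
  have hcont : ContinuousOn (fun s => φ (radialCoordInv α R s • (θ : EuclideanSpace ℝ (Fin n))))
      (Set.Icc 0 t) := by
    have hφc := hφ.1.continuous
    suffices hc : ContinuousOn (radialCoordInv α R) (Set.Icc 0 t) by fun_prop
    unfold radialCoordInv
    refine (continuousOn_id.add continuousOn_const).rpow_const fun s hs => Or.inl ?_
    have : 0 < R ^ (-α) := Real.rpow_pos_of_pos hR _
    have := hs.1
    exact (by linarith : 0 < s + R ^ (-α)).ne'
  have hderiv : ∀ s ∈ Set.Ioo 0 t,
      HasDerivAt (fun s => φ (radialCoordInv α R s • (θ : EuclideanSpace ℝ (Fin n))))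
        (profileOf α R H s) s := fun s hs => by
    have h1 := (hasDerivAt_radialCoordInv hα hR hs.1).smul_const (θ : EuclideanSpace ℝ (Fin n))
    have h2 := ((hφ.1.differentiable (by simp)) (radialCoordInv α R s •
      (θ : EuclideanSpace ℝ (Fin n)))).hasFDerivAt.comp_hasDerivAt s h1
    refine h2.congr_deriv ?_
    rw [profileOf, if_pos hs.1, hH, map_smul, smul_eq_mul, mul_comm]
    beta_reduce
    rw [inner_gradient_eq_fderiv]
  rw [intervalIntegral.integral_eq_sub_of_hasDerivAt_of_le ht.le hcont hderiv
    ((intervalIntegrable_iff_integrableOn_Ioc_of_le ht.le).2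
      (integrableOn_Ioc_of_memLp_Ioi hp.le hmem t))]
  have h0 : radialCoordInv α R 0 = R := by
    rw [radialCoordInv, zero_add, ← Real.rpow_mul hR.le, neg_mul_neg, mul_one_div_cancel hα.ne',
      Real.rpow_one]
  rw [h0, image_eq_zero_of_notMem_tsupport (f := φ) (x := R • (θ : EuclideanSpace ℝ (Fin n))),
    sub_zero]
  intro hmem
  have := hφ.2.2 hmem
  rw [mem_ball_zero_iff, norm_smul, Real.norm_of_nonneg hR.le, norm_eq_of_mem_sphere, mul_one] at this
  exact lt_irrefl _ this

end

section
variable {n : ℕ} {α p R : ℝ}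

/-- Along one direction, the test functions approximating `u` determine a profile. -/
theorem exists_profile_of_slice (hn : 0 < n) (hα : 0 < α) (hp : 1 < p) (hR : 0 < R)
    (hαp : α * (p - 1) = n - p) {u : EuclideanSpace ℝ (Fin n) → ℝ}
    {G : EuclideanSpace ℝ (Fin n) → EuclideanSpace ℝ (Fin n)} (hu : Measurable u)
    (hG : Measurable G) {φ : ℕ → EuclideanSpace ℝ (Fin n) → ℝ}
    (hφ : ∀ k, IsTestFunction (Metric.ball 0 R) (φ k))
    (θ : Metric.sphere (0 : EuclideanSpace ℝ (Fin n)) 1)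
    (hGθ : ∫⁻ r in Set.Ioo 0 R, ENNReal.ofReal (r ^ (n - 1)) *
      ‖G (r • (θ : EuclideanSpace ℝ (Fin n)))‖ₑ ^ p ≠ ∞)
    (hlim : Tendsto (fun k => ∫⁻ r in Set.Ioo 0 R, ENNReal.ofReal (r ^ (n - 1)) *
      (‖φ k (r • (θ : EuclideanSpace ℝ (Fin n))) - u (r • (θ : EuclideanSpace ℝ (Fin n)))‖ₑ ^ p +
      ‖gradient (φ k) (r • (θ : EuclideanSpace ℝ (Fin n))) -
        G (r • (θ : EuclideanSpace ℝ (Fin n)))‖ₑ ^ p)) atTop (𝓝 0)) :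
    ∃ f, IsProfile p f ∧ ∀ᵐ r ∂volume.restrict (Set.Ioo 0 R),
      u (r • (θ : EuclideanSpace ℝ (Fin n))) = ∫ s in (0 : ℝ)..radialCoord α R r, f s := by
  have hp0 : 0 < p := by linarith
  set H : ℝ → ℝ := fun r => inner ℝ (G (r • (θ : EuclideanSpace ℝ (Fin n)))) θ.1 with hH
  have hHm : Measurable H := by fun_prop
  have hinner : ∀ v : EuclideanSpace ℝ (Fin n), ‖(inner ℝ v θ.1 : ℝ)‖ₑ ≤ ‖v‖ₑ := fun v => by
    rw [← ofReal_norm, ← ofReal_norm]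
    refine ENNReal.ofReal_le_ofReal ((norm_inner_le_norm _ _).trans ?_)
    rw [norm_eq_of_mem_sphere, mul_one]
  have hf : IsProfile p (profileOf α R H) := by
    refine ⟨measurable_profileOf hHm, fun t ht => if_neg (not_lt.2 ht),
      (measurable_profileOf hHm).aestronglyMeasurable, ?_⟩
    rw [eLpNorm_profileOf hn hα hp hR hαp]
    refine ENNReal.rpow_lt_top_of_nonneg (by positivity)
      (ENNReal.mul_ne_top ENNReal.ofReal_ne_top (ne_top_of_le_ne_top hGθ ?_))
    refine lintegral_mono fun r => ?_
    gcongr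
    exact hinner _
  refine ⟨_, hf, ?_⟩
  set Hk : ℕ → ℝ → ℝ := fun k r =>
    inner ℝ (gradient (φ k) (r • (θ : EuclideanSpace ℝ (Fin n)))) θ.1 with hHk
  set a : ℕ → ℝ≥0∞ := fun k => ∫⁻ r in Set.Ioo 0 R, ENNReal.ofReal (r ^ (n - 1)) *
      (‖φ k (r • (θ : EuclideanSpace ℝ (Fin n))) - u (r • (θ : EuclideanSpace ℝ (Fin n)))‖ₑ ^ p +
      ‖gradient (φ k) (r • (θ : EuclideanSpace ℝ (Fin n))) -
        G (r • (θ : EuclideanSpace ℝ (Fin n)))‖ₑ ^ p) with ha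
  -- The radial component of a vector is no longer than the vector, so gradient convergence along
  -- the ray gives convergence of the profiles.
  have hconv : Tendsto (fun k => eLpNorm (fun t => profileOf α R (Hk k) t - profileOf α R H t)
      (ENNReal.ofReal p) (volume.restrict (Set.Ioi 0))) atTop (𝓝 0) := by
    have h1 : Tendsto (fun k => (ENNReal.ofReal (α ^ (1 - p)) * a k) ^ (1 / p)) atTop (𝓝 0) := by
      have := (ENNReal.Tendsto.const_mul hlim (a := ENNReal.ofReal (α ^ (1 - p)))
        (Or.inr ENNReal.ofReal_ne_top)).ennrpow_const (1 / p)
      rwa [mul_zero, ENNReal.zero_rpow_of_pos (by positivity)] at this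
    refine tendsto_of_tendsto_of_tendsto_of_le_of_le tendsto_const_nhds h1 (fun _ => zero_le)
      fun k => ?_
    simp_rw [← profileOf_sub]
    rw [eLpNorm_profileOf hn hα hp hR hαp]
    gcongr
    refine lintegral_mono fun r => ?_
    gcongr
    refine le_trans ?_ le_add_self
    gcongr
    rw [hHk, hH, ← inner_sub_left]
    exact hinner _
  have hpt : ∀ r ∈ Set.Ioo 0 R, Tendsto (fun k => φ k (r • (θ : EuclideanSpace ℝ (Fin n)))) atTop
      (𝓝 (∫ s in (0 : ℝ)..radialCoord α R r, profileOf α R H s)) := fun r hr => by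
    have ht := radialCoord_pos hα hr
    have h1 := tendsto_primitive hp.le hf.memLp
      (fun k => ((hφ k).primitive_profileOf hn hα hp hR hαp θ).1) hconv ht.le
    refine h1.congr fun k => ?_
    rw [((hφ k).primitive_profileOf hn hα hp hR hαp θ).2 _ ht, radialCoordInv_radialCoord hα hr.1]
  have hwm : Measurable fun r => ∫ s in (0 : ℝ)..radialCoord α R r, profileOf α R H s :=
    (hf.continuous_primitive hp.le).measurable.comp measurable_radialCoord
  have hφm : ∀ k, Measurable (φ k) := fun k => (hφ k).1.continuous.measurable
  -- Along the ray the test functions tend pointwise to the primitive of the limit profile and in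
  -- weighted L^p to u; Fatou's lemma identifies the two limits.
  have hzero : ∫⁻ r in Set.Ioo 0 R, ENNReal.ofReal (r ^ (n - 1)) *
      ‖(∫ s in (0 : ℝ)..radialCoord α R r, profileOf α R H s) -
        u (r • (θ : EuclideanSpace ℝ (Fin n)))‖ₑ ^ p = 0 := by
    refine le_antisymm ?_ zero_le
    calc _ = ∫⁻ r in Set.Ioo 0 R, liminf (fun k => ENNReal.ofReal (r ^ (n - 1)) *
          ‖φ k (r • (θ : EuclideanSpace ℝ (Fin n))) -
            u (r • (θ : EuclideanSpace ℝ (Fin n)))‖ₑ ^ p) atTop := by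
          refine setLIntegral_congr_fun measurableSet_Ioo fun r hr => ?_
          refine (Tendsto.liminf_eq ?_).symm
          exact ENNReal.Tendsto.const_mul
            ((((hpt r hr).sub_const _).enorm).ennrpow_const p) (Or.inr ENNReal.ofReal_ne_top)
      _ ≤ liminf (fun k => ∫⁻ r in Set.Ioo 0 R, ENNReal.ofReal (r ^ (n - 1)) *
          ‖φ k (r • (θ : EuclideanSpace ℝ (Fin n))) -
            u (r • (θ : EuclideanSpace ℝ (Fin n)))‖ₑ ^ p) atTop :=
          lintegral_liminf_le fun k => by
            have := hφm k
            fun_prop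
      _ ≤ liminf a atTop := by
          refine liminf_le_liminf (Eventually.of_forall fun k => lintegral_mono fun r => ?_)
          gcongr
          exact le_self_add
      _ = 0 := hlim.liminf_eq
  rw [lintegral_eq_zero_iff (by fun_prop)] at hzero
  filter_upwards [hzero, ae_restrict_mem measurableSet_Ioo] with r hr hr'
  have hr0 : ENNReal.ofReal (r ^ (n - 1)) ≠ 0 :=
    (ENNReal.ofReal_pos.2 (pow_pos hr'.1 _)).ne'
  rw [Pi.zero_apply, mul_eq_zero, or_iff_right hr0, ENNReal.rpow_eq_zero_iff_of_pos hp0,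
    enorm_eq_zero, sub_eq_zero] at hr
  exact hr.symm

/-- Radial elements of `W^{1,p}_0` of a ball are given by profiles. -/
theorem MemW1pZero.exists_profile (hn : 0 < n) (hα : 0 < α) (hp : 1 < p) (hR : 0 < R)
    (hαp : α * (p - 1) = n - p) {u : EuclideanSpace ℝ (Fin n) → ℝ}
    {G : EuclideanSpace ℝ (Fin n) → EuclideanSpace ℝ (Fin n)}
    (h : MemW1pZero p (Metric.ball 0 R) u G) (hr : IsRadialOnBall R u) :
    ∃ f, IsProfile p f ∧ u =ᵐ[volume.restrict (Metric.ball 0 R)] radialFun α R f ∧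
      G =ᵐ[volume.restrict (Metric.ball 0 R)] radialField α R f := by
  have hp0 : 0 < p := by linarith
  have hp1 : 1 ≤ ENNReal.ofReal p := by simpa using ENNReal.ofReal_le_ofReal hp.le
  have : Nonempty (Fin n) := ⟨⟨0, hn⟩⟩
  have : IsFiniteMeasure (volume.restrict (Metric.ball (0 : EuclideanSpace ℝ (Fin n)) R)) :=
    ⟨by simpa using measure_ball_lt_top⟩
  obtain ⟨g, hg⟩ := hr
  obtain ⟨φ, hφ, hφ1, hφ2⟩ := h.2
  set u' := h.1.1.1.mk u with hu'
  set G' := h.1.2.1.1.mk G with hG'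
  have hum : Measurable u' := h.1.1.1.stronglyMeasurable_mk.measurable
  have hGm : Measurable G' := h.1.2.1.1.stronglyMeasurable_mk.measurable
  have hue : u =ᵐ[volume.restrict (Metric.ball 0 R)] u' := h.1.1.1.ae_eq_mk
  have hGe : G =ᵐ[volume.restrict (Metric.ball 0 R)] G' := h.1.2.1.1.ae_eq_mk
  have hφm : ∀ k, Measurable (φ k) := fun k => (hφ k).1.continuous.measurable
  have hgm : ∀ k, Measurable (gradient (φ k)) := fun k => (hφ k).continuous_gradient.measurable
  have hpow : ∀ {E : Type} [NormedAddCommGroup E] {v : ℕ → EuclideanSpace ℝ (Fin n) → E},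
      Tendsto (fun k => eLpNorm (v k) (ENNReal.ofReal p) (volume.restrict (Metric.ball 0 R)))
        atTop (𝓝 0) →
      Tendsto (fun k => ∫⁻ x in Metric.ball 0 R, ‖v k x‖ₑ ^ p) atTop (𝓝 0) := fun {E} _ v hv => by
    have h1 := hv.ennrpow_const p
    rw [ENNReal.zero_rpow_of_pos hp0] at h1
    refine h1.congr fun k => ?_
    rw [eLpNorm_eq_lintegral_rpow_enorm_toReal (ENNReal.ofReal_pos.2 hp0).ne'
      ENNReal.ofReal_ne_top, ENNReal.toReal_ofReal hp0.le, ← ENNReal.rpow_mul,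
      one_div_mul_cancel hp0.ne', ENNReal.rpow_one]
  set F : ℕ → EuclideanSpace ℝ (Fin n) → ℝ≥0∞ := fun k x =>
    ‖φ k x - u' x‖ₑ ^ p + ‖gradient (φ k) x - G' x‖ₑ ^ p with hF
  have hFm : ∀ k, Measurable (F k) := fun k => by
    have := hφm k; have := hgm k
    fun_prop
  have hFlim : Tendsto (fun k => ∫⁻ x in Metric.ball 0 R, F k x) atTop (𝓝 0) := by
    have h1 := (hpow hφ1).add (hpow hφ2)
    rw [add_zero] at h1
    refine h1.congr fun k => ?_
    have := hφm k
    rw [hF, lintegral_add_left (by fun_prop)]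
    congr 1
    · exact lintegral_congr_ae (hue.mono fun x hx => by simp only [hx])
    · exact lintegral_congr_ae (hGe.mono fun x hx => by simp only [hx])
  set a : ℕ → Metric.sphere (0 : EuclideanSpace ℝ (Fin n)) 1 → ℝ≥0∞ := fun k θ =>
    ∫⁻ r in Set.Ioo 0 R, ENNReal.ofReal (r ^ (n - 1)) *
      F k (r • (θ : EuclideanSpace ℝ (Fin n))) with ha
  have ham : ∀ k, Measurable (a k) := fun k => by
    have hm2 : Measurable fun z : Metric.sphere (0 : EuclideanSpace ℝ (Fin n)) 1 × ℝ =>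
      ENNReal.ofReal (z.2 ^ (n - 1)) * F k (z.2 • (z.1 : EuclideanSpace ℝ (Fin n))) := by
      have := hFm k
      fun_prop
    exact hm2.lintegral_prod_right'
  -- Fatou's lemma on the sphere gives only a vanishing lower limit for almost every direction. This
  -- suffices, since the subsequence may depend on the direction.
  have hliminf : ∀ᵐ θ ∂(volume : Measure (EuclideanSpace ℝ (Fin n))).toSphere,
      liminf (fun k => a k θ) atTop = 0 := by
    have h1 : ∫⁻ θ, liminf (fun k => a k θ) atTop
        ∂(volume : Measure (EuclideanSpace ℝ (Fin n))).toSphere = 0 := by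
      refine le_antisymm ((lintegral_liminf_le ham).trans ?_) zero_le
      simp_rw [ha, ← lintegral_ball_eq_lintegral_sphere hn R (hFm _)]
      exact hFlim.liminf_eq.le
    rwa [lintegral_eq_zero_iff (Measurable.liminf ham)] at h1
  have hGfin : ∀ᵐ θ : Metric.sphere (0 : EuclideanSpace ℝ (Fin n)) 1
      ∂(volume : Measure (EuclideanSpace ℝ (Fin n))).toSphere,
      ∫⁻ r in Set.Ioo 0 R, ENNReal.ofReal (r ^ (n - 1)) *
        ‖G' (r • (θ : EuclideanSpace ℝ (Fin n)))‖ₑ ^ p < ∞ := by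
    refine ae_lt_top ?_ ?_
    · have hm2 : Measurable fun z : Metric.sphere (0 : EuclideanSpace ℝ (Fin n)) 1 × ℝ =>
        ENNReal.ofReal (z.2 ^ (n - 1)) * ‖G' (z.2 • (z.1 : EuclideanSpace ℝ (Fin n)))‖ₑ ^ p := by
        fun_prop
      exact hm2.lintegral_prod_right'
    · rw [← lintegral_ball_eq_lintegral_sphere hn R (F := fun x => ‖G' x‖ₑ ^ p) (by fun_prop)]
      have h1 := (memLp_congr_ae hGe).1 h.1.2.1
      have h2 := lintegral_rpow_enorm_lt_top_of_eLpNorm_lt_top (ENNReal.ofReal_pos.2 hp0).ne'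
        ENNReal.ofReal_ne_top h1.2
      rw [ENNReal.toReal_ofReal hp0.le] at h2
      exact h2.ne
  have hgs := ae_sphere_of_ae_ball hn (hue.symm.trans hg)
  have : (ae (volume : Measure (EuclideanSpace ℝ (Fin n))).toSphere).NeBot :=
    ae_neBot.2 (Measure.toSphere_ne_zero _)
  -- The sphere has positive measure, so one direction satisfies all three almost-everywhere
  -- conditions; as u is radial, a single ray determines it.
  obtain ⟨θ, hθ1, hθ2, hθ3⟩ := (hliminf.and (hGfin.and hgs)).exists
  have hsel : ∀ j : ℕ, ∃ k, a k θ < ENNReal.ofReal (1 / ((j : ℝ) + 1)) := fun j =>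
    (frequently_lt_of_liminf_lt (by isBoundedDefault)
      (by rw [hθ1]; exact ENNReal.ofReal_pos.2 (by positivity))).exists
  choose k hk using hsel
  have hsub : Tendsto (fun j => a (k j) θ) atTop (𝓝 0) := by
    have h1 : Tendsto (fun j : ℕ => ENNReal.ofReal (1 / ((j : ℝ) + 1))) atTop (𝓝 0) := by
      rw [← ENNReal.ofReal_zero]
      exact ENNReal.tendsto_ofReal tendsto_one_div_add_atTop_nhds_zero_nat
    exact tendsto_of_tendsto_of_tendsto_of_le_of_le tendsto_const_nhds h1 (fun _ => zero_le)
      fun j => (hk j).le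
  obtain ⟨f, hf, hfu⟩ := exists_profile_of_slice hn hα hp hR hαp hum hGm (fun j => hφ (k j)) θ
    hθ2.ne hsub
  have hgw : ∀ᵐ r ∂volume.restrict (Set.Ioo 0 R),
      g r = ∫ s in (0 : ℝ)..radialCoord α R r, f s := by
    filter_upwards [hθ3, hfu, ae_restrict_mem measurableSet_Ioo] with r h1 h2 h3
    rw [← h2, h1, norm_smul, Real.norm_of_nonneg h3.1.le, norm_eq_of_mem_sphere, mul_one]
  have hufun : u =ᵐ[volume.restrict (Metric.ball 0 R)] radialFun α R f := by
    filter_upwards [hg, ae_ball_of_ae_norm hn hgw] with x h1 h2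
    rw [h1, h2, radialFun]
  -- Only u has been identified so far. G follows by uniqueness of the weak gradient, so no radial
  -- structure of G is assumed.
  have hmem := (hf.memW1pZero hn hα hp hR hαp).congr hufun.symm (ae_eq_refl _)
  exact ⟨f, hf, hufun, h.1.2.2.unique Metric.isOpen_ball hmem.1.2.2 (h.1.2.1.integrable hp1)
    (hmem.1.2.1.integrable hp1)⟩

end

/-! ### Exponents and constants. -/

/-- The surface measure of the unit sphere in `ℝ^N`. -/
noncomputable def sphereArea (N : ℝ) : ℝ := N * (Real.pi ^ (N / 2) / Real.Gamma (1 + N / 2))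

theorem toSphere_univ_eq_sphereArea {n : ℕ} (hn : 0 < n) :
    (volume : Measure (EuclideanSpace ℝ (Fin n))).toSphere Set.univ =
      ENNReal.ofReal (sphereArea n) := by
  have : Nonempty (Fin n) := ⟨⟨0, hn⟩⟩
  rw [Measure.toSphere_apply_univ, EuclideanSpace.volume_ball, finrank_euclideanSpace,
    Fintype.card_fin, ENNReal.ofReal_one, one_pow, one_mul, sphereArea,
    ENNReal.ofReal_mul (by positivity), ENNReal.ofReal_natCast, Real.sqrt_eq_rpow,
    ← Real.rpow_natCast, ← Real.rpow_mul Real.pi_pos.le, add_comm (1 : ℝ)]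
  congr 4
  ring

theorem sphereArea_pos {N : ℝ} (hN : 0 < N) : 0 < sphereArea N := by
  have := Real.Gamma_pos_of_pos (show 0 < 1 + N / 2 by positivity)
  have := Real.pi_pos
  unfold sphereArea
  positivity

section
variable {n : ℕ} {p : ℝ}

/-- The dictionary with Bliss's inequality: N = n, δ = p/(n-p), β = (p-1)/(n-p), and α = 1/β. -/
theorem exponent_relations (hp : 1 < p) (hpn : p < n) :
    1 < (n : ℝ) ∧ 0 < (n - p) / (p - 1) ∧ 0 < p / (n - p) ∧ 0 < (p - 1) / (n - p) ∧
      (n : ℝ) * ((p - 1) / (n - p)) = (n - 1) * (p / (n - p)) - 1 ∧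
      p.HolderConjugate (p / (p - 1)) ∧
      (p - 1) / (n - p) * (p / (p - 1)) = p / (n - p) ∧
      (n - p) / (p - 1) * (p - 1) = n - p := by
  have h1 : 0 < p - 1 := by linarith
  have h2 : 0 < n - p := by linarith
  refine ⟨by linarith, by positivity, by positivity, by positivity, ?_,
    Real.HolderConjugate.conjExponent hp, ?_, ?_⟩
  · field_simp
    ring
  · field_simp
  · field_simp

/-- Since (δ+1)/δ = n/p, the beta function in the Bliss mass supplies the Gamma quotient, and the
factor √π cancels the power of π in the sphere area. -/
theorem sobolevConst_eq (hp : 1 < p) (hpn : p < n) :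
    sobolevConst n p = (n : ℝ) ^ (1 / p) * ((n - p) / (p - 1)) ^ ((p - 1) / p) *
      (blissMass n (p / (n - p)) * sphereArea n / ((n - p) / (p - 1))) ^ (1 / (n : ℝ)) := by
  have h1 : 0 < p - 1 := by linarith
  have h2 : 0 < n - p := by linarith
  have hN : 0 < (n : ℝ) := by linarith
  have hp0 : 0 < p := by linarith
  have hG1 := Real.Gamma_pos_of_pos (show 0 < (n : ℝ) / p by positivity)
  have hlt : (n : ℝ) / p < n := div_lt_self hN hp
  have hG2 := Real.Gamma_pos_of_pos (show 0 < (n : ℝ) - n / p by linarith)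
  have hG3 := Real.Gamma_pos_of_pos hN
  have hG4 := Real.Gamma_pos_of_pos (show 0 < 1 + (n : ℝ) / 2 by positivity)
  have hπ := Real.pi_pos
  have e : Real.Gamma (n / p) * Real.Gamma (n + 1 - n / p) /
      (Real.Gamma n * Real.Gamma (1 + n / 2)) =
      blissMass n (p / (n - p)) * sphereArea n / ((n - p) / (p - 1)) / Real.pi ^ ((n : ℝ) / 2) := by
    rw [show (n : ℝ) + 1 - n / p = n - n / p + 1 by ring, Real.Gamma_add_one (by linarith),
      blissMass, sphereArea, ProbabilityTheory.beta,
      show (p / (n - p) + 1) / (p / (n - p)) = (n : ℝ) / p by field_simp; ring,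
      show (n : ℝ) / p + (n - n / p) = n by ring]
    field_simp
  have hpos : 0 < blissMass n (p / (n - p)) := by
    obtain ⟨h1, h2, h3, h4, h5, h6, h7, h8⟩ := exponent_relations hp hpn
    exact blissMass_pos h4 h3 h1 h5
  have hs := sphereArea_pos hN
  rw [sobolevConst, e, Real.div_rpow
    (x := blissMass n (p / (n - p)) * sphereArea n / ((n - p) / (p - 1)))
    (by positivity) (by positivity), ← Real.rpow_mul hπ.le,
    show (n : ℝ) / 2 * (1 / n) = 1 / 2 by field_simp, ← Real.sqrt_eq_rpow]
  have := Real.sqrt_pos.2 hπ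
  field_simp

theorem sobolevConst_pos (hp : 1 < p) (hpn : p < n) : 0 < sobolevConst n p := by
  obtain ⟨h1, h2, h3, h4, h5, h6, h7, h8⟩ := exponent_relations hp hpn
  have hN : 0 < (n : ℝ) := by linarith
  have hs := sphereArea_pos hN
  have hM := blissMass_pos h4 h3 h1 h5
  rw [sobolevConst_eq hp hpn]
  positivity

/-- The relation between the constant in the weighted inequality and that in Bliss's inequality. -/
theorem sobolevConst_relation (hp : 1 < p) (hpn : p < n) :
    sobolevConst n p * ((n - p) / (p - 1)) ^ (1 / (n : ℝ) - 1) *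
      ((sphereArea n * ((n - p) / (p - 1)) ^ ((n - 1) * (p / (n - p)) - 1)) ^
        (1 / ((n : ℝ) * (p / (n - p)))) *
      blissMass n (p / (n - p)) ^ (1 / ((n : ℝ) * (p / (n - p))))) =
    (sphereArea n * ((n - p) / (p - 1)) ^ (p - 1)) ^ (1 / p) *
      (n * ((p - 1) / (n - p)) * blissMass n (p / (n - p))) ^ (1 / p) := by
  obtain ⟨h1, h2, h3, h4, h5, h6, h7, h8⟩ := exponent_relations hp hpn
  have hN : 0 < (n : ℝ) := by linarith
  have hnp : (n : ℝ) - p ≠ 0 := by linarith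
  have hp0 : p ≠ 0 := by linarith
  rw [sobolevConst_eq hp hpn]
  have hM := blissMass_pos h4 h3 h1 h5
  have hs := sphereArea_pos hN
  generalize blissMass n (p / (n - p)) = m at hM ⊢
  generalize sphereArea n = s at hs ⊢
  rw [show (p - 1) / ((n : ℝ) - p) = ((n - p) / (p - 1))⁻¹ by rw [inv_div]]
  generalize ((n : ℝ) - p) / (p - 1) = A at h2 ⊢
  -- The number n occurs both as a base and inside exponents. Renaming only the base lets it become
  -- an exponential while the exponents stay as they are.
  obtain ⟨x, hx, hxpos⟩ : ∃ x : ℝ, (n : ℝ) = x ∧ 0 < x := ⟨n, rfl, hN⟩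
  have hbase : (n : ℝ) ^ (1 / p) = x ^ (1 / p) := by rw [hx]
  have hbase2 : (n : ℝ) * A⁻¹ * m = x * A⁻¹ * m := by rw [hx]
  rw [hbase, hbase2]
  have hN0 : (n : ℝ) ≠ 0 := hN.ne'
  clear hbase hbase2 hx
  obtain ⟨x, rfl⟩ := exists_exp_eq hxpos
  obtain ⟨m, rfl⟩ := exists_exp_eq hM
  obtain ⟨s, rfl⟩ := exists_exp_eq hs
  obtain ⟨A, rfl⟩ := exists_exp_eq h2
  simp only [← Real.exp_mul, ← Real.exp_add, ← Real.exp_sub, ← Real.exp_neg]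
  congr 1
  field_simp
  ring

/-- For q = (n-1)/(p-1) one has 1 - q = -α, so the q-logarithm is (1 - (r/R)^α)/α, which factors
through the coordinate t. -/
theorem qLog_eq {R r : ℝ} (hp : 1 < p) (hpn : p < n) (hR : 0 < R) (hr : 0 < r) :
    qLog ((n - 1) / (p - 1)) (R / r) =
      radialCoord ((n - p) / (p - 1)) R r * r ^ ((n - p) / (p - 1)) / ((n - p) / (p - 1)) := by
  obtain ⟨h1, h2, h3, h4, h5, h6, h7, h8⟩ := exponent_relations hp hpn
  have hp1 : p - 1 ≠ 0 := by linarith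
  have e : 1 - ((n : ℝ) - 1) / (p - 1) = -((n - p) / (p - 1)) := by field_simp; ring
  rw [qLog, e, radialCoord, Real.div_rpow hR.le hr.le]
  generalize ((n : ℝ) - p) / (p - 1) = A at h2 ⊢
  rw [Real.rpow_neg hr.le]
  have := Real.rpow_pos_of_pos hr A
  field_simp
  ring

/-- With γ = (n-1)p/(n-p) one has αγ = n+α, so the factor |x|^(-αγ) from the logarithmic weight is
exactly the weight of the change of variable and only t^(-γ) remains. -/
theorem logWeightedNorm_eq {R : ℝ} (hp : 1 < p) (hpn : p < n) (hR : 0 < R)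
    {u : EuclideanSpace ℝ (Fin n) → ℝ} {f : ℝ → ℝ} (hf : IsProfile p f)
    (hu : u =ᵐ[volume.restrict (Metric.ball 0 R)] radialFun ((n - p) / (p - 1)) R f) :
    logWeightedNorm p R u = ENNReal.ofReal ((sphereArea n * ((n - p) / (p - 1)) ^
        ((n - 1) * (p / (n - p)) - 1)) ^ (1 / ((n : ℝ) * (p / (n - p))))) *
      (∫⁻ t in Set.Ioi (0 : ℝ), ENNReal.ofReal (|∫ s in (0 : ℝ)..t, f s| ^ (n * (p / (n - p))) *
      t ^ (-((n - 1) * (p / (n - p)))))) ^ (1 / ((n : ℝ) * (p / (n - p)))) := by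
  obtain ⟨h1, h2, h3, h4, h5, h6, h7, h8⟩ := exponent_relations hp hpn
  have hN : 0 < (n : ℝ) := by linarith
  have hn : 0 < n := by exact_mod_cast hN
  have : Nonempty (Fin n) := ⟨⟨0, hn⟩⟩
  have hs := sphereArea_pos hN
  have hq : sobolevConj n p = n * (p / (n - p)) := by rw [sobolevConj]; ring
  have hγ : p * ((n : ℝ) - 1) / (n - p) = (n - 1) * (p / (n - p)) := by ring
  have hαγ : (n - p) / (p - 1) * ((n - 1) * (p / (n - p))) = n + ((n : ℝ) - p) / (p - 1) := by
    have : (n : ℝ) - p ≠ 0 := by linarith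
    have : p - 1 ≠ 0 := by linarith
    field_simp
    ring
  rw [logWeightedNorm, hq, hγ]
  generalize ((n : ℝ) - 1) * (p / (n - p)) = γ at hαγ h5 ⊢
  have hqpos : 0 < (n : ℝ) * (p / (n - p)) := mul_pos hN h3
  generalize (n : ℝ) * (p / (n - p)) = q at hqpos ⊢
  have hqL := fun r hr => qLog_eq (n := n) (p := p) (R := R) (r := r) hp hpn hR hr
  generalize ((n : ℝ) - p) / (p - 1) = A at *
  have hwm : Measurable fun t => ∫ s in (0 : ℝ)..t, f s := (hf.continuous_primitive hp.le).measurable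
  have key : ∫⁻ x in Metric.ball (0 : EuclideanSpace ℝ (Fin n)) R,
      ENNReal.ofReal (|u x| ^ q / qLog ((n - 1) / (p - 1)) (R / ‖x‖) ^ γ) =
      ENNReal.ofReal (sphereArea n * A ^ (γ - 1)) *
        ∫⁻ t in Set.Ioi (0 : ℝ), ENNReal.ofReal (|∫ s in (0 : ℝ)..t, f s| ^ q * t ^ (-γ)) := by
    have h := lintegral_ball_radialCoord hn h2 hR (F := fun t =>
      ENNReal.ofReal (A ^ γ * (|∫ s in (0 : ℝ)..t, f s| ^ q * t ^ (-γ)))) (by fun_prop)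
    calc _ = _ := ?_
      _ = _ := h
      _ = _ := ?_
    · refine lintegral_congr_ae ?_
      filter_upwards [hu, ae_restrict_mem measurableSet_ball, ae_restrict_of_ae
        (compl_mem_ae_iff.2 (measure_singleton (0 : EuclideanSpace ℝ (Fin n))))] with x hx hxb hx0
      have hr : ‖x‖ ∈ Set.Ioo 0 R := ⟨norm_pos_iff.2 hx0, by simpa using hxb⟩
      have ht := radialCoord_pos h2 hr
      have hr0 := hr.1
      rw [← ENNReal.ofReal_mul (by positivity), hx, radialFun, hqL _ hr0, Real.div_rpow
        (by positivity) h2.le, Real.mul_rpow ht.le (by positivity), ← Real.rpow_mul hr0.le, hαγ,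
        Real.rpow_neg hr0.le, Real.rpow_neg ht.le]
      congr 1
      have h1 := Real.rpow_pos_of_pos ht γ
      have h2 := Real.rpow_pos_of_pos hr0 ((n : ℝ) + A)
      field_simp
    · simp_rw [fun t : ℝ => ENNReal.ofReal_mul (q := |∫ s in (0 : ℝ)..t, f s| ^ q * t ^ (-γ))
        (show 0 ≤ A ^ γ by positivity)]
      rw [lintegral_const_mul' _ _ ENNReal.ofReal_ne_top, ← mul_assoc,
        toSphere_univ_eq_sphereArea hn, ← ENNReal.ofReal_mul hs.le,
        ← ENNReal.ofReal_mul (by positivity), Real.rpow_sub_one h2.ne']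
      congr 2
      ring
  rw [key, ENNReal.mul_rpow_of_nonneg _ _ (by positivity),
    ENNReal.ofReal_rpow_of_pos (by positivity)]

theorem ballLpNorm_eq {R : ℝ} (hp : 1 < p) (hpn : p < n) (hR : 0 < R)
    {G : EuclideanSpace ℝ (Fin n) → EuclideanSpace ℝ (Fin n)} {f : ℝ → ℝ} (hf : IsProfile p f)
    (hG : G =ᵐ[volume.restrict (Metric.ball 0 R)] radialField ((n - p) / (p - 1)) R f) :
    ballLpNorm p R G =
      ENNReal.ofReal ((sphereArea n * ((n - p) / (p - 1)) ^ (p - 1)) ^ (1 / p)) *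
        eLpNorm f (ENNReal.ofReal p) (volume.restrict (Set.Ioi 0)) := by
  obtain ⟨h1, h2, h3, h4, h5, h6, h7, h8⟩ := exponent_relations hp hpn
  have hN : 0 < (n : ℝ) := by linarith
  have hn : 0 < n := by exact_mod_cast hN
  have hs := sphereArea_pos hN
  rw [ballLpNorm, eLpNorm_congr_ae hG, ← ballLpNorm, eLpNorm_radialField hn h2 hp hR h8
    hf.measurable, toSphere_univ_eq_sphereArea hn, ← ENNReal.ofReal_mul hs.le,
    ENNReal.ofReal_rpow_of_pos (by positivity)]

end

/-! ### The inequality and its extremal functions. -/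

section
variable {n : ℕ} {p R : ℝ}

theorem radial_sobolev_inequality (hp : 1 < p) (hpn : p < n) (hR : 0 < R)
    {u : EuclideanSpace ℝ (Fin n) → ℝ}
    {G : EuclideanSpace ℝ (Fin n) → EuclideanSpace ℝ (Fin n)}
    (h : MemW1pZero p (Metric.ball 0 R) u G) (hr : IsRadialOnBall R u) :
    ENNReal.ofReal (sobolevConst n p * ((n - p) / (p - 1)) ^ (1 / (n : ℝ) - 1)) *
      logWeightedNorm p R u ≤ ballLpNorm p R G := by
  obtain ⟨h1, h2, h3, h4, h5, h6, h7, h8⟩ := exponent_relations hp hpn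
  have hN : 0 < (n : ℝ) := by linarith
  have hn : 0 < n := by exact_mod_cast hN
  have hs := sphereArea_pos hN
  have hM := blissMass_pos h4 h3 h1 h5
  have hS := sobolevConst_pos hp hpn
  obtain ⟨f, hf, hu, hG⟩ := h.exists_profile hn h2 hp hR h8 hr
  rw [logWeightedNorm_eq hp hpn hR hf hu, ballLpNorm_eq hp hpn hR hf hG]
  have hb := bliss_inequality h1 h4 h3 h5 h6 h7 hM (lintegral_blissMass h4 h3 h1 h5)
    (lintegral_bliss_energy h4 h3 h1 h5) hf.memLp
  have hrel := sobolevConst_relation hp hpn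
  set I := ∫⁻ t in Set.Ioi (0 : ℝ), ENNReal.ofReal (|∫ s in (0 : ℝ)..t, f s| ^ (n * (p / (n - p))) *
      t ^ (-((n - 1) * (p / (n - p)))))
  have hBpos : 0 < (n : ℝ) * ((p - 1) / (n - p)) * blissMass n (p / (n - p)) := by positivity
  rw [ENNReal.ofReal_rpow_of_pos hBpos, ENNReal.ofReal_rpow_of_pos hM] at hb
  have hb0 := Real.rpow_pos_of_pos hBpos (1 / p)
  -- Multiplying by the energy factor lets `sobolevConst_relation` be used without division.
  refine (ENNReal.mul_le_mul_iff_left (ENNReal.ofReal_pos.2 hb0).ne' ENNReal.ofReal_ne_top).1 ?_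
  set c₁ := sobolevConst n p * ((n - p) / (p - 1)) ^ (1 / (n : ℝ) - 1)
  set c₂ := (sphereArea n * ((n - p) / (p - 1)) ^ ((n - 1) * (p / (n - p)) - 1)) ^
    (1 / ((n : ℝ) * (p / (n - p))))
  set c₃ := blissMass n (p / (n - p)) ^ (1 / ((n : ℝ) * (p / (n - p))))
  set c₄ := (sphereArea n * ((n - p) / (p - 1)) ^ (p - 1)) ^ (1 / p)
  set c₅ := ((n : ℝ) * ((p - 1) / (n - p)) * blissMass n (p / (n - p))) ^ (1 / p)
  have hc₁ : 0 ≤ c₁ := by positivity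
  have hc₂ : 0 ≤ c₂ := by positivity
  have hc₄ : 0 ≤ c₄ := by positivity
  calc ENNReal.ofReal c₁ * (ENNReal.ofReal c₂ * I ^ (1 / ((n : ℝ) * (p / (n - p))))) *
        ENNReal.ofReal c₅ = ENNReal.ofReal c₁ * ENNReal.ofReal c₂ *
        (I ^ (1 / ((n : ℝ) * (p / (n - p)))) * ENNReal.ofReal c₅) := by ring
    _ ≤ ENNReal.ofReal c₁ * ENNReal.ofReal c₂ * (ENNReal.ofReal c₃ *
        eLpNorm f (ENNReal.ofReal p) (volume.restrict (Set.Ioi 0))) := mul_le_mul_right hb _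
    _ = ENNReal.ofReal (c₁ * (c₂ * c₃)) *
        eLpNorm f (ENNReal.ofReal p) (volume.restrict (Set.Ioi 0)) := by
        rw [ENNReal.ofReal_mul hc₁, ENNReal.ofReal_mul hc₂]; ring
    _ = _ := by rw [hrel, ENNReal.ofReal_mul hc₄]; ring

/-- The profile of the extremal functions. -/
noncomputable def talentiProfile (n : ℕ) (p a b t : ℝ) : ℝ :=
  if 0 < t then b * (a * t ^ (p / (n - p)) + b) ^ (-(n / p)) else 0

section extremal
variable {a b : ℝ}

/-- Differentiating the right side gives two terms; because δ(p-n) = -p their t^δ parts cancel and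
the profile is left. -/
theorem primitive_talentiProfile (hp : 1 < p) (hpn : p < n) (ha : 0 < a) (hb : 0 < b) {t : ℝ}
    (ht : 0 < t) : ∫ s in (0 : ℝ)..t, talentiProfile n p a b s =
      t * (a * t ^ (p / (n - p)) + b) ^ (1 - n / p) := by
  obtain ⟨h1, h2, h3, h4, h5, h6, h7, h8⟩ := exponent_relations hp hpn
  have hnp : 0 < n - p := by linarith
  have hp0 : 0 < p := by linarith
  have hδ : p / (n - p) * (1 - n / p) = -1 := by field_simp; ring
  have hδ' : p / (n - p) * (p - n) = -p := by field_simp; ring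
  have hT : ∀ s, 0 < s → talentiProfile n p a b s = b * (a * s ^ (p / (n - p)) + b) ^ (-(n / p)) :=
    fun s hs => by rw [talentiProfile, if_pos hs]
  generalize p / (n - p) = δ at h3 hδ hδ' hT ⊢
  have hF : ∀ s ∈ Set.Ioi (0 : ℝ), 0 < a * s ^ δ + b := fun s hs => by
    have : 0 < s := hs
    positivity
  have hbc : ContinuousOn (fun s : ℝ => a * s ^ δ + b) (Set.Icc 0 t) :=
    (continuousOn_const.mul (continuousOn_id.rpow_const fun s hs => Or.inr h3.le)).add
      continuousOn_const
  have hcont : ContinuousOn (fun s : ℝ => s * (a * s ^ δ + b) ^ (1 - n / p)) (Set.Icc 0 t) := by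
    refine continuousOn_id.mul (hbc.rpow_const fun s hs => Or.inl ?_)
    have := hs.1
    exact (by positivity : 0 < a * s ^ δ + b).ne'
  have hd : ∀ s ∈ Set.Ioo 0 t, HasDerivAt (fun s : ℝ => s * (a * s ^ δ + b) ^ (1 - n / p))
      (b * (a * s ^ δ + b) ^ (-(n / p))) s := fun s hs => by
    have hs0 := hs.1
    have hpos := hF s hs0
    have e := (hasDerivAt_id s).mul (((((Real.hasDerivAt_rpow_const (x := s) (p := δ)
      (Or.inl hs0.ne')).const_mul a).add_const b)).rpow_const (p := 1 - n / p) (Or.inl hpos.ne'))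
    refine e.congr_deriv ?_
    simp only [id]
    rw [show 1 - n / p - 1 = -((n : ℝ) / p) by ring,
      show (1 : ℝ) - n / p = -(n / p) + 1 by ring, Real.rpow_add_one hpos.ne',
      Real.rpow_sub_one hs0.ne', show -((n : ℝ) / p) + 1 = 1 - n / p by ring]
    field_simp
    linear_combination a * s ^ δ * hδ'
  rw [intervalIntegral.integral_of_le ht.le, setIntegral_congr_fun (g := fun s =>
    b * (a * s ^ δ + b) ^ (-(n / p))) measurableSet_Ioc fun s hs => hT s hs.1,
    ← intervalIntegral.integral_of_le ht.le,
    intervalIntegral.integral_eq_sub_of_hasDerivAt_of_le ht.le hcont hd, zero_mul, sub_zero]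
  · refine ContinuousOn.intervalIntegrable ?_
    rw [Set.uIcc_of_le ht.le]
    refine continuousOn_const.mul (hbc.rpow_const fun s hs => Or.inl ?_)
    have := hs.1
    exact (by positivity : 0 < a * s ^ δ + b).ne'

theorem eLpNorm_talentiProfile (hp : 1 < p) (hpn : p < n) (ha : 0 < a) (hb : 0 < b) :
    eLpNorm (talentiProfile n p a b) (ENNReal.ofReal p) (volume.restrict (Set.Ioi 0)) =
      ENNReal.ofReal ((b ^ p * (b ^ (-(n : ℝ)) * (b / a) ^ (1 / (p / (n - p)))) *
        (n * ((p - 1) / (n - p)) * blissMass n (p / (n - p)))) ^ (1 / p)) := by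
  obtain ⟨h1, h2, h3, h4, h5, h6, h7, h8⟩ := exponent_relations hp hpn
  have hM := blissMass_pos h4 h3 h1 h5
  have hp0 : 0 < p := by linarith
  have hN : 0 < (n : ℝ) := by linarith
  have hext := lintegral_extremal (N := n) (s := 0) ha hb h3
  simp only [Real.rpow_zero, one_mul, zero_add] at hext
  rw [lintegral_bliss_energy h4 h3 h1 h5, ← ENNReal.ofReal_mul (by positivity)] at hext
  rw [eLpNorm_ofReal_eq_lintegral hp0, ← ENNReal.ofReal_rpow_of_pos (by positivity), mul_assoc,
    ENNReal.ofReal_mul (by positivity), ← hext, ← lintegral_const_mul' _ _ ENNReal.ofReal_ne_top]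
  congr 1
  refine setLIntegral_congr_fun measurableSet_Ioi fun t ht => ?_
  have ht' : 0 < t := ht
  have hpos : 0 < a * t ^ (p / (n - p)) + b := by positivity
  rw [talentiProfile, if_pos ht', Real.norm_of_nonneg (by positivity),
    Real.mul_rpow hb.le (by positivity), ← Real.rpow_mul hpos.le, neg_mul,
    div_mul_cancel₀ _ hp0.ne', ENNReal.ofReal_mul (by positivity)]

theorem isProfile_talentiProfile (hp : 1 < p) (hpn : p < n) (ha : 0 < a) (hb : 0 < b) :
    IsProfile p (talentiProfile n p a b) := by
  have hm : Measurable (talentiProfile n p a b) := by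
    unfold talentiProfile
    exact Measurable.ite measurableSet_Ioi (by fun_prop) measurable_const
  refine ⟨hm, fun t ht => if_neg (not_lt.2 ht), hm.aestronglyMeasurable, ?_⟩
  rw [eLpNorm_talentiProfile hp hpn ha hb]
  exact ENNReal.ofReal_lt_top

/-- The integrand collapses to t^δ (a t^δ + b)^(-n), the mass density up to a dilation. -/
theorem lintegral_primitive_talentiProfile (hp : 1 < p) (hpn : p < n) (ha : 0 < a) (hb : 0 < b) :
    ∫⁻ t in Set.Ioi (0 : ℝ), ENNReal.ofReal
      (|∫ s in (0 : ℝ)..t, talentiProfile n p a b s| ^ (n * (p / (n - p))) *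
      t ^ (-((n - 1) * (p / (n - p))))) =
    ENNReal.ofReal (b ^ (-(n : ℝ)) * (b / a) ^ ((p / (n - p) + 1) / (p / (n - p))) *
      blissMass n (p / (n - p))) := by
  obtain ⟨h1, h2, h3, h4, h5, h6, h7, h8⟩ := exponent_relations hp hpn
  have hM := blissMass_pos h4 h3 h1 h5
  have hp0 : 0 < p := by linarith
  have hnp : 0 < n - p := by linarith
  have hN : 0 < (n : ℝ) := by linarith
  have hext := lintegral_extremal (N := n) (s := p / (n - p)) ha hb h3
  rw [lintegral_blissMass h4 h3 h1 h5, ← ENNReal.ofReal_mul (by positivity)] at hext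
  rw [← hext]
  refine setLIntegral_congr_fun measurableSet_Ioi fun t ht => ?_
  have ht' : 0 < t := ht
  have hpos : 0 < a * t ^ (p / (n - p)) + b := by positivity
  rw [primitive_talentiProfile hp hpn ha hb ht', abs_of_pos (by positivity),
    Real.mul_rpow ht'.le (by positivity), ← Real.rpow_mul hpos.le, mul_right_comm,
    ← Real.rpow_add ht']
  congr 3
  · ring
  · field_simp
    ring

/-- Taking t^δ out of a t^δ + b leaves a + b t^(-δ), and δ(1 - n/p) = -1 cancels the prefactor t. -/
theorem radialFun_talentiProfile (hp : 1 < p) (hpn : p < n) (ha : 0 < a)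
    (hb : 0 < b) {x : EuclideanSpace ℝ (Fin n)} (hx0 : x ≠ 0) (hx : ‖x‖ < R) :
    talentiBall p R a b x = radialFun ((n - p) / (p - 1)) R (talentiProfile n p a b) x := by
  obtain ⟨h1, h2, h3, h4, h5, h6, h7, h8⟩ := exponent_relations hp hpn
  have hp0 : 0 < p := by linarith
  have hnp : 0 < n - p := by linarith
  have hr : ‖x‖ ∈ Set.Ioo 0 R := ⟨norm_pos_iff.2 hx0, hx⟩
  have ht := radialCoord_pos h2 hr
  have hR : 0 < R := hr.1.trans hr.2
  rw [talentiBall, if_neg hx0, radialFun, primitive_talentiProfile hp hpn ha hb ht]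
  have e : 1 / ‖x‖ ^ (((n : ℝ) - p) / (p - 1)) - 1 / R ^ (((n : ℝ) - p) / (p - 1)) =
      radialCoord ((n - p) / (p - 1)) R ‖x‖ := by
    rw [radialCoord, Real.rpow_neg (norm_nonneg _), Real.rpow_neg hR.le, one_div, one_div]
  rw [e]
  generalize radialCoord (((n : ℝ) - p) / (p - 1)) R ‖x‖ = t at ht ⊢
  have h9 : a * t ^ (p / ((n : ℝ) - p)) + b =
      t ^ (p / ((n : ℝ) - p)) * (a + b * t ^ (-(p / ((n : ℝ) - p)))) := by
    rw [Real.rpow_neg ht.le]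
    have := Real.rpow_pos_of_pos ht (p / ((n : ℝ) - p))
    field_simp
  have h10 : p / ((n : ℝ) - p) * (1 - n / p) = -1 := by field_simp; ring
  rw [h9, Real.mul_rpow (by positivity) (by positivity), ← Real.rpow_mul ht.le, h10,
    Real.rpow_neg_one]
  field_simp

theorem talentiBall_extremal (hp : 1 < p) (hpn : p < n) (hR : 0 < R) (ha : 0 < a) (hb : 0 < b) :
    IsRadialOnBall R (talentiBall (n := n) p R a b) ∧
      ∃ G : EuclideanSpace ℝ (Fin n) → EuclideanSpace ℝ (Fin n),
        MemW1pZero p (Metric.ball 0 R) (talentiBall p R a b) G ∧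
        ballLpNorm p R G ≠ 0 ∧ ballLpNorm p R G ≠ ∞ ∧
        ENNReal.ofReal (sobolevConst n p * ((n - p) / (p - 1)) ^ (1 / (n : ℝ) - 1)) *
          logWeightedNorm (n := n) p R (talentiBall p R a b) = ballLpNorm p R G := by
  obtain ⟨h1, h2, h3, h4, h5, h6, h7, h8⟩ := exponent_relations hp hpn
  have hN : 0 < (n : ℝ) := by linarith
  have hn : 0 < n := by exact_mod_cast hN
  have : Nonempty (Fin n) := ⟨⟨0, hn⟩⟩
  have hp0 : 0 < p := by linarith
  have hnp : 0 < n - p := by linarith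
  have hs := sphereArea_pos hN
  have hM := blissMass_pos h4 h3 h1 h5
  have hS := sobolevConst_pos hp hpn
  have hf := isProfile_talentiProfile hp hpn ha hb
  have hu : talentiBall (n := n) p R a b =ᵐ[volume.restrict (Metric.ball 0 R)]
      radialFun ((n - p) / (p - 1)) R (talentiProfile n p a b) := by
    filter_upwards [ae_restrict_mem measurableSet_ball, ae_restrict_of_ae (compl_mem_ae_iff.2
      (measure_singleton (0 : EuclideanSpace ℝ (Fin n))))] with x hx hx0
    exact radialFun_talentiProfile hp hpn ha hb hx0 (by simpa using hx)
  have hG := ballLpNorm_eq (G := radialField ((n - p) / (p - 1)) R (talentiProfile n p a b))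
    hp hpn hR hf (ae_eq_refl _)
  rw [eLpNorm_talentiProfile hp hpn ha hb, ← ENNReal.ofReal_mul (by positivity)] at hG
  refine ⟨⟨fun r => ∫ s in (0 : ℝ)..radialCoord ((n - p) / (p - 1)) R r,
      talentiProfile n p a b s, hu⟩, _,
    (hf.memW1pZero hn h2 hp hR h8).congr hu.symm (ae_eq_refl _), ?_, ?_, ?_⟩
  · rw [hG]
    exact (ENNReal.ofReal_pos.2 (by positivity)).ne'
  · rw [hG]
    exact ENNReal.ofReal_ne_top
  · rw [hG, logWeightedNorm_eq hp hpn hR hf hu, lintegral_primitive_talentiProfile hp hpn ha hb,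
      ENNReal.ofReal_rpow_of_pos (by positivity), ← ENNReal.ofReal_mul (by positivity),
      ← ENNReal.ofReal_mul (by positivity)]
    congr 1
    have hrel := sobolevConst_relation hp hpn
    have hB : 0 < (n : ℝ) * ((p - 1) / (n - p)) := by positivity
    rw [Real.mul_rpow (y := blissMass n (p / (n - p))) (by positivity) hM.le,
      Real.mul_rpow (y := (n : ℝ) * ((p - 1) / (n - p)) * blissMass n (p / (n - p)))
        (by positivity) (by positivity)]
    -- Both sides depend on a and b through the same factor, so equality holds for all parameters
    -- once it holds for the constants.
    have e : (b ^ (-(n : ℝ)) * (b / a) ^ ((p / (n - p) + 1) / (p / (n - p)))) ^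
        (1 / ((n : ℝ) * (p / (n - p)))) =
        (b ^ p * (b ^ (-(n : ℝ)) * (b / a) ^ (1 / (p / (n - p))))) ^ (1 / p) := by
      obtain ⟨x, rfl⟩ := exists_exp_eq hb
      obtain ⟨y, rfl⟩ := exists_exp_eq ha
      simp only [← Real.exp_mul, ← Real.exp_add, ← Real.exp_sub]
      congr 1
      field_simp
      ring
    rw [e]
    linear_combination (b ^ p * (b ^ (-(n : ℝ)) * (b / a) ^ (1 / (p / (n - p))))) ^ (1 / p) * hrel

end extremal
end

/-! ### Invariance under the nonlinear scaling. -/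

/-- The dilation of a profile that preserves its `L^p` norm. -/
noncomputable def dilateProfile (p μ : ℝ) (f : ℝ → ℝ) (t : ℝ) : ℝ := μ ^ (1 / p) * f (μ * t)

section dilation
variable {n : ℕ} {p R μ : ℝ} {f : ℝ → ℝ}

theorem eLpNorm_dilateProfile (hp : 0 < p) (hμ : 0 < μ) (f : ℝ → ℝ) :
    eLpNorm (dilateProfile p μ f) (ENNReal.ofReal p) (volume.restrict (Set.Ioi 0)) =
      eLpNorm f (ENNReal.ofReal p) (volume.restrict (Set.Ioi 0)) := by
  rw [eLpNorm_ofReal_eq_lintegral hp, eLpNorm_ofReal_eq_lintegral hp,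
    lintegral_Ioi_comp_mul hμ (fun t => ENNReal.ofReal (‖f t‖ ^ p)),
    ← lintegral_const_mul' _ _ ENNReal.ofReal_ne_top]
  congr 1
  refine lintegral_congr fun t => ?_
  rw [dilateProfile, norm_mul, Real.mul_rpow (norm_nonneg _) (norm_nonneg _),
    Real.norm_of_nonneg (by positivity), ← Real.rpow_mul hμ.le, one_div_mul_cancel hp.ne',
    Real.rpow_one, ENNReal.ofReal_mul hμ.le]

theorem IsProfile.dilate (hp : 0 < p) (hμ : 0 < μ) (hf : IsProfile p f) :
    IsProfile p (dilateProfile p μ f) := by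
  have hm : Measurable (dilateProfile p μ f) := by
    have := hf.measurable
    unfold dilateProfile
    fun_prop
  refine ⟨hm, fun t ht => ?_, hm.aestronglyMeasurable, ?_⟩
  · rw [dilateProfile, hf.eq_zero _ (mul_nonpos_of_nonneg_of_nonpos hμ.le ht), mul_zero]
  · rw [eLpNorm_dilateProfile hp hμ]
    exact hf.memLp.2

/-- The exponent 1/p - 1 = -(p-1)/p is the prefactor in the definition of the scaling. -/
theorem primitive_dilateProfile (hp : 0 < p) (hμ : 0 < μ) (t : ℝ) :
    ∫ s in (0 : ℝ)..t, dilateProfile p μ f s =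
      μ ^ (-((p - 1) / p)) * ∫ s in (0 : ℝ)..μ * t, f s := by
  unfold dilateProfile
  rw [intervalIntegral.integral_const_mul, intervalIntegral.integral_comp_mul_left f hμ.ne',
    mul_zero, smul_eq_mul, ← mul_assoc, ← Real.rpow_neg_one, ← Real.rpow_add hμ]
  congr 2
  field_simp
  ring

/-- The factor from the scaled primitive, μ^(-(p-1)/p) to the power np/(n-p), equals μ^(1-γ) with γ
= (n-1)p/(n-p), and cancels the change of t^(-γ) dt under dilation. -/
theorem lintegral_primitive_dilateProfile (hp : 1 < p) (hpn : p < n) (hμ : 0 < μ) :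
    ∫⁻ t in Set.Ioi (0 : ℝ), ENNReal.ofReal
        (|∫ s in (0 : ℝ)..t, dilateProfile p μ f s| ^ (n * (p / (n - p))) *
          t ^ (-((n - 1) * (p / (n - p))))) =
      ∫⁻ t in Set.Ioi (0 : ℝ), ENNReal.ofReal (|∫ s in (0 : ℝ)..t, f s| ^ (n * (p / (n - p))) *
          t ^ (-((n - 1) * (p / (n - p))))) := by
  rw [lintegral_Ioi_comp_mul hμ (fun t => ENNReal.ofReal
    (|∫ s in (0 : ℝ)..t, f s| ^ (n * (p / (n - p))) * t ^ (-((n - 1) * (p / (n - p)))))),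
    ← lintegral_const_mul' _ _ ENNReal.ofReal_ne_top]
  refine setLIntegral_congr_fun measurableSet_Ioi fun t ht => ?_
  have ht' : 0 < t := ht
  have hnp : 0 < n - p := by linarith
  have hp0 : 0 < p := by linarith
  rw [primitive_dilateProfile hp0 hμ, ← ENNReal.ofReal_mul hμ.le, abs_mul,
    Real.mul_rpow (abs_nonneg _) (abs_nonneg _), abs_of_pos (by positivity : 0 < μ ^ (-((p - 1) / p))),
    ← Real.rpow_mul hμ.le, Real.mul_rpow hμ.le ht'.le]
  congr 1
  have e : μ ^ (-((p - 1) / p) * (n * (p / (n - p)))) = μ * μ ^ (-((n - 1) * (p / (n - p)))) := by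
    rw [← Real.rpow_one_add' hμ.le]
    · congr 1
      field_simp
      ring
    · have : 1 + -((n - 1) * (p / (n - p))) = -(n * (p - 1) / (n - p)) := by field_simp; ring
      rw [this]
      have : 0 < n * (p - 1) / (n - p) := by
        have : 0 < p - 1 := by linarith
        have : (0 : ℝ) < n := by linarith
        positivity
      linarith
  rw [e]
  ring

/-- As μ r^(-α) + (1-μ) R^(-α) = μ t + R^(-α), the nonlinear scaling is multiplication of t by μ
along each ray. -/
theorem scaledPoint_eq {x : EuclideanSpace ℝ (Fin n)} :
    scaledPoint p R μ x = (radialCoordInv ((n - p) / (p - 1)) R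
      (μ * radialCoord ((n - p) / (p - 1)) R ‖x‖) * ‖x‖⁻¹) • x := by
  rw [scaledPoint, radialCoordInv, radialCoord, smul_smul, one_div_div]
  congr 3
  ring

theorem norm_scaledPoint (hp : 1 < p) (hpn : p < n) (hR : 0 < R) (hμ : 0 < μ)
    {x : EuclideanSpace ℝ (Fin n)} (hx : x ∈ Metric.ball 0 R \ {0}) :
    ‖scaledPoint p R μ x‖ = radialCoordInv ((n - p) / (p - 1)) R
      (μ * radialCoord ((n - p) / (p - 1)) R ‖x‖) := by
  obtain ⟨h1, h2, -⟩ := exponent_relations hp hpn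
  have hx0 : 0 < ‖x‖ := norm_pos_iff.2 hx.2
  have hτ := radialCoord_pos h2 ⟨hx0, mem_ball_zero_iff.1 hx.1⟩
  have hρ := radialCoordInv_mem h2 hR (mul_pos hμ hτ)
  rw [scaledPoint_eq, norm_smul, norm_mul, norm_inv, norm_norm, mul_assoc,
    inv_mul_cancel₀ hx0.ne', mul_one, Real.norm_of_nonneg hρ.1.le]

theorem scaledPoint_mem (hp : 1 < p) (hpn : p < n) (hR : 0 < R) (hμ : 0 < μ)
    {x : EuclideanSpace ℝ (Fin n)} (hx : x ∈ Metric.ball 0 R \ {0}) :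
    scaledPoint p R μ x ∈ Metric.ball 0 R \ {0} := by
  obtain ⟨h1, h2, -⟩ := exponent_relations hp hpn
  have hx0 : 0 < ‖x‖ := norm_pos_iff.2 hx.2
  have hτ := radialCoord_pos h2 ⟨hx0, mem_ball_zero_iff.1 hx.1⟩
  have hρ := radialCoordInv_mem h2 hR (mul_pos hμ hτ)
  rw [← norm_scaledPoint hp hpn hR hμ hx] at hρ
  exact ⟨mem_ball_zero_iff.2 hρ.2, norm_pos_iff.1 hρ.1⟩

theorem radialCoord_scaledPoint (hp : 1 < p) (hpn : p < n) (hR : 0 < R) (hμ : 0 < μ)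
    {x : EuclideanSpace ℝ (Fin n)} (hx : x ∈ Metric.ball 0 R \ {0}) :
    radialCoord ((n - p) / (p - 1)) R ‖scaledPoint p R μ x‖ =
      μ * radialCoord ((n - p) / (p - 1)) R ‖x‖ := by
  obtain ⟨h1, h2, -⟩ := exponent_relations hp hpn
  have hτ := radialCoord_pos h2 ⟨norm_pos_iff.2 hx.2, mem_ball_zero_iff.1 hx.1⟩
  rw [norm_scaledPoint hp hpn hR hμ hx, radialCoord_radialCoordInv h2 hR (mul_pos hμ hτ)]

theorem scaledPoint_inv_scaledPoint (hp : 1 < p) (hpn : p < n) (hR : 0 < R) (hμ : 0 < μ)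
    {x : EuclideanSpace ℝ (Fin n)} (hx : x ∈ Metric.ball 0 R \ {0}) :
    scaledPoint p R μ⁻¹ (scaledPoint p R μ x) = x := by
  obtain ⟨h1, h2, -⟩ := exponent_relations hp hpn
  have hx0 : 0 < ‖x‖ := norm_pos_iff.2 hx.2
  have hτ := radialCoord_pos h2 ⟨hx0, mem_ball_zero_iff.1 hx.1⟩
  have hρ := radialCoordInv_mem h2 hR (mul_pos hμ hτ)
  rw [scaledPoint_eq, radialCoord_scaledPoint hp hpn hR hμ hx, norm_scaledPoint hp hpn hR hμ hx,
    inv_mul_cancel_left₀ hμ.ne', radialCoordInv_radialCoord h2 hx0, scaledPoint_eq, smul_smul]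
  have h3 := hρ.1.ne'
  have h4 := hx0.ne'
  generalize radialCoordInv ((n - p) / (p - 1)) R (μ * radialCoord ((n - p) / (p - 1)) R ‖x‖) = ρ at h3 ⊢
  rw [show ‖x‖ * ρ⁻¹ * (ρ * ‖x‖⁻¹) = 1 by field_simp, one_smul]

theorem differentiableOn_scaledPoint (hp : 1 < p) (hpn : p < n) (hR : 0 < R) (hμ : 0 < μ) :
    DifferentiableOn ℝ (scaledPoint (n := n) p R μ) (Metric.ball 0 R \ {0}) := by
  obtain ⟨h1, h2, -⟩ := exponent_relations hp hpn
  intro x hx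
  have hx0 : 0 < ‖x‖ := norm_pos_iff.2 hx.2
  have hτ := radialCoord_pos h2 ⟨hx0, mem_ball_zero_iff.1 hx.1⟩
  have hN : DifferentiableAt ℝ (fun y : EuclideanSpace ℝ (Fin n) => ‖y‖) x :=
    (hasFDerivAt_norm_of_ne_zero hx.2).differentiableAt
  have hC : DifferentiableAt ℝ (fun y : EuclideanSpace ℝ (Fin n) =>
      μ * radialCoord ((n - p) / (p - 1)) R ‖y‖) x :=
    ((hasDerivAt_radialCoord hx0).differentiableAt.comp x hN).const_mul μ
  have hI := (hasDerivAt_radialCoordInv h2 hR (mul_pos hμ hτ)).differentiableAt.comp x hC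
  have he : scaledPoint (n := n) p R μ = fun x => (radialCoordInv ((n - p) / (p - 1)) R
      (μ * radialCoord ((n - p) / (p - 1)) R ‖x‖) * ‖x‖⁻¹) • x :=
    funext fun x => scaledPoint_eq
  rw [he]
  exact ((hI.mul (hN.inv hx0.ne')).smul differentiableAt_id).differentiableWithinAt

/-- Since u is known only almost everywhere, composing it with the scaling requires preimages of
null sets to be null. Away from the origin such a preimage lies in the image of the null set under
the inverse scaling, which is differentiable. -/
theorem ae_ball_comp_scaledPoint (hp : 1 < p) (hpn : p < n) (hR : 0 < R) (hμ : 0 < μ)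
    {P : EuclideanSpace ℝ (Fin n) → Prop}
    (hP : ∀ᵐ x ∂volume.restrict (Metric.ball (0 : EuclideanSpace ℝ (Fin n)) R), P x) :
    ∀ᵐ x ∂volume.restrict (Metric.ball (0 : EuclideanSpace ℝ (Fin n)) R),
      x ≠ 0 → P (scaledPoint p R μ x) := by
  rw [ae_restrict_iff' measurableSet_ball] at hP ⊢
  have hd := (differentiableOn_scaledPoint (n := n) hp hpn hR (inv_pos.2 hμ)).mono
    (Set.inter_subset_left (t := {x | ¬(x ∈ Metric.ball 0 R → P x)}))
  refine measure_mono_null ?_ (addHaar_image_eq_zero_of_differentiableOn_of_addHaar_eq_zero volume hd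
    (measure_mono_null Set.inter_subset_right hP))
  intro x hx
  simp only [Set.mem_compl_iff, Set.mem_ofPred_eq, Classical.not_imp] at hx
  have hx' : x ∈ Metric.ball 0 R \ {0} := ⟨hx.1, hx.2.1⟩
  have hm := scaledPoint_mem hp hpn hR hμ hx'
  exact ⟨_, ⟨hm, fun h => hx.2.2 (h hm.1)⟩, scaledPoint_inv_scaledPoint hp hpn hR hμ hx'⟩

theorem scaledFun_ae_eq (hn : 0 < n) (hp : 1 < p) (hpn : p < n) (hR : 0 < R) (hμ : 0 < μ)
    {u : EuclideanSpace ℝ (Fin n) → ℝ}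
    (hu : u =ᵐ[volume.restrict (Metric.ball 0 R)] radialFun ((n - p) / (p - 1)) R f) :
    scaledFun p R μ u =ᵐ[volume.restrict (Metric.ball 0 R)]
      radialFun ((n - p) / (p - 1)) R (dilateProfile p μ f) := by
  have : Nonempty (Fin n) := ⟨⟨0, hn⟩⟩
  filter_upwards [ae_ball_comp_scaledPoint hp hpn hR hμ hu, ae_restrict_mem measurableSet_ball,
    ae_restrict_of_ae (Measure.ae_ne volume (0 : EuclideanSpace ℝ (Fin n)))] with x h1 h2 h3
  rw [scaledFun, h1 h3, radialFun, radialFun, primitive_dilateProfile (by linarith) hμ,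
    radialCoord_scaledPoint hp hpn hR hμ ⟨h2, h3⟩]

theorem scaledFun_invariance (hp : 1 < p) (hpn : p < n) (hR : 0 < R) (hμ : 0 < μ)
    {u : EuclideanSpace ℝ (Fin n) → ℝ} {G : EuclideanSpace ℝ (Fin n) → EuclideanSpace ℝ (Fin n)}
    (h : MemW1pZero p (Metric.ball 0 R) u G) (hr : IsRadialOnBall R u) :
    IsRadialOnBall R (scaledFun p R μ u) ∧
      ∃ Gμ : EuclideanSpace ℝ (Fin n) → EuclideanSpace ℝ (Fin n),
        MemW1pZero p (Metric.ball 0 R) (scaledFun p R μ u) Gμ ∧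
        logWeightedNorm p R (scaledFun p R μ u) = logWeightedNorm p R u ∧
        ballLpNorm p R Gμ = ballLpNorm p R G := by
  obtain ⟨h1, h2, h3, h4, h5, h6, h7, h8⟩ := exponent_relations hp hpn
  have hp0 : 0 < p := by linarith
  have hn : 0 < n := by exact_mod_cast (by linarith : (0 : ℝ) < n)
  obtain ⟨f, hf, hu, hG⟩ := h.exists_profile hn h2 hp hR h8 hr
  have hs := scaledFun_ae_eq hn hp hpn hR hμ hu
  have hd := hf.dilate hp0 hμ
  refine ⟨⟨fun r => ∫ s in (0 : ℝ)..radialCoord ((n - p) / (p - 1)) R r, dilateProfile p μ f s, hs⟩,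
    _, (hd.memW1pZero hn h2 hp hR h8).congr hs.symm .rfl, ?_, ?_⟩
  · rw [logWeightedNorm_eq hp hpn hR hd hs, logWeightedNorm_eq hp hpn hR hf hu,
      lintegral_primitive_dilateProfile hp hpn hμ]
  · rw [ballLpNorm_eq hp hpn hR hd .rfl, ballLpNorm_eq hp hpn hR hf hG,
      eLpNorm_dilateProfile hp0 hμ]

end dilation

/-! ### Optimality and the final statement. -/

/-- Tested on the extremal with a = b = 1: equality and a finite nonzero gradient norm make its
weighted norm finite and nonzero, so it cancels. -/
theorem radial_sobolev_optimal {n : ℕ} {p R : ℝ} (hp : 1 < p) (hpn : p < n) (hR : 0 < R) {C : ℝ}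
    (hC : ∀ (u : EuclideanSpace ℝ (Fin n) → ℝ)
      (G : EuclideanSpace ℝ (Fin n) → EuclideanSpace ℝ (Fin n)),
      MemW1pZero p (Metric.ball 0 R) u G → IsRadialOnBall R u →
        ENNReal.ofReal C * logWeightedNorm p R u ≤ ballLpNorm p R G) :
    C ≤ sobolevConst n p * ((n - p) / (p - 1)) ^ (1 / (n : ℝ) - 1) := by
  obtain ⟨-, h2, -⟩ := exponent_relations hp hpn
  have hS : 0 < sobolevConst n p * ((n - p) / (p - 1)) ^ (1 / (n : ℝ) - 1) :=
    mul_pos (sobolevConst_pos hp hpn) (by positivity)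
  obtain ⟨hr, G, hG, h0, htop, he⟩ := talentiBall_extremal hp hpn hR one_pos one_pos
  have h := hC _ _ hG hr
  rw [← he] at h h0 htop
  have hN0 := right_ne_zero_of_mul h0
  have hNtop := fun e => htop ((congrArg _ e).trans (ENNReal.mul_top (left_ne_zero_of_mul h0)))
  rwa [ENNReal.mul_le_mul_iff_left hN0 hNtop, ENNReal.ofReal_le_ofReal_iff hS.le] at h

theorem mainTheorem3 (n : ℕ) (p R : ℝ) (hn : 2 ≤ n) (hp : 1 < p) (hpn : p < n) (hR : 0 < R) :
    -- the inequality
    (∀ (u : EuclideanSpace ℝ (Fin n) → ℝ) (G : EuclideanSpace ℝ (Fin n) → EuclideanSpace ℝ (Fin n)),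
      MemW1pZero p (Metric.ball 0 R) u G → IsRadialOnBall R u →
        ENNReal.ofReal (sobolevConst n p * ((n - p) / (p - 1)) ^ (1 / (n : ℝ) - 1)) *
          logWeightedNorm p R u ≤ ballLpNorm p R G) ∧
    -- the constant is optimal
    (∀ C : ℝ,
      (∀ (u : EuclideanSpace ℝ (Fin n) → ℝ)
          (G : EuclideanSpace ℝ (Fin n) → EuclideanSpace ℝ (Fin n)),
        MemW1pZero p (Metric.ball 0 R) u G → IsRadialOnBall R u →
          ENNReal.ofReal C * logWeightedNorm p R u ≤ ballLpNorm p R G) →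
      C ≤ sobolevConst n p * ((n - p) / (p - 1)) ^ (1 / (n : ℝ) - 1)) ∧
    -- the constant is attained
    (∀ a b : ℝ, 0 < a → 0 < b →
      IsRadialOnBall R (talentiBall (n := n) p R a b) ∧
      ∃ G : EuclideanSpace ℝ (Fin n) → EuclideanSpace ℝ (Fin n),
        MemW1pZero p (Metric.ball 0 R) (talentiBall p R a b) G ∧
        ballLpNorm p R G ≠ 0 ∧
        ENNReal.ofReal (sobolevConst n p * ((n - p) / (p - 1)) ^ (1 / (n : ℝ) - 1)) *
          logWeightedNorm (n := n) p R (talentiBall p R a b) = ballLpNorm p R G) ∧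
    -- both sides of the inequality are invariant under the scaling
    (∀ μ : ℝ, 0 < μ →
      ∀ (u : EuclideanSpace ℝ (Fin n) → ℝ)
        (G : EuclideanSpace ℝ (Fin n) → EuclideanSpace ℝ (Fin n)),
        MemW1pZero p (Metric.ball 0 R) u G → IsRadialOnBall R u →
          IsRadialOnBall R (scaledFun p R μ u) ∧
          ∃ Gμ : EuclideanSpace ℝ (Fin n) → EuclideanSpace ℝ (Fin n),
            MemW1pZero p (Metric.ball 0 R) (scaledFun p R μ u) Gμ ∧
            logWeightedNorm p R (scaledFun p R μ u) = logWeightedNorm p R u ∧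
            ballLpNorm p R Gμ = ballLpNorm p R G) := by
  exact ⟨fun u G h hr => radial_sobolev_inequality hp hpn hR h hr,
    fun C hC => radial_sobolev_optimal hp hpn hR hC,
    fun a b ha hb => by
      obtain ⟨hr, G, hG, h0, -, he⟩ := talentiBall_extremal hp hpn hR ha hb
      exact ⟨hr, G, hG, h0, he⟩,
    fun μ hμ u G h hr => scaledFun_invariance hp hpn hR hμ h hr⟩
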